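/- Let $d$ be a dimension. The Gelfand--Shilov space $\Sigma_1(\mathbf R^d)$ consists of all $f\in C^\infty(\mathbf R^d)$ such that $$\|f\|_{[h]}=\sup_{\alpha,\beta\in\mathbf N^d}\frac{\|x^\alpha D^\beta f\|_{L^\infty}}{h^{|\alpha+\beta|}\,\alpha!\,\beta!}$$ is finite for every $h>0$, with the Fréchet topology defined by these semi-norms; $\Sigma_1'(\mathbf R^d)$ is its topological dual, and $f\in\Sigma_1(\mathbf R^d)$ is identified with the functional $g\mapsto\int fg\,dx$. The short-time Fourier transform of $f\in\Sigma_1'(\mathbf R^d)$ with window $\phi\in\Sigma_1(\mathbf R^d)$ is $$V_\phi f(x,\xi)=(2\pi)^{-d/2}\bigl(f,\phi(\cdot-x)e^{i\langle\cdot,\xi\rangle}\bigr)_{L^2},\qquad x,\xi\in\mathbf R^d,$$ where $(f,\psi)_{L^2}=\langle f,\overline\psi\rangle$. A weight on $\mathbf R^{n}$ is a positive function $\omega$ such that $\omega,1/\omega\in L^\infty_{loc}(\mathbf R^{n})$, and $\mathscr P_E(\mathbf R^{n})$ is the set of weights $\omega$ for which there are a weight $v$ and a constant $C\ge 1$ with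 $\omega(x+y)\le C\omega(x)v(y)$ for all $x,y\in\mathbf R^{n}$. Let $0<q<\infty$, $\omega\in\mathscr P_E(\mathbf R^{2d})$ and $\phi\in\Sigma_1(\mathbf R^d)\setminus\{0\}$. For $f\in\Sigma_1'(\mathbf R^d)$ put $$\|f\|_{M^{\infty,q}_{(\omega)}}=\Bigl\|\,\xi\mapsto\operatorname*{ess\,sup}_{x\in\mathbf R^d}|V_\phi f(x,\xi)\,\omega(x,\xi)|\,\Bigr\|_{L^q(\mathbf R^d)}\in[0,\infty],$$ and let $M^{\sharp,q}_{(\omega)}(\mathbf R^d)$ be the set of all $f\in\Sigma_1'(\mathbf R^d)$ such that $\|f\|_{M^{\infty,q}_{(\omega)}}<\infty$ and $$\lim_{R\to\infty}\Bigl\|\,\xi\mapsto\operatorname*{ess\,sup}_{|x|\ge R}|V_\phi f(x,\xi)\,\omega(x,\xi)|\,\Bigr\|_{L^q(\mathbf R^d)}=0 .$$ Then $M^{\sharp,q}_{(\omega)}(\mathbf R^d)$ is the completion of $\Sigma_1(\mathbf R^d)$ under the quasi-norm $\|\cdot\|_{M^{\infty,q}_{(\omega)}}$. That is, $M^{\sharp,q}_{(\omega)}(\mathbf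 R^d)$ is a linear subspace of $\Sigma_1'(\mathbf R^d)$ on which $\|\cdot\|_{M^{\infty,q}_{(\omega)}}$ is a quasi-norm of order $r=\min(1,q)$ (finite, definite, homogeneous, and with $\|f+g\|^r\le\|f\|^r+\|g\|^r$); it is complete with respect to this quasi-norm; the identification of $\Sigma_1(\mathbf R^d)$ with a set of functionals is injective with image in $M^{\sharp,q}_{(\omega)}(\mathbf R^d)$; and $\Sigma_1(\mathbf R^d)$ is dense in $M^{\sharp,q}_{(\omega)}(\mathbf R^d)$. -/

import Mathlib

open MeasureTheory Filter Topology

namespace ModSharp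

/-- `ℝᵈ` with its Euclidean norm. -/
abbrev Rd (d : ℕ) : Type := EuclideanSpace ℝ (Fin d)

section Smooth

open scoped ContDiff ComplexConjugate

/-! ### Partial derivatives -/

/-- The partial derivative `∂ᵢ f`. -/
noncomputable def partialDeriv {d : ℕ} (i : Fin d) (f : Rd d → ℂ) : Rd d → ℂ :=
  fun x => fderiv ℝ f x (EuclideanSpace.single i 1)

/-- `∂_{i₁} ∂_{i₂} ⋯ ∂_{iₙ} f` for a list of coordinates `[i₁, …, iₙ]`. -/
noncomputable def wordDeriv {d : ℕ} (w : List (Fin d)) (f : Rd d → ℂ) : Rd d → ℂ :=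
  w.foldr partialDeriv f

/-- The list in which each coordinate `i` occurs `β i` times. -/
def multiWord {d : ℕ} (β : Fin d → ℕ) : List (Fin d) :=
  (List.finRange d).flatMap fun i => List.replicate (β i) i

/-- `∂^β f = ∂₁^{β₁} ⋯ ∂_d^{β_d} f` for a multi-index `β`. -/
noncomputable def multiDeriv {d : ℕ} (β : Fin d → ℕ) (f : Rd d → ℂ) : Rd d → ℂ :=
  wordDeriv (multiWord β) f

section Derivatives

variable {d : ℕ}

theorem partialDeriv_smooth (i : Fin d) {f : Rd d → ℂ} (hf : ContDiff ℝ ∞ f) :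
    ContDiff ℝ ∞ (partialDeriv i f) :=
  (hf.fderiv_right (m := ∞) (by simp)).clm_apply contDiff_const

theorem wordDeriv_smooth (w : List (Fin d)) {f : Rd d → ℂ} (hf : ContDiff ℝ ∞ f) :
    ContDiff ℝ ∞ (wordDeriv w f) := by
  induction w with
  | nil => exact hf
  | cons i w ih => exact partialDeriv_smooth i ih

theorem partialDeriv_add (i : Fin d) {f g : Rd d → ℂ} (hf : ContDiff ℝ ∞ f)
    (hg : ContDiff ℝ ∞ g) :
    partialDeriv i (f + g) = partialDeriv i f + partialDeriv i g := by
  funext x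
  have h1 := (hf.differentiable (by simp)) x
  have h2 := (hg.differentiable (by simp)) x
  simp [partialDeriv, fderiv_add h1 h2]

theorem partialDeriv_smul (i : Fin d) (c : ℂ) {f : Rd d → ℂ} (hf : ContDiff ℝ ∞ f) :
    partialDeriv i (c • f) = c • partialDeriv i f := by
  funext x
  have h1 := (hf.differentiable (by simp)) x
  simp [partialDeriv, fderiv_const_smul h1 c]

theorem wordDeriv_add (w : List (Fin d)) {f g : Rd d → ℂ} (hf : ContDiff ℝ ∞ f)
    (hg : ContDiff ℝ ∞ g) : wordDeriv w (f + g) = wordDeriv w f + wordDeriv w g := by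
  induction w with
  | nil => rfl
  | cons i w ih =>
    change partialDeriv i (wordDeriv w (f + g)) = _
    rw [ih, partialDeriv_add i (wordDeriv_smooth w hf) (wordDeriv_smooth w hg)]
    rfl

theorem wordDeriv_smul (w : List (Fin d)) (c : ℂ) {f : Rd d → ℂ} (hf : ContDiff ℝ ∞ f) :
    wordDeriv w (c • f) = c • wordDeriv w f := by
  induction w with
  | nil => rfl
  | cons i w ih =>
    change partialDeriv i (wordDeriv w (c • f)) = _
    rw [ih, partialDeriv_smul i c (wordDeriv_smooth w hf)]
    rfl

theorem wordDeriv_append (u w : List (Fin d)) (f : Rd d → ℂ) :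
    wordDeriv (u ++ w) f = wordDeriv u (wordDeriv w f) := by
  simp [wordDeriv, List.foldr_append]

theorem partialDeriv_comm (i j : Fin d) {f : Rd d → ℂ} (hf : ContDiff ℝ ∞ f) :
    partialDeriv i (partialDeriv j f) = partialDeriv j (partialDeriv i f) := by
  funext x
  have hd : DifferentiableAt ℝ (fderiv ℝ f) x :=
    ((hf.fderiv_right (m := ∞) (by simp)).differentiable (by simp)) x
  have key : ∀ a b : Fin d, partialDeriv a (partialDeriv b f) x
      = fderiv ℝ (fderiv ℝ f) x (EuclideanSpace.single a 1) (EuclideanSpace.single b 1) := by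
    intro a b
    unfold partialDeriv
    rw [fderiv_clm_apply hd (differentiableAt_const _)]
    simp
  rw [key, key]
  have hs : IsSymmSndFDerivAt ℝ f x :=
    hf.contDiffAt.isSymmSndFDerivAt (by
      rw [minSmoothness_of_isRCLikeNormedField]
      exact WithTop.coe_le_coe.mpr le_top)
  exact hs _ _

theorem wordDeriv_perm {u w : List (Fin d)} (h : u.Perm w) {f : Rd d → ℂ}
    (hf : ContDiff ℝ ∞ f) : wordDeriv u f = wordDeriv w f := by
  induction h with
  | nil => rfl
  | cons i _ ih =>
    change partialDeriv i (wordDeriv _ f) = partialDeriv i (wordDeriv _ f)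
    rw [ih]
  | swap i j l => exact partialDeriv_comm j i (wordDeriv_smooth l hf)
  | trans _ _ h1 h2 => exact h1.trans h2

theorem count_multiWord (β : Fin d → ℕ) (i : Fin d) : (multiWord β).count i = β i := by
  unfold multiWord
  rw [List.count_flatMap]
  have : (List.map (List.count i ∘ fun j => List.replicate (β j) j) (List.finRange d)).sum
      = ∑ j, if j = i then β j else 0 := by
    rw [Fin.sum_univ_def]
    congr 1
    apply List.map_congr_left
    intro j _
    simp [List.count_replicate]
  rw [this]
  simp

theorem length_eq_sum_count (u : List (Fin d)) : u.length = ∑ i, u.count i := by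
  have := Multiset.sum_count_eq_card (s := Finset.univ) (m := (u : Multiset (Fin d)))
    (fun a _ => Finset.mem_univ a)
  simpa using this.symm

theorem length_multiWord (β : Fin d → ℕ) : (multiWord β).length = ∑ i, β i := by
  rw [length_eq_sum_count]
  simp [count_multiWord]

theorem wordDeriv_eq_multiDeriv (u : List (Fin d)) {f : Rd d → ℂ} (hf : ContDiff ℝ ∞ f) :
    wordDeriv u f = multiDeriv (fun i => u.count i) f := by
  apply wordDeriv_perm _ hf
  rw [List.perm_iff_count]
  intro i
  rw [count_multiWord]

end Derivatives

/-! ### The Gelfand-Shilov space `Σ₁(ℝᵈ)` -/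

/-- The quantity `|x^α ∂^β f(x)| / (h^{|α+β|} α! β!)`. The operators `D^β = (-i)^{|β|} ∂^β` and
`∂^β` give the same absolute values. -/
noncomputable def gsQuot {d : ℕ} (h : ℝ) (f : Rd d → ℂ)
    (p : (Fin d → ℕ) × (Fin d → ℕ) × Rd d) : ℝ :=
  (∏ i, |p.2.2 i| ^ p.1 i) * ‖multiDeriv p.2.1 f p.2.2‖ /
    (h ^ (∑ i, (p.1 i + p.2.1 i)) * (∏ i, ((p.1 i).factorial : ℝ)) *
      ∏ i, ((p.2.1 i).factorial : ℝ))

theorem gsQuot_add_le {d : ℕ} {h : ℝ} (hh : 0 < h) {f g : Rd d → ℂ} (hf : ContDiff ℝ ∞ f)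
    (hg : ContDiff ℝ ∞ g) (p : (Fin d → ℕ) × (Fin d → ℕ) × Rd d) :
    gsQuot h (f + g) p ≤ gsQuot h f p + gsQuot h g p := by
  unfold gsQuot multiDeriv
  rw [wordDeriv_add _ hf hg, ← add_div, ← mul_add]
  gcongr
  exact norm_add_le _ _

theorem gsQuot_smul {d : ℕ} {h : ℝ} (c : ℂ) {f : Rd d → ℂ} (hf : ContDiff ℝ ∞ f)
    (p : (Fin d → ℕ) × (Fin d → ℕ) × Rd d) : gsQuot h (c • f) p = ‖c‖ * gsQuot h f p := by
  unfold gsQuot multiDeriv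
  rw [wordDeriv_smul _ c hf, Pi.smul_apply, norm_smul]
  ring

theorem gsQuot_nonneg {d : ℕ} {h : ℝ} (hh : 0 < h) (f : Rd d → ℂ)
    (p : (Fin d → ℕ) × (Fin d → ℕ) × Rd d) : 0 ≤ gsQuot h f p := by
  unfold gsQuot
  positivity

/-- The smooth `f` for which `sup_{α, β, x} |x^α ∂^β f(x)| / (h^{|α+β|} α! β!)` is finite for
every `h > 0`. -/
def sigmaOneSubmodule (d : ℕ) : Submodule ℂ (Rd d → ℂ) where
  carrier := {f | ContDiff ℝ ∞ f ∧ ∀ h : ℝ, 0 < h → BddAbove (Set.range (gsQuot h f))}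
  zero_mem' := by
    refine ⟨contDiff_const, fun h _ => ⟨0, ?_⟩⟩
    rintro _ ⟨p, rfl⟩
    have := gsQuot_smul (h := h) 0 (f := (0 : Rd d → ℂ)) contDiff_const p
    simp only [smul_zero, norm_zero, zero_mul] at this
    exact this.le
  add_mem' := by
    rintro f g ⟨hf, hf'⟩ ⟨hg, hg'⟩
    refine ⟨hf.add hg, fun h hh => ?_⟩
    obtain ⟨A, hA⟩ := hf' h hh
    obtain ⟨B, hB⟩ := hg' h hh
    refine ⟨A + B, ?_⟩
    rintro _ ⟨p, rfl⟩
    exact (gsQuot_add_le hh hf hg p).trans (add_le_add (hA ⟨p, rfl⟩) (hB ⟨p, rfl⟩))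
  smul_mem' := by
    rintro c f ⟨hf, hf'⟩
    refine ⟨contDiff_const.smul hf, fun h hh => ?_⟩
    obtain ⟨A, hA⟩ := hf' h hh
    refine ⟨‖c‖ * A, ?_⟩
    rintro _ ⟨p, rfl⟩
    rw [gsQuot_smul c hf]
    exact mul_le_mul_of_nonneg_left (hA ⟨p, rfl⟩) (norm_nonneg c)

/-- The Gelfand-Shilov space `Σ₁(ℝᵈ)`, as a type of its own so that it carries its Fréchet topology
and not the topology of pointwise convergence. -/
def SigmaOne (d : ℕ) : Type := ↥(sigmaOneSubmodule d)

noncomputable instance (d : ℕ) : AddCommGroup (SigmaOne d) :=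
  inferInstanceAs (AddCommGroup ↥(sigmaOneSubmodule d))

noncomputable instance (d : ℕ) : Module ℂ (SigmaOne d) :=
  inferInstanceAs (Module ℂ ↥(sigmaOneSubmodule d))

instance (d : ℕ) : CoeFun (SigmaOne d) (fun _ => Rd d → ℂ) := ⟨fun f => f.1⟩

/-- The (semi-)norm `‖f‖_[h]`. -/
noncomputable def gsSeminorm (d : ℕ) (h : {h : ℝ // 0 < h}) : Seminorm ℂ (SigmaOne d) :=
  Seminorm.of (fun f => ⨆ p, gsQuot h.1 f.1 p)
    (fun f g => ciSup_le fun p =>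
      (gsQuot_add_le h.2 f.2.1 g.2.1 p).trans
        (add_le_add (le_ciSup (f.2.2 h.1 h.2) p) (le_ciSup (g.2.2 h.1 h.2) p)))
    (fun c f => by
      rw [Real.mul_iSup_of_nonneg (norm_nonneg c)]
      exact iSup_congr fun p => gsQuot_smul c f.2.1 p)

/-- The Fréchet topology of `Σ₁(ℝᵈ)`, defined by the seminorms `‖·‖_[h]`, `h > 0`. -/
noncomputable instance (d : ℕ) : TopologicalSpace (SigmaOne d) :=
  SeminormFamily.moduleFilterBasis (gsSeminorm d) |>.topology

theorem sigmaOne_withSeminorms (d : ℕ) : WithSeminorms (gsSeminorm d) := ⟨rfl⟩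

/-- The space `Σ₁'(ℝᵈ)` of Gelfand-Shilov distributions: the topological dual of `Σ₁(ℝᵈ)`. -/
abbrev SigmaOneDual (d : ℕ) : Type := SigmaOne d →L[ℂ] ℂ

/-! ### Time-frequency shifts preserve `Σ₁(ℝᵈ)` -/

section Shifts

variable {d : ℕ}

theorem exists_exp_le (t : ℝ) :
    ∃ n : ℕ, Real.exp t ≤ 2 * ((2 * t) ^ n / n.factorial) := by
  by_contra! hcon
  have h1 : HasSum (fun n : ℕ => t ^ n / (n.factorial : ℝ)) (Real.exp t) := by
    rw [Real.exp_eq_exp_ℝ]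
    exact NormedSpace.expSeries_div_hasSum_exp t
  have h2 : HasSum (fun n : ℕ => (1 / 2 : ℝ) ^ n * (Real.exp t / 2)) (Real.exp t) := by
    have := hasSum_geometric_two.mul_right (Real.exp t / 2)
    have e : (2 : ℝ) * (Real.exp t / 2) = Real.exp t := by ring
    rwa [e] at this
  have h3 : ∀ n : ℕ, t ^ n / (n.factorial : ℝ) < (1 / 2 : ℝ) ^ n * (Real.exp t / 2) := by
    intro n
    have := hcon n
    have e : t ^ n / (n.factorial : ℝ) = (1 / 2 : ℝ) ^ n * ((2 * t) ^ n / n.factorial) := by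
      rw [mul_pow, ← mul_div_assoc, ← mul_assoc, ← mul_pow]
      norm_num
    rw [e]
    exact mul_lt_mul_of_pos_left (by linarith) (by positivity)
  exact lt_irrefl _ (hasSum_lt (fun n => (h3 n).le) (h3 0) h1 h2)

/-- Exponential decay of all derivatives of an element of `Σ₁(ℝᵈ)`. -/
theorem exp_bound_of_mem {f : Rd d → ℂ} (hf : f ∈ sigmaOneSubmodule d) (h : ℝ) (hh : 0 < h) :
    ∃ C : ℝ, 0 ≤ C ∧ ∀ (β : Fin d → ℕ) (x : Rd d),
      Real.exp ((∑ i, |x i|) / h) * ‖multiDeriv β f x‖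
        ≤ C * (h ^ (∑ i, β i) * ∏ i, ((β i).factorial : ℝ)) := by
  obtain ⟨A, hA⟩ := hf.2 (h / 2) (by positivity)
  have hA0 : 0 ≤ A := (gsQuot_nonneg (by positivity) f (0, 0, 0)).trans (hA ⟨(0, 0, 0), rfl⟩)
  refine ⟨2 ^ d * A, by positivity, fun β x => ?_⟩
  choose n hn using fun i : Fin d => exists_exp_le (|x i| / h)
  have h1 : Real.exp ((∑ i, |x i|) / h) ≤
      2 ^ d * ∏ i, ((|x i| / (h / 2)) ^ n i / ((n i).factorial : ℝ)) := by
    rw [Finset.sum_div, Real.exp_sum]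
    calc ∏ i, Real.exp (|x i| / h)
        ≤ ∏ i, (2 * ((2 * (|x i| / h)) ^ n i / ((n i).factorial : ℝ))) :=
          Finset.prod_le_prod (fun i _ => (Real.exp_pos _).le) (fun i _ => hn i)
      _ = _ := by
          rw [Finset.prod_mul_distrib]
          congr 1
          · simp
          · refine Finset.prod_congr rfl fun i _ => ?_
            congr 2
            field_simp
  have h2 : gsQuot (h / 2) f (n, β, x) ≤ A := hA ⟨(n, β, x), rfl⟩
  have e : gsQuot (h / 2) f (n, β, x) =
      (∏ i, ((|x i| / (h / 2)) ^ n i / ((n i).factorial : ℝ))) * ‖multiDeriv β f x‖ /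
        ((h / 2) ^ (∑ i, β i) * ∏ i, ((β i).factorial : ℝ)) := by
    unfold gsQuot
    simp only [div_pow, Finset.prod_div_distrib, Finset.sum_add_distrib, pow_add,
      Finset.prod_pow_eq_pow_sum]
    field_simp
  rw [e, div_le_iff₀ (by positivity)] at h2
  calc Real.exp ((∑ i, |x i|) / h) * ‖multiDeriv β f x‖
      ≤ (2 ^ d * ∏ i, ((|x i| / (h / 2)) ^ n i / ((n i).factorial : ℝ))) *
          ‖multiDeriv β f x‖ := by gcongr
    _ = 2 ^ d * ((∏ i, ((|x i| / (h / 2)) ^ n i / ((n i).factorial : ℝ))) *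
          ‖multiDeriv β f x‖) := by ring
    _ ≤ 2 ^ d * (A * ((h / 2) ^ (∑ i, β i) * ∏ i, ((β i).factorial : ℝ))) := by gcongr
    _ ≤ 2 ^ d * (A * (h ^ (∑ i, β i) * ∏ i, ((β i).factorial : ℝ))) := by
        gcongr
        linarith
    _ = _ := by ring

theorem mem_of_exp_bound {f : Rd d → ℂ} (hf : ContDiff ℝ ∞ f)
    (H : ∀ h : ℝ, 0 < h → ∃ C : ℝ, ∀ (β : Fin d → ℕ) (x : Rd d),
      Real.exp ((∑ i, |x i|) / h) * ‖multiDeriv β f x‖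
        ≤ C * (h ^ (∑ i, β i) * ∏ i, ((β i).factorial : ℝ))) : f ∈ sigmaOneSubmodule d := by
  refine ⟨hf, fun h hh => ?_⟩
  obtain ⟨C, hC⟩ := H h hh
  refine ⟨C, ?_⟩
  rintro _ ⟨⟨α, β, x⟩, rfl⟩
  have h1 : ∏ i, ((|x i| / h) ^ α i / ((α i).factorial : ℝ)) ≤
      Real.exp ((∑ i, |x i|) / h) := by
    rw [Finset.sum_div, Real.exp_sum]
    exact Finset.prod_le_prod (fun i _ => by positivity)
      (fun i _ => Real.pow_div_factorial_le_exp _ (by positivity) _)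
  have e : gsQuot h f (α, β, x) =
      (∏ i, ((|x i| / h) ^ α i / ((α i).factorial : ℝ))) * ‖multiDeriv β f x‖ /
        (h ^ (∑ i, β i) * ∏ i, ((β i).factorial : ℝ)) := by
    unfold gsQuot
    simp only [div_pow, Finset.prod_div_distrib, Finset.sum_add_distrib, pow_add,
      Finset.prod_pow_eq_pow_sum]
    field_simp
  rw [e, div_le_iff₀ (by positivity)]
  exact (mul_le_mul_of_nonneg_right h1 (norm_nonneg _)).trans (hC β x)

theorem wordDeriv_conj (w : List (Fin d)) (f : Rd d → ℂ) :
    wordDeriv w (fun x => conj (f x)) = fun x => conj (wordDeriv w f x) := by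
  induction w with
  | nil => rfl
  | cons i w ih =>
    change partialDeriv i (wordDeriv w _) = fun x => conj (partialDeriv i (wordDeriv w f) x)
    rw [ih]
    funext x
    unfold partialDeriv
    have h := Complex.conjCLE.comp_fderiv (f := wordDeriv w f) (x := x)
    have h' := congrArg (fun L => L (EuclideanSpace.single i (1 : ℝ))) h
    simpa [Function.comp_def] using h'

theorem wordDeriv_translate (w : List (Fin d)) (a : Rd d) (f : Rd d → ℂ) :
    wordDeriv w (fun x => f (x - a)) = fun x => wordDeriv w f (x - a) := by
  induction w with
  | nil => rfl
  | cons i w ih =>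
    change partialDeriv i (wordDeriv w _) = fun x => partialDeriv i (wordDeriv w f) (x - a)
    rw [ih]
    funext x
    unfold partialDeriv
    rw [fderiv_comp_sub]

theorem conj_mem {f : Rd d → ℂ} (hf : f ∈ sigmaOneSubmodule d) :
    (fun x => conj (f x)) ∈ sigmaOneSubmodule d := by
  refine ⟨Complex.conjCLE.contDiff.comp hf.1, fun h hh => ?_⟩
  have : gsQuot h (fun x => conj (f x)) = gsQuot h f := by
    funext p
    simp [gsQuot, multiDeriv, wordDeriv_conj]
  rw [this]
  exact hf.2 h hh

theorem translate_mem {f : Rd d → ℂ} (hf : f ∈ sigmaOneSubmodule d) (a : Rd d) :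
    (fun x => f (x - a)) ∈ sigmaOneSubmodule d := by
  refine mem_of_exp_bound (hf.1.comp (contDiff_id.sub contDiff_const)) fun h hh => ?_
  obtain ⟨C, hC0, hC⟩ := exp_bound_of_mem hf h hh
  refine ⟨Real.exp ((∑ i, |a i|) / h) * C, fun β x => ?_⟩
  have h1 : Real.exp ((∑ i, |x i|) / h) ≤
      Real.exp ((∑ i, |a i|) / h) * Real.exp ((∑ i, |(x - a) i|) / h) := by
    rw [← Real.exp_add, ← add_div, ← Finset.sum_add_distrib]
    gcongr with i
    have := abs_add_le (a i) ((x - a) i)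
    simpa using this
  have h2 := hC β (x - a)
  unfold multiDeriv at h2 ⊢
  rw [wordDeriv_translate]
  calc _ ≤ (Real.exp ((∑ i, |a i|) / h) * Real.exp ((∑ i, |(x - a) i|) / h)) *
        ‖wordDeriv (multiWord β) f (x - a)‖ := by gcongr
    _ = Real.exp ((∑ i, |a i|) / h) * (Real.exp ((∑ i, |(x - a) i|) / h) *
        ‖wordDeriv (multiWord β) f (x - a)‖) := by ring
    _ ≤ Real.exp ((∑ i, |a i|) / h) *
        (C * (h ^ (∑ i, β i) * ∏ i, ((β i).factorial : ℝ))) := by gcongr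
    _ = _ := by ring

/-- The character `y ↦ e^{-i⟨y, ξ⟩}`. -/
noncomputable def character (ξ y : Rd d) : ℂ := Complex.exp (-Complex.I * ((inner ℝ y ξ : ℝ) : ℂ))

theorem character_smooth (ξ : Rd d) : ContDiff ℝ ∞ (character ξ) := by
  unfold character
  have h1 : ContDiff ℝ ∞ (fun y : Rd d => (inner ℝ y ξ : ℝ)) := contDiff_id.inner ℝ contDiff_const
  exact (contDiff_const.mul (Complex.ofRealCLM.contDiff.comp h1)).cexp

theorem norm_character (ξ y : Rd d) : ‖character ξ y‖ = 1 := by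
  simp [character, Complex.norm_exp]

/-- `∂ᵢ - i ξᵢ`. -/
noncomputable def shiftDeriv (ξ : Rd d) (i : Fin d) (f : Rd d → ℂ) : Rd d → ℂ :=
  partialDeriv i f + (-Complex.I * (ξ i : ℂ)) • f

theorem shiftDeriv_smooth (ξ : Rd d) (w : List (Fin d)) {f : Rd d → ℂ} (hf : ContDiff ℝ ∞ f) :
    ContDiff ℝ ∞ (w.foldr (shiftDeriv ξ) f) := by
  induction w with
  | nil => exact hf
  | cons i w ih => exact (partialDeriv_smooth i ih).add (contDiff_const.smul ih)

theorem partialDeriv_character_mul (ξ : Rd d) (i : Fin d) {f : Rd d → ℂ}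
    (hf : ContDiff ℝ ∞ f) :
    partialDeriv i (fun y => character ξ y * f y) =
      fun y => character ξ y * shiftDeriv ξ i f y := by
  funext x
  have h1 : HasFDerivAt (fun y : Rd d => (inner ℝ y ξ : ℝ)) (innerSL ℝ ξ) x := by
    have := (innerSL ℝ ξ).hasFDerivAt (x := x)
    refine this.congr_of_eventuallyEq (Eventually.of_forall fun y => ?_)
    simp [real_inner_comm]
  have h2 : HasFDerivAt (fun y : Rd d => ((inner ℝ y ξ : ℝ) : ℂ))
      (Complex.ofRealCLM.comp (innerSL ℝ ξ)) x := Complex.ofRealCLM.hasFDerivAt.comp x h1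
  have h3 := (h2.const_mul (-Complex.I)).cexp
  have h4 := ((hf.differentiable (by simp)) x).hasFDerivAt
  have h5 := h3.mul h4
  have h6 : HasFDerivAt (fun y => character ξ y * f y) _ x := h5
  unfold partialDeriv
  rw [h6.fderiv]
  simp [shiftDeriv, partialDeriv, character, EuclideanSpace.inner_single_right]
  ring

theorem wordDeriv_character_mul (ξ : Rd d) (w : List (Fin d)) {f : Rd d → ℂ}
    (hf : ContDiff ℝ ∞ f) :
    wordDeriv w (fun y => character ξ y * f y) =
      fun y => character ξ y * w.foldr (shiftDeriv ξ) f y := by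
  induction w with
  | nil => rfl
  | cons i w ih =>
    change partialDeriv i (wordDeriv w _) = _
    rw [ih, partialDeriv_character_mul ξ i (shiftDeriv_smooth ξ w hf)]
    rfl

theorem shift_word_bound (ξ : Rd d) {f : Rd d → ℂ} (hf : ContDiff ℝ ∞ f) (x : Rd d)
    {K h a : ℝ} (hh : 0 < h) (hK : 0 ≤ K) (ha : ∀ i, |ξ i| ≤ a) (ha0 : 0 ≤ a)
    (H : ∀ u : List (Fin d), ‖wordDeriv u f x‖ ≤ K * (h ^ u.length * u.length.factorial))
    (w : List (Fin d)) : ∀ u : List (Fin d),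
    ‖wordDeriv u (w.foldr (shiftDeriv ξ) f) x‖ ≤
      K * (h ^ (u.length + w.length) * (u.length + w.length).factorial) *
        ∏ j ∈ Finset.range w.length, (1 + a / h / (j + 1)) := by
  induction w with
  | nil => intro u; simpa using H u
  | cons i w ih =>
    intro u
    have hs := shiftDeriv_smooth ξ w hf
    have e : wordDeriv u ((i :: w).foldr (shiftDeriv ξ) f) =
        wordDeriv (u ++ [i]) (w.foldr (shiftDeriv ξ) f) +
          (-Complex.I * (ξ i : ℂ)) • wordDeriv u (w.foldr (shiftDeriv ξ) f) := by
      have hs' : ContDiff ℝ ∞ ((-Complex.I * (ξ i : ℂ)) • w.foldr (shiftDeriv ξ) f) :=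
        contDiff_const.smul hs
      rw [List.foldr_cons, shiftDeriv, wordDeriv_add u (partialDeriv_smooth i hs) hs',
        wordDeriv_smul u _ hs, wordDeriv_append]
      rfl
    have h1 := ih (u ++ [i])
    have h2 := ih u
    set P := ∏ j ∈ Finset.range w.length, (1 + a / h / ((j : ℝ) + 1)) with hP
    have hP0 : 0 ≤ P := Finset.prod_nonneg fun j _ => by positivity
    have h3 : ‖-Complex.I * (ξ i : ℂ)‖ ≤ a := by simpa using ha i
    rw [e, Pi.add_apply, Pi.smul_apply]
    refine (norm_add_le _ _).trans ?_
    rw [norm_smul]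
    have l1 : (u ++ [i]).length + w.length = u.length + w.length + 1 := by simp; ring
    rw [l1] at h1
    have l2 : u.length + (i :: w).length = u.length + w.length + 1 := by simp; ring
    rw [l2, List.length_cons, Finset.prod_range_succ, ← hP]
    set N := u.length + w.length with hN
    have h4 : a * (K * (h ^ N * (N.factorial : ℝ)) * P) ≤
        K * (h ^ (N + 1) * ((N + 1).factorial : ℝ)) * P * (a / h / ((w.length : ℝ) + 1)) := by
      have hw : ((w.length : ℝ) + 1) ≤ (N : ℝ) + 1 := by
        have : w.length ≤ N := by omega
        have : (w.length : ℝ) ≤ N := by exact_mod_cast this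
        linarith
      have e2 : K * (h ^ (N + 1) * ((N + 1).factorial : ℝ)) * P * (a / h / ((w.length : ℝ) + 1))
          = a * (K * (h ^ N * (N.factorial : ℝ)) * P) *
            (((N : ℝ) + 1) / ((w.length : ℝ) + 1)) := by
        rw [Nat.factorial_succ, pow_succ]
        push_cast
        field_simp
      rw [e2]
      apply le_mul_of_one_le_right (by positivity)
      rwa [one_le_div (by positivity)]
    calc _ ≤ K * (h ^ (N + 1) * ((N + 1).factorial : ℝ)) * P +
          a * (K * (h ^ N * (N.factorial : ℝ)) * P) := by gcongr
      _ ≤ K * (h ^ (N + 1) * ((N + 1).factorial : ℝ)) * P +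
          K * (h ^ (N + 1) * ((N + 1).factorial : ℝ)) * P * (a / h / ((w.length : ℝ) + 1)) := by
            gcongr
      _ = _ := by ring

theorem prod_growth (s : ℝ) (hs : 0 ≤ s) : ∃ C : ℝ, 0 ≤ C ∧ ∀ n : ℕ,
    ∏ j ∈ Finset.range n, (1 + s / (j + 1)) ≤ C * 2 ^ n := by
  obtain ⟨J, hJ⟩ := exists_nat_ge s
  have key : ∀ n : ℕ, ∏ j ∈ Finset.range n, (1 + s / ((j : ℝ) + 1)) ≤
      (1 + s) ^ (min n J) * 2 ^ n := by
    intro n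
    induction n with
    | zero => simp
    | succ n ih =>
      rw [Finset.prod_range_succ]
      rcases lt_or_ge n J with hn | hn
      · have e1 : min (n + 1) J = min n J + 1 := by omega
        have h1 : 1 + s / ((n : ℝ) + 1) ≤ (1 + s) * 2 := by
          have : s / ((n : ℝ) + 1) ≤ s := div_le_self hs (by linarith [n.cast_nonneg (α := ℝ)])
          linarith
        rw [e1]
        calc _ ≤ ((1 + s) ^ (min n J) * 2 ^ n) * ((1 + s) * 2) := by gcongr
          _ = _ := by ring
      · have e1 : min (n + 1) J = min n J := by omega
        have h1 : 1 + s / ((n : ℝ) + 1) ≤ 2 := by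
          have : s / ((n : ℝ) + 1) ≤ 1 := by
            rw [div_le_one (by positivity)]
            have : (J : ℝ) ≤ n := by exact_mod_cast hn
            linarith
          linarith
        rw [e1]
        calc _ ≤ ((1 + s) ^ (min n J) * 2 ^ n) * 2 := by gcongr
          _ = _ := by ring
  refine ⟨(1 + s) ^ J, by positivity, fun n => (key n).trans ?_⟩
  gcongr
  · linarith
  · exact min_le_right _ _

theorem factorial_sum_le (β : Fin d → ℕ) :
    (∑ i, β i).factorial ≤ d ^ (∑ i, β i) * ∏ i, (β i).factorial := by
  have h1 := Nat.multinomial_spec Finset.univ β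
  have h2 : Nat.multinomial Finset.univ β ≤ d ^ (∑ i, β i) := by
    have := Finset.sum_pow_eq_sum_piAntidiag (R := ℕ) Finset.univ (fun _ : Fin d => 1) (∑ i, β i)
    simp only [Finset.sum_const, Finset.card_univ, Fintype.card_fin, smul_eq_mul, mul_one,
      one_pow, Finset.prod_const_one, Nat.cast_id] at this
    rw [this]
    exact Finset.single_le_sum (f := fun k => Nat.multinomial Finset.univ k)
      (fun _ _ => Nat.zero_le _) (by simp)
  rw [← h1, mul_comm]
  exact Nat.mul_le_mul_right _ h2

theorem modulate_mem {f : Rd d → ℂ} (hf : f ∈ sigmaOneSubmodule d) (ξ : Rd d) :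
    (fun y => character ξ y * f y) ∈ sigmaOneSubmodule d := by
  refine mem_of_exp_bound ((character_smooth ξ).mul hf.1) fun h0 hh0 => ?_
  set h : ℝ := h0 / (2 * (d + 1)) with hdef
  have hh : 0 < h := by positivity
  have hle : h ≤ h0 := div_le_self hh0.le (by linarith [d.cast_nonneg (α := ℝ)])
  obtain ⟨C, hC0, hC⟩ := exp_bound_of_mem hf h hh
  set a : ℝ := ∑ i, |ξ i| with hadef
  have ha0 : 0 ≤ a := Finset.sum_nonneg fun i _ => abs_nonneg _
  have ha : ∀ i, |ξ i| ≤ a := fun i =>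
    Finset.single_le_sum (f := fun i => |ξ i|) (fun i _ => abs_nonneg _) (Finset.mem_univ i)
  obtain ⟨D, hD0, hD⟩ := prod_growth (a / h) (by positivity)
  refine ⟨C * D, fun β x => ?_⟩
  set n := ∑ i, β i with hn
  have hbase : ∀ u : List (Fin d), ‖wordDeriv u f x‖ ≤
      (C * Real.exp (-((∑ i, |x i|) / h))) * (h ^ u.length * u.length.factorial) := by
    intro u
    have h1 := hC (fun i => u.count i) x
    rw [← wordDeriv_eq_multiDeriv u hf.1, ← length_eq_sum_count] at h1
    have h2 : ∏ i, ((u.count i).factorial : ℝ) ≤ (u.length.factorial : ℝ) := by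
      rw [length_eq_sum_count u]
      exact_mod_cast Nat.le_of_dvd (Nat.factorial_pos _)
        (Nat.prod_factorial_dvd_factorial_sum Finset.univ fun i => u.count i)
    rw [Real.exp_neg]
    have h3 : ‖wordDeriv u f x‖ ≤ C * (h ^ u.length * ∏ i, ((u.count i).factorial : ℝ)) /
        Real.exp ((∑ i, |x i|) / h) := by
      rw [le_div_iff₀ (Real.exp_pos _), mul_comm]
      exact h1
    calc _ ≤ _ := h3
      _ ≤ C * (h ^ u.length * (u.length.factorial : ℝ)) / Real.exp ((∑ i, |x i|) / h) := by
        gcongr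
      _ = _ := by ring
  have h1 := shift_word_bound ξ hf.1 x hh (by positivity) ha ha0 hbase (multiWord β) []
  simp only [List.length_nil, zero_add, length_multiWord] at h1
  have h2 : ‖multiDeriv β (fun y => character ξ y * f y) x‖ =
      ‖wordDeriv [] ((multiWord β).foldr (shiftDeriv ξ) f) x‖ := by
    unfold multiDeriv
    rw [wordDeriv_character_mul ξ _ hf.1]
    simp [norm_character, wordDeriv]
  have h3 : (n.factorial : ℝ) ≤ (d + 1 : ℝ) ^ n * ∏ i, ((β i).factorial : ℝ) := by
    have h4 : (n.factorial : ℝ) ≤ (d : ℝ) ^ n * ∏ i, ((β i).factorial : ℝ) := by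
      exact_mod_cast factorial_sum_le β
    refine h4.trans ?_
    gcongr
    linarith
  have h5 : Real.exp (-((∑ i, |x i|) / h)) ≤ Real.exp (-((∑ i, |x i|) / h0)) := by
    gcongr
  rw [h2]
  calc _ ≤ Real.exp ((∑ i, |x i|) / h0) * ((C * Real.exp (-((∑ i, |x i|) / h0))) *
        (h ^ n * ((d + 1 : ℝ) ^ n * ∏ i, ((β i).factorial : ℝ))) * (D * 2 ^ n)) := by
        gcongr
        refine h1.trans ?_
        have := hD n
        gcongr
    _ = (Real.exp ((∑ i, |x i|) / h0) * Real.exp (-((∑ i, |x i|) / h0))) * (C * D *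
        ((h * (2 * (d + 1))) ^ n * ∏ i, ((β i).factorial : ℝ))) := by
        rw [mul_pow, mul_pow]
        ring
    _ = _ := by
        rw [← Real.exp_add, add_neg_cancel, Real.exp_zero, one_mul]
        congr 3
        rw [hdef]
        field_simp

end Shifts

/-! ### The short-time Fourier transform -/

/-- The complex conjugate `y ↦ conj (φ(y - x)) e^{-i⟨y, ξ⟩}` of the time-frequency shift
`φ(· - x) e^{i⟨·, ξ⟩}` of `φ ∈ Σ₁(ℝᵈ)`. -/
noncomputable def conjShift {d : ℕ} (φ : SigmaOne d) (x ξ : Rd d) : SigmaOne d :=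
  ⟨fun y => character ξ y * conj (φ (y - x)), modulate_mem (conj_mem (translate_mem φ.2 x)) ξ⟩

/-- The short-time Fourier transform
`V_φ f (x, ξ) = (2π)^{-d/2} (f, φ(· - x) e^{i⟨·, ξ⟩})_{L²}` of `f ∈ Σ₁'(ℝᵈ)`, where
`(f, ψ)_{L²} = ⟨f, conj ψ⟩`. -/
noncomputable def stft {d : ℕ} (φ : SigmaOne d) (f : SigmaOneDual d) (z : Rd d × Rd d) : ℂ :=
  (((2 * Real.pi) ^ (-(d : ℝ) / 2) : ℝ) : ℂ) * f (conjShift φ z.1 z.2)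

/-! ### The embedding of `Σ₁(ℝᵈ)` into `Σ₁'(ℝᵈ)` -/

theorem sigmaOne_norm_le {d : ℕ} (g : SigmaOne d) (x : Rd d) :
    ‖g x‖ ≤ gsSeminorm d ⟨1, one_pos⟩ g := by
  have h := le_ciSup (g.2.2 1 one_pos) (0, 0, x)
  have e : gsQuot 1 g.1 (0, 0, x) = ‖g x‖ := by
    have : multiWord (0 : Fin d → ℕ) = [] := by
      apply List.eq_nil_of_length_eq_zero
      simp [length_multiWord]
    simp [gsQuot, multiDeriv, this, wordDeriv]
  rw [e] at h
  exact h

theorem sigmaOne_integrable {d : ℕ} (f : SigmaOne d) : Integrable f.1 volume := by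
  obtain ⟨C, hC0, hC⟩ := exp_bound_of_mem f.2 (1 / (d + 1 : ℝ)) (by positivity)
  have hint : Integrable (fun x : Rd d => C * (1 + ‖x‖) ^ (-((d : ℝ) + 1))) volume :=
    (integrable_one_add_norm (by simp)).const_mul C
  refine hint.mono' f.2.1.continuous.aestronglyMeasurable (Eventually.of_forall fun x => ?_)
  have h1 := hC 0 x
  have : multiWord (0 : Fin d → ℕ) = [] := by
    apply List.eq_nil_of_length_eq_zero
    simp [length_multiWord]
  simp only [multiDeriv, this, wordDeriv, List.foldr_nil, Pi.zero_apply, Finset.sum_const_zero,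
    pow_zero, Nat.factorial_zero, Nat.cast_one, Finset.prod_const_one, mul_one] at h1
  have h2 : (1 + ‖x‖) ^ ((d : ℝ) + 1) ≤ Real.exp ((∑ i, |x i|) / (1 / (d + 1 : ℝ))) := by
    have h3 : ‖x‖ ≤ ∑ i, |x i| := by
      rw [EuclideanSpace.norm_eq]
      apply Real.sqrt_le_iff.mpr
      refine ⟨Finset.sum_nonneg fun i _ => abs_nonneg _, ?_⟩
      simpa using Finset.sum_sq_le_sq_sum_of_nonneg (s := Finset.univ) (f := fun i => |x i|)
        (fun i _ => abs_nonneg _)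
    have h4 : 1 + ‖x‖ ≤ Real.exp (∑ i, |x i|) := by
      have := Real.add_one_le_exp (∑ i, |x i|)
      linarith
    calc (1 + ‖x‖) ^ ((d : ℝ) + 1) ≤ Real.exp (∑ i, |x i|) ^ ((d : ℝ) + 1) := by gcongr
      _ = _ := by
        rw [← Real.exp_mul]
        congr 1
        field_simp
  have h6 : 0 < (1 + ‖x‖) ^ ((d : ℝ) + 1) := by positivity
  rw [Real.rpow_neg (by positivity), ← div_eq_mul_inv, le_div_iff₀ h6, mul_comm]
  exact (mul_le_mul_of_nonneg_right h2 (norm_nonneg _)).trans h1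

theorem sigmaOne_integrable_mul {d : ℕ} (f g : SigmaOne d) :
    Integrable (fun x => f x * g x) volume :=
  (sigmaOne_integrable f).mul_bdd g.2.1.continuous.aestronglyMeasurable
    (Eventually.of_forall (sigmaOne_norm_le g))

/-- The pairing `g ↦ ∫ f g` on `Σ₁(ℝᵈ)`. -/
noncomputable def pairing {d : ℕ} (f : SigmaOne d) : SigmaOne d →ₗ[ℂ] ℂ where
  toFun g := ∫ x, f x * g x
  map_add' g₁ g₂ := by
    rw [← integral_add (sigmaOne_integrable_mul f g₁) (sigmaOne_integrable_mul f g₂)]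
    exact integral_congr_ae (Eventually.of_forall fun x => mul_add (f x) (g₁ x) (g₂ x))
  map_smul' c g := by
    rw [RingHom.id_apply, smul_eq_mul, ← integral_const_mul]
    exact integral_congr_ae (Eventually.of_forall fun x => mul_left_comm (f x) c (g x))

theorem pairing_continuous {d : ℕ} (f : SigmaOne d) : Continuous (pairing f) := by
  refine (sigmaOne_withSeminorms d).continuous_normedSpace_rng ℂ (pairing f)
    ⟨{⟨1, one_pos⟩}, ⟨∫ x, ‖f x‖, integral_nonneg fun x => norm_nonneg _⟩, fun g => ?_⟩
  rw [Finset.sup_singleton]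
  change ‖∫ x, f x * g x‖ ≤ (∫ x, ‖f x‖) * gsSeminorm d ⟨1, one_pos⟩ g
  rw [← integral_mul_const]
  refine norm_integral_le_of_norm_le ((sigmaOne_integrable f).norm.mul_const _)
    (Eventually.of_forall fun x => ?_)
  rw [norm_mul]
  exact mul_le_mul_of_nonneg_left (sigmaOne_norm_le g x) (norm_nonneg _)

/-- The canonical map `Σ₁(ℝᵈ) → Σ₁'(ℝᵈ)`, under which `f` is the distribution `g ↦ ∫ f g`. -/
noncomputable def toDual (d : ℕ) : SigmaOne d →ₗ[ℂ] SigmaOneDual d where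
  toFun f := ⟨pairing f, pairing_continuous f⟩
  map_add' f₁ f₂ := by
    ext g
    change ∫ x, (f₁ x + f₂ x) * g x = (∫ x, f₁ x * g x) + ∫ x, f₂ x * g x
    rw [← integral_add (sigmaOne_integrable_mul f₁ g) (sigmaOne_integrable_mul f₂ g)]
    simp only [add_mul]
  map_smul' c f := by
    ext g
    change ∫ x, (c * f x) * g x = c * ∫ x, f x * g x
    rw [← integral_const_mul]
    simp only [mul_assoc]

end Smooth

open scoped ENNReal

/-! ### Weights -/

/-- A weight: a positive function `ω` such that `ω` and `1 / ω` are in `L^∞_loc`. -/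
structure IsWeight {E : Type*} [TopologicalSpace E] [MeasureSpace E] (ω : E → ℝ) : Prop where
  pos : ∀ x, 0 < ω x
  locBdd : ∀ K : Set E, IsCompact K → MemLp ω ∞ (volume.restrict K)
  locBdd_inv : ∀ K : Set E, IsCompact K → MemLp (fun x => (ω x)⁻¹) ∞ (volume.restrict K)

/-- The class `𝒫_E` of moderate weights. -/
def IsModerateWeight {E : Type*} [TopologicalSpace E] [MeasureSpace E] [Add E] (ω : E → ℝ) :
    Prop :=
  IsWeight ω ∧ ∃ (v : E → ℝ) (C : ℝ), IsWeight v ∧ 1 ≤ C ∧ ∀ x y, ω (x + y) ≤ C * ω x * v y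

/-! ### Modulation spaces -/

/-- The mixed (quasi-)norm of `F · ω` over `S × ℝᵈ`: the `L^p(S)` norm in `x`, then the
`L^q(ℝᵈ)` norm in `ξ`. -/
noncomputable def mixedNormOn {d : ℕ} (S : Set (Rd d)) (p q : ℝ≥0∞) (ω : Rd d × Rd d → ℝ)
    (F : Rd d × Rd d → ℂ) : ℝ≥0∞ :=
  eLpNorm (fun ξ => eLpNorm (fun x => F (x, ξ) * (ω (x, ξ) : ℂ)) p (volume.restrict S)) q volume

/-- The quasi-norm of `L^{p,q}_{(ω)}(ℝ^{2d})`. -/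
noncomputable def mixedNorm {d : ℕ} (p q : ℝ≥0∞) (ω : Rd d × Rd d → ℝ)
    (F : Rd d × Rd d → ℂ) : ℝ≥0∞ :=
  mixedNormOn Set.univ p q ω F

/-- The quasi-norm `‖f‖_{M^{p,q}_{(ω)}} = ‖V_φ f‖_{L^{p,q}_{(ω)}}`, with values in `[0, ∞]`. -/
noncomputable def modNorm {d : ℕ} (φ : SigmaOne d) (ω : Rd d × Rd d → ℝ) (p q : ℝ≥0∞)
    (f : SigmaOneDual d) : ℝ≥0∞ :=
  mixedNorm p q ω (stft φ f)

/-- The modulation space `M^{p,q}_{(ω)}(ℝᵈ)`. -/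
def modSpace {d : ℕ} (φ : SigmaOne d) (ω : Rd d × Rd d → ℝ) (p q : ℝ≥0∞) :
    Set (SigmaOneDual d) :=
  {f | modNorm φ ω p q f < ∞}

/-- The space `M^{♯,q}_{(ω)}(ℝᵈ)`: all `f ∈ M^{∞,q}_{(ω)}(ℝᵈ)` such that the `L^q` norm in `ξ` of
the (essential) supremum of `|V_φ f(x, ξ) ω(x, ξ)|` over `|x| ≥ R` tends to `0` as `R → ∞`. -/
def modSharp {d : ℕ} (φ : SigmaOne d) (ω : Rd d × Rd d → ℝ) (q : ℝ≥0∞) :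
    Set (SigmaOneDual d) :=
  {f | f ∈ modSpace φ ω ∞ q ∧
    Tendsto (fun R : ℝ => mixedNormOn {x | R ≤ ‖x‖} ∞ q ω (stft φ f)) atTop (𝓝 0)}

/-! ### Completions with respect to a quasi-norm -/

/-- `X ⊆ W`, with the quasi-norm `N` of order `r`, is the completion of the vector space `V`,
embedded in `W` by `ι`, under `N ∘ ι`: `X` is a linear subspace on which `N` is a (finite) quasi-norm
of order `r`, `X` is complete under `N`, and `V` is a dense subspace of `X`. -/
structure IsQuasiNormCompletion {V W : Type*} [AddCommGroup V] [Module ℂ V] [AddCommGroup W]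
    [Module ℂ W] (r : ℝ) (N : W → ℝ≥0∞) (ι : V →ₗ[ℂ] W) (X : Set W) : Prop where
  isSubspace : ∃ S : Submodule ℂ W, (S : Set W) = X
  finite : ∀ u ∈ X, N u < ∞
  definite : ∀ u ∈ X, N u = 0 ↔ u = 0
  homogeneous : ∀ (c : ℂ), ∀ u ∈ X, N (c • u) = ‖c‖ₑ * N u
  subadditive : ∀ u ∈ X, ∀ v ∈ X, N (u + v) ^ r ≤ N u ^ r + N v ^ r
  injective : Function.Injective ι
  map_mem : ∀ f, ι f ∈ X
  dense : ∀ u ∈ X, ∀ ε : ℝ≥0∞, 0 < ε → ∃ f, N (u - ι f) < ε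
  complete : ∀ s : ℕ → W, (∀ n, s n ∈ X) →
    (∀ ε : ℝ≥0∞, 0 < ε → ∃ n₀, ∀ m n, n₀ ≤ m → n₀ ≤ n → N (s m - s n) < ε) →
    ∃ u ∈ X, Tendsto (fun n => N (s n - u)) atTop (𝓝 0)

end ModSharp

open scoped ENNReal

namespace ModSharp

/-! ### Exponential bounds in `Σ₁`; growth and continuity of time-frequency shifts. -/

section Seminorms

open scoped ContDiff ComplexConjugate

variable {d : ℕ}

/-! ### Quantitative forms of the defining estimates -/

theorem multiWord_zero : multiWord (0 : Fin d → ℕ) = [] := by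
  apply List.eq_nil_of_length_eq_zero
  simp [length_multiWord]

theorem gsQuot_le_gsSeminorm (h : {h : ℝ // 0 < h}) (g : SigmaOne d)
    (p : (Fin d → ℕ) × (Fin d → ℕ) × Rd d) : gsQuot h.1 g.1 p ≤ gsSeminorm d h g :=
  le_ciSup (g.2.2 h.1 h.2) p

theorem gsSeminorm_le {h : {h : ℝ // 0 < h}} {g : SigmaOne d} {C : ℝ}
    (H : ∀ p, gsQuot h.1 g.1 p ≤ C) : gsSeminorm d h g ≤ C :=
  ciSup_le H

theorem gsQuot_eq (h : ℝ) (f : Rd d → ℂ) (α β : Fin d → ℕ) (x : Rd d) :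
    gsQuot h f (α, β, x) =
      (∏ i, ((|x i| / h) ^ α i / ((α i).factorial : ℝ))) * ‖multiDeriv β f x‖ /
        (h ^ (∑ i, β i) * ∏ i, ((β i).factorial : ℝ)) := by
  unfold gsQuot
  simp only [div_pow, Finset.prod_div_distrib, Finset.sum_add_distrib, pow_add,
    Finset.prod_pow_eq_pow_sum]
  field_simp

/-- Since `e^t = ∑ 2^{-n} (2t)^n / n!`, some `2 (2t)^n / n!` dominates `e^t`. Used in each
coordinate, this costs `2 ^ d` and replaces `h` by `h / 2`. The constant is explicit in `g`, so the
bound is uniform over families of test functions. -/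
theorem exp_mul_multiDeriv_le {h : ℝ} (hh : 0 < h) (g : SigmaOne d) (β : Fin d → ℕ) (x : Rd d) :
    Real.exp ((∑ i, |x i|) / h) * ‖multiDeriv β g.1 x‖
      ≤ 2 ^ d * gsSeminorm d ⟨h / 2, by positivity⟩ g *
        (h ^ (∑ i, β i) * ∏ i, ((β i).factorial : ℝ)) := by
  set A := gsSeminorm d ⟨h / 2, by positivity⟩ g with hA
  have hA0 : 0 ≤ A := apply_nonneg _ _
  choose n hn using fun i : Fin d => exists_exp_le (|x i| / h)
  have h1 : Real.exp ((∑ i, |x i|) / h) ≤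
      2 ^ d * ∏ i, ((|x i| / (h / 2)) ^ n i / ((n i).factorial : ℝ)) := by
    rw [Finset.sum_div, Real.exp_sum]
    calc ∏ i, Real.exp (|x i| / h)
        ≤ ∏ i, (2 * ((2 * (|x i| / h)) ^ n i / ((n i).factorial : ℝ))) :=
          Finset.prod_le_prod (fun i _ => (Real.exp_pos _).le) (fun i _ => hn i)
      _ = _ := by
          rw [Finset.prod_mul_distrib]
          congr 1
          · simp
          · refine Finset.prod_congr rfl fun i _ => ?_
            congr 2
            field_simp
  have h2 : gsQuot (h / 2) g.1 (n, β, x) ≤ A := gsQuot_le_gsSeminorm ⟨h / 2, by positivity⟩ g _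
  rw [gsQuot_eq, div_le_iff₀ (by positivity)] at h2
  calc Real.exp ((∑ i, |x i|) / h) * ‖multiDeriv β g.1 x‖
      ≤ (2 ^ d * ∏ i, ((|x i| / (h / 2)) ^ n i / ((n i).factorial : ℝ))) *
          ‖multiDeriv β g.1 x‖ := by gcongr
    _ = 2 ^ d * ((∏ i, ((|x i| / (h / 2)) ^ n i / ((n i).factorial : ℝ))) *
          ‖multiDeriv β g.1 x‖) := by ring
    _ ≤ 2 ^ d * (A * ((h / 2) ^ (∑ i, β i) * ∏ i, ((β i).factorial : ℝ))) := by gcongr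
    _ ≤ 2 ^ d * (A * (h ^ (∑ i, β i) * ∏ i, ((β i).factorial : ℝ))) := by
        gcongr
        linarith
    _ = _ := by ring

theorem gsSeminorm_le_of_exp_bound {h : ℝ} (hh : 0 < h) {g : SigmaOne d} {C : ℝ}
    (H : ∀ (β : Fin d → ℕ) (x : Rd d), Real.exp ((∑ i, |x i|) / h) * ‖multiDeriv β g.1 x‖
        ≤ C * (h ^ (∑ i, β i) * ∏ i, ((β i).factorial : ℝ))) :
    gsSeminorm d ⟨h, hh⟩ g ≤ C := by
  refine gsSeminorm_le ?_
  rintro ⟨α, β, x⟩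
  have h1 : ∏ i, ((|x i| / h) ^ α i / ((α i).factorial : ℝ)) ≤
      Real.exp ((∑ i, |x i|) / h) := by
    rw [Finset.sum_div, Real.exp_sum]
    exact Finset.prod_le_prod (fun i _ => by positivity)
      (fun i _ => Real.pow_div_factorial_le_exp _ (by positivity) _)
  rw [gsQuot_eq, div_le_iff₀ (by positivity)]
  exact (mul_le_mul_of_nonneg_right h1 (norm_nonneg _)).trans (H β x)

/-- Weakening `β!` to `|β|!` gives a bound depending only on the length of the word, which suits
inductions on words. The loss is at most `d ^ |β|` (`factorial_sum_le`) and is recovered by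
shrinking `h`. -/
theorem norm_wordDeriv_le {h : ℝ} (hh : 0 < h) (g : SigmaOne d) (u : List (Fin d)) (x : Rd d) :
    ‖wordDeriv u g.1 x‖ ≤ (2 ^ d * gsSeminorm d ⟨h / 2, by positivity⟩ g *
      Real.exp (-((∑ i, |x i|) / h))) * (h ^ u.length * u.length.factorial) := by
  have h1 := exp_mul_multiDeriv_le hh g (fun i => u.count i) x
  rw [← wordDeriv_eq_multiDeriv u g.2.1, ← length_eq_sum_count] at h1
  have h2 : ∏ i, ((u.count i).factorial : ℝ) ≤ (u.length.factorial : ℝ) := by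
    rw [length_eq_sum_count u]
    exact_mod_cast Nat.le_of_dvd (Nat.factorial_pos _)
      (Nat.prod_factorial_dvd_factorial_sum Finset.univ fun i => u.count i)
  set A := gsSeminorm d ⟨h / 2, by positivity⟩ g with hA
  have hA0 : 0 ≤ A := apply_nonneg _ _
  rw [Real.exp_neg]
  have h3 : ‖wordDeriv u g.1 x‖ ≤ 2 ^ d * A *
      (h ^ u.length * ∏ i, ((u.count i).factorial : ℝ)) / Real.exp ((∑ i, |x i|) / h) := by
    rw [le_div_iff₀ (Real.exp_pos _), mul_comm]
    exact h1
  calc _ ≤ _ := h3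
    _ ≤ 2 ^ d * A * (h ^ u.length * (u.length.factorial : ℝ)) / Real.exp ((∑ i, |x i|) / h) := by
      gcongr
    _ = _ := by ring

theorem norm_le_sum_abs (x : Rd d) : ‖x‖ ≤ ∑ i, |x i| := by
  rw [EuclideanSpace.norm_eq]
  apply Real.sqrt_le_iff.mpr
  refine ⟨Finset.sum_nonneg fun i _ => abs_nonneg _, ?_⟩
  simpa using Finset.sum_sq_le_sq_sum_of_nonneg (s := Finset.univ) (f := fun i => |x i|)
    (fun i _ => abs_nonneg _)

theorem abs_apply_le_norm (x : Rd d) (i : Fin d) : |x i| ≤ ‖x‖ := by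
  simpa using PiLp.norm_apply_le x i

theorem sum_abs_le (x : Rd d) : ∑ i, |x i| ≤ (d + 1) * ‖x‖ := by
  calc ∑ i, |x i| ≤ ∑ _i : Fin d, ‖x‖ := Finset.sum_le_sum fun i _ => abs_apply_le_norm x i
    _ = d * ‖x‖ := by simp
    _ ≤ (d + 1) * ‖x‖ := by gcongr; linarith

theorem sum_abs_sub_le (x y : Rd d) : ∑ i, |y i| ≤ ∑ i, |x i| + ∑ i, |(y - x) i| := by
  rw [← Finset.sum_add_distrib]
  gcongr with i
  have := abs_add_le (x i) ((y - x) i)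
  simpa using this

/-- For an integer `s` the product is the binomial coefficient `C(s + n, n) ≤ 2^(s + n)`; rounding
`s` up costs one more factor. The explicit exponential dependence on `s` is what makes the seminorms
of a modulation by `ξ` grow only exponentially in `ξ`. -/
theorem prod_one_add_div_le (s : ℝ) (hs : 0 ≤ s) (n : ℕ) :
    ∏ j ∈ Finset.range n, (1 + s / (j + 1)) ≤ Real.exp (s + 1) * 2 ^ n := by
  have h1 : ∀ n : ℕ, ∏ j ∈ Finset.range n, (1 + (⌈s⌉₊ : ℝ) / (j + 1)) =
      ((⌈s⌉₊ + n).choose n : ℝ) := by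
    intro n
    induction n with
    | zero => simp
    | succ n ih =>
      rw [Finset.prod_range_succ, ih]
      have h := Nat.add_one_mul_choose_eq (⌈s⌉₊ + n) n
      have h' : ((⌈s⌉₊ : ℝ) + n + 1) * ((⌈s⌉₊ + n).choose n : ℝ) =
          ((⌈s⌉₊ + (n + 1)).choose (n + 1) : ℝ) * (n + 1) := by exact_mod_cast h
      have hn : (n : ℝ) + 1 ≠ 0 := by positivity
      field_simp
      linarith
  have h2 : ∏ j ∈ Finset.range n, (1 + s / ((j : ℝ) + 1)) ≤
      ∏ j ∈ Finset.range n, (1 + (⌈s⌉₊ : ℝ) / (j + 1)) := by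
    refine Finset.prod_le_prod (fun j _ => by positivity) fun j _ => ?_
    gcongr
    exact Nat.le_ceil s
  have h3 : ((⌈s⌉₊ + n).choose n : ℝ) ≤ 2 ^ (⌈s⌉₊ + n) := by
    exact_mod_cast Nat.choose_le_two_pow _ _
  have h4 : (2 : ℝ) ^ ⌈s⌉₊ ≤ Real.exp (s + 1) := by
    have h5 : (2 : ℝ) ≤ Real.exp 1 := by
      have := Real.add_one_le_exp 1
      linarith
    calc (2 : ℝ) ^ ⌈s⌉₊ ≤ Real.exp 1 ^ ⌈s⌉₊ := by gcongr
      _ = Real.exp ⌈s⌉₊ := by rw [← Real.exp_nat_mul, mul_one]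
      _ ≤ Real.exp (s + 1) := by
        gcongr
        exact (Nat.ceil_lt_add_one hs).le
  calc _ ≤ _ := h2
    _ ≤ _ := (h1 n).le.trans h3
    _ ≤ _ := by
      rw [pow_add]
      gcongr

/-- Translation by `x` costs an exponential of `|x|`. Derivatives falling on the character produce
factors `ξᵢ`, which `shift_word_bound` collects into the product estimated by `prod_one_add_div_le`.
-/
theorem gsSeminorm_conjShift_le {h : ℝ} (hh : 0 < h) (φ : SigmaOne d) :
    ∃ C k : ℝ, 0 ≤ C ∧ 0 ≤ k ∧ ∀ x ξ : Rd d, gsSeminorm d ⟨h, hh⟩ (conjShift φ x ξ) ≤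
      C * Real.exp (k * (‖x‖ + ‖ξ‖)) := by
  -- The factor `2` absorbs the `2 ^ n` of `prod_one_add_div_le`, and `d + 1` absorbs the `d ^ n` of
  -- `factorial_sum_le` while staying positive for `d = 0`.
  set t : ℝ := h / (2 * (d + 1)) with htdef
  have ht : 0 < t := by positivity
  have hle : t ≤ h := div_le_self hh.le (by linarith [d.cast_nonneg (α := ℝ)])
  set A := 2 ^ d * gsSeminorm d ⟨t / 2, by positivity⟩ φ with hA
  have hA0 : 0 ≤ A := mul_nonneg (by positivity) (apply_nonneg _ _)
  refine ⟨A * Real.exp 1, (d + 1) / t, by positivity, by positivity, fun x ξ => ?_⟩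
  refine gsSeminorm_le_of_exp_bound hh fun β y => ?_
  set n := ∑ i, β i with hn
  set a : ℝ := ∑ i, |ξ i| with hadef
  have ha0 : 0 ≤ a := Finset.sum_nonneg fun i _ => abs_nonneg _
  have ha : ∀ i, |ξ i| ≤ a := fun i =>
    Finset.single_le_sum (f := fun i => |ξ i|) (fun i _ => abs_nonneg _) (Finset.mem_univ i)
  set ψ : Rd d → ℂ := fun y => conj (φ (y - x)) with hψ
  have hψs : ContDiff ℝ ∞ ψ := (conj_mem (translate_mem φ.2 x)).1
  set K := A * Real.exp ((∑ i, |x i|) / t) * Real.exp (-((∑ i, |y i|) / t)) with hK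
  have hbase : ∀ u : List (Fin d), ‖wordDeriv u ψ y‖ ≤ K * (t ^ u.length * u.length.factorial) := by
    intro u
    have e : ‖wordDeriv u ψ y‖ = ‖wordDeriv u φ.1 (y - x)‖ := by
      rw [hψ, wordDeriv_conj u (fun y => φ (y - x)), wordDeriv_translate]
      simp
    rw [e]
    refine (norm_wordDeriv_le ht φ u (y - x)).trans ?_
    rw [← hA, hK, mul_assoc A (Real.exp _) (Real.exp _), ← Real.exp_add]
    gcongr ?_ * _
    gcongr
    rw [← sub_eq_add_neg, ← sub_div, ← neg_div]
    gcongr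
    have := sum_abs_sub_le x y
    linarith
  have h1 := shift_word_bound ξ hψs y ht (by positivity) ha ha0 hbase (multiWord β) []
  simp only [List.length_nil, zero_add, length_multiWord] at h1
  have h2 : ‖multiDeriv β (conjShift φ x ξ).1 y‖ =
      ‖wordDeriv [] ((multiWord β).foldr (shiftDeriv ξ) ψ) y‖ := by
    unfold multiDeriv conjShift
    rw [wordDeriv_character_mul ξ _ hψs]
    simp [norm_character, wordDeriv]
  have h3 : (n.factorial : ℝ) ≤ (d + 1 : ℝ) ^ n * ∏ i, ((β i).factorial : ℝ) := by
    have h4 : (n.factorial : ℝ) ≤ (d : ℝ) ^ n * ∏ i, ((β i).factorial : ℝ) := by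
      exact_mod_cast factorial_sum_le β
    refine h4.trans ?_
    gcongr
    linarith
  have h5 : Real.exp (-((∑ i, |y i|) / t)) ≤ Real.exp (-((∑ i, |y i|) / h)) := by
    gcongr
  have h6 := prod_one_add_div_le (a / t) (by positivity) n
  rw [h2]
  calc _ ≤ Real.exp ((∑ i, |y i|) / h) * ((A * Real.exp ((∑ i, |x i|) / t) *
        Real.exp (-((∑ i, |y i|) / h))) * (t ^ n * ((d + 1 : ℝ) ^ n * ∏ i, ((β i).factorial : ℝ))) *
          (Real.exp (a / t + 1) * 2 ^ n)) := by
        gcongr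
        refine h1.trans ?_
        rw [← hn]
        have hKle : K ≤ A * Real.exp ((∑ i, |x i|) / t) * Real.exp (-((∑ i, |y i|) / h)) := by
          rw [hK]
          gcongr
        gcongr
    _ = (Real.exp ((∑ i, |y i|) / h) * Real.exp (-((∑ i, |y i|) / h))) * ((A * Real.exp 1) *
        Real.exp ((∑ i, |x i|) / t + a / t) *
        ((t * (2 * (d + 1))) ^ n * ∏ i, ((β i).factorial : ℝ))) := by
        rw [mul_pow, mul_pow, Real.exp_add, Real.exp_add]
        ring
    _ = A * Real.exp 1 * Real.exp ((∑ i, |x i|) / t + a / t) *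
        (h ^ n * ∏ i, ((β i).factorial : ℝ)) := by
        rw [← Real.exp_add, add_neg_cancel, Real.exp_zero, one_mul]
        congr 3
        rw [htdef]
        field_simp
    _ ≤ _ := by
        gcongr
        have e1 := sum_abs_le x
        have e2 := sum_abs_le ξ
        rw [← add_div, div_mul_eq_mul_div]
        gcongr
        linarith

/-! ### Continuity of time-frequency shifts -/

theorem foldr_shiftDeriv_translate (ξ a : Rd d) (w : List (Fin d)) (f : Rd d → ℂ) :
    w.foldr (shiftDeriv ξ) (fun y => f (y - a)) = fun y => w.foldr (shiftDeriv ξ) f (y - a) := by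
  induction w with
  | nil => rfl
  | cons i w ih =>
    rw [List.foldr_cons, ih]
    funext y
    simp only [shiftDeriv, partialDeriv, List.foldr_cons, Pi.add_apply, Pi.smul_apply]
    rw [fderiv_comp_sub]

/-- Unfolding one operator `∂ᵢ - i ξᵢ` either adds a letter to `u` or produces a factor `ξᵢ`, so `u`
stays general in the induction. The expression is a polynomial in `ξ` whose coefficients are
derivatives of `f`. -/
theorem continuous_wordDeriv_foldr_shiftDeriv {f : Rd d → ℂ} (hf : ContDiff ℝ ∞ f)
    (w : List (Fin d)) : ∀ u : List (Fin d),
    Continuous fun p : Rd d × Rd d => wordDeriv u (w.foldr (shiftDeriv p.1) f) p.2 := by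
  induction w with
  | nil =>
    intro u
    exact (wordDeriv_smooth u hf).continuous.comp continuous_snd
  | cons i w ih =>
    intro u
    have e : (fun p : Rd d × Rd d => wordDeriv u ((i :: w).foldr (shiftDeriv p.1) f) p.2) =
        fun p => wordDeriv (u ++ [i]) (w.foldr (shiftDeriv p.1) f) p.2 +
          (-Complex.I * (p.1 i : ℂ)) * wordDeriv u (w.foldr (shiftDeriv p.1) f) p.2 := by
      funext p
      have hs := shiftDeriv_smooth p.1 w hf
      have hs' : ContDiff ℝ ∞ ((-Complex.I * (p.1 i : ℂ)) • w.foldr (shiftDeriv p.1) f) :=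
        contDiff_const.smul hs
      rw [List.foldr_cons, shiftDeriv, wordDeriv_add u (partialDeriv_smooth i hs) hs',
        wordDeriv_smul u _ hs, wordDeriv_append]
      rfl
    rw [e]
    refine (ih _).add (Continuous.mul ?_ (ih u))
    fun_prop

theorem continuous_character : Continuous fun p : Rd d × Rd d => character p.1 p.2 := by
  unfold character
  fun_prop

theorem continuous_wordDeriv_conjShift (φ : SigmaOne d) (w : List (Fin d)) :
    Continuous fun p : (Rd d × Rd d) × Rd d => wordDeriv w (conjShift φ p.1.1 p.1.2).1 p.2 := by
  set ψ : Rd d → ℂ := fun y => conj (φ y) with hψ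
  have hc : ContDiff ℝ ∞ ψ := (conj_mem φ.2).1
  have e : (fun p : (Rd d × Rd d) × Rd d => wordDeriv w (conjShift φ p.1.1 p.1.2).1 p.2) =
      fun p => character p.1.2 p.2 *
        wordDeriv [] (w.foldr (shiftDeriv p.1.2) ψ) (p.2 - p.1.1) := by
    funext p
    unfold conjShift
    rw [wordDeriv_character_mul _ _ (conj_mem (translate_mem φ.2 p.1.1)).1]
    rw [foldr_shiftDeriv_translate p.1.2 p.1.1 w ψ]
    rfl
  rw [e]
  clear e
  clear_value ψ
  have h1 : Continuous fun p : (Rd d × Rd d) × Rd d => (p.1.2, p.2) := by fun_prop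
  have h2 : Continuous fun p : (Rd d × Rd d) × Rd d => (p.1.2, p.2 - p.1.1) := by fun_prop
  have h3 := continuous_wordDeriv_foldr_shiftDeriv hc w []
  refine Continuous.mul ?_ ?_
  · exact continuous_character.comp h1
  · have h4 := h3.comp h2
    simp only [Function.comp_def] at h4
    exact h4

end Seminorms

/-! ### Continuity of maps into `Σ₁`, and weak integrals with values in `Σ₁`. -/

section Synthesis

open scoped ContDiff ComplexConjugate ENNReal

variable {d : ℕ}

theorem eventually_forall_closedBall_lt {Z : Type*} [TopologicalSpace Z] {F : Z × Rd d → ℝ}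
    (hF : Continuous F) {z₀ : Z} {c : ℝ} (R : ℝ) (h0 : ∀ y, F (z₀, y) < c) :
    ∀ᶠ z in 𝓝 z₀, ∀ y ∈ Metric.closedBall (0 : Rd d) R, F (z, y) < c :=
  (isCompact_closedBall (0 : Rd d) R).eventually_forall_of_forall_eventually fun y _ =>
    hF.continuousAt.eventually_lt continuousAt_const (h0 y)

theorem multiDeriv_sub (β : Fin d → ℕ) (f g : SigmaOne d) (y : Rd d) :
    multiDeriv β (f - g).1 y = wordDeriv (multiWord β) f.1 y - wordDeriv (multiWord β) g.1 y := by
  have : (f - g).1 = f.1 + (-1 : ℂ) • g.1 := by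
    rw [neg_one_smul, ← sub_eq_add_neg]
    rfl
  have hs : ContDiff ℝ ∞ ((-1 : ℂ) • g.1) := contDiff_const.smul g.2.1
  unfold multiDeriv
  rw [this, wordDeriv_add _ f.2.1 hs, wordDeriv_smul _ _ g.2.1,
    neg_one_smul, ← sub_eq_add_neg]
  rfl

theorem finite_sum_lt (N : ℕ) : {β : Fin d → ℕ | ∑ i, β i < N}.Finite := by
  refine (Set.finite_Iic (fun _ : Fin d => N)).subset fun β hβ i => ?_
  exact (Finset.single_le_sum (f := β) (fun _ _ => Nat.zero_le _) (Finset.mem_univ i)).trans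
    (le_of_lt hβ)

/-- Halving `h` once more gains both `exp(-|y|₁ / h)` and `2^{-|β|}`. The `h`-quotients are
therefore uniformly small outside a compact set of `y` and a finite set of `β`. -/
theorem exp_mul_multiDeriv_le_decay {h B : ℝ} (hh : 0 < h) {g : SigmaOne d}
    (hg : gsSeminorm d ⟨h / 2 / 2, by positivity⟩ g ≤ B) (β : Fin d → ℕ) (y : Rd d) :
    Real.exp ((∑ i, |y i|) / h) * ‖multiDeriv β g.1 y‖ ≤
      2 ^ d * B * Real.exp (-((∑ i, |y i|) / h)) * (1 / 2) ^ (∑ i, β i) *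
        (h ^ (∑ i, β i) * ∏ i, ((β i).factorial : ℝ)) := by
  have h1 := exp_mul_multiDeriv_le (h := h / 2) (by positivity) g β y
  have e : Real.exp ((∑ i, |y i|) / h) =
      Real.exp (-((∑ i, |y i|) / h)) * Real.exp ((∑ i, |y i|) / (h / 2)) := by
    rw [← Real.exp_add]
    congr 1
    field_simp
    ring
  rw [e, mul_assoc]
  calc _ ≤ Real.exp (-((∑ i, |y i|) / h)) * (2 ^ d * B *
        ((h / 2) ^ (∑ i, β i) * ∏ i, ((β i).factorial : ℝ))) := by
        refine mul_le_mul_of_nonneg_left (h1.trans ?_) (Real.exp_pos _).le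
        gcongr
    _ = _ := by
        rw [div_pow, div_pow]
        ring

/-- A locally bounded map into `Σ₁(ℝᵈ)` with jointly continuous derivatives is continuous. -/
theorem continuousAt_sigmaOne {Z : Type*} [TopologicalSpace Z] {Φ : Z → SigmaOne d} {z₀ : Z}
    (hb : ∀ h, ∃ B, ∀ᶠ z in 𝓝 z₀, gsSeminorm d h (Φ z) ≤ B)
    (hc : ∀ w : List (Fin d), Continuous fun p : Z × Rd d => wordDeriv w (Φ p.1).1 p.2) :
    ContinuousAt Φ z₀ := by
  unfold ContinuousAt
  rw [(sigmaOne_withSeminorms d).tendsto_nhds]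
  rintro ⟨h, hh⟩ ε hε
  obtain ⟨B, hB⟩ := hb ⟨h / 2 / 2, by positivity⟩
  have hloc : ∀ᶠ z in 𝓝 z₀, gsSeminorm d ⟨h / 2 / 2, by positivity⟩ (Φ z - Φ z₀) ≤ B + B := by
    filter_upwards [hB] with z hz
    exact (map_sub_le_add _ _ _).trans (add_le_add hz hB.self_of_nhds)
  have hB0 : 0 ≤ B := (apply_nonneg _ _).trans hB.self_of_nhds
  set D := 2 ^ d * (B + B) with hD
  -- Orders `|β| ≥ N` and points `|y| > R` are handled by the extra decay; the finitely many
  -- remaining `β` on the closed ball are handled by compactness.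
  obtain ⟨N, hN⟩ : ∃ N : ℕ, D * (1 / 2 : ℝ) ^ N < ε / 2 := by
    have h1 := (tendsto_pow_atTop_nhds_zero_of_lt_one (r := (1 / 2 : ℝ)) (by norm_num)
      (by norm_num)).const_mul D
    rw [mul_zero] at h1
    exact (h1.eventually_lt_const (by positivity)).exists
  obtain ⟨R, hR⟩ : ∃ R : ℝ, D * Real.exp (-(R / h)) < ε / 2 := by
    have h1 : Tendsto (fun R : ℝ => D * Real.exp (-(R / h))) atTop (𝓝 (D * 0)) :=
      (Real.tendsto_exp_neg_atTop_nhds_zero.comp (tendsto_id.atTop_div_const hh)).const_mul D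
    rw [mul_zero] at h1
    exact (h1.eventually_lt_const (by positivity)).exists
  have hcompact : ∀ᶠ z in 𝓝 z₀, ∀ β ∈ {β : Fin d → ℕ | ∑ i, β i < N},
      ∀ y ∈ Metric.closedBall (0 : Rd d) R,
        Real.exp ((∑ i, |y i|) / h) * ‖multiDeriv β (Φ z - Φ z₀).1 y‖ <
      ε / 2 * (h ^ (∑ i, β i) * ∏ i, ((β i).factorial : ℝ)) := by
    rw [eventually_all_finite (finite_sum_lt N)]
    intro β _
    have hcont : Continuous fun p : Z × Rd d => Real.exp ((∑ i, |p.2 i|) / h) *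
        ‖multiDeriv β (Φ p.1 - Φ z₀).1 p.2‖ := by
      simp only [multiDeriv_sub]
      have h1 := hc (multiWord β)
      have h2 := (wordDeriv_smooth (multiWord β) (Φ z₀).2.1).continuous
      fun_prop
    refine eventually_forall_closedBall_lt hcont R fun y => ?_
    rw [multiDeriv_sub, sub_self, norm_zero, mul_zero]
    positivity
  filter_upwards [hloc, hcompact] with z hz hzc
  refine lt_of_le_of_lt (gsSeminorm_le_of_exp_bound hh (C := ε / 2) fun β y => ?_) (half_lt_self hε)
  have hdecay := exp_mul_multiDeriv_le_decay hh hz β y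
  rw [← hD] at hdecay
  rcases lt_or_ge (∑ i, β i) N with hβ | hβ
  · by_cases hy : y ∈ Metric.closedBall (0 : Rd d) R
    · exact (hzc β hβ y hy).le
    · refine hdecay.trans ?_
      gcongr
      rw [mem_closedBall_zero_iff, not_le] at hy
      calc D * Real.exp (-((∑ i, |y i|) / h)) * (1 / 2) ^ (∑ i, β i)
          ≤ D * Real.exp (-(R / h)) * 1 := by
            gcongr
            · exact hy.le.trans (norm_le_sum_abs y)
            · exact pow_le_one₀ (by norm_num) (by norm_num)
        _ ≤ ε / 2 := by rw [mul_one]; exact hR.le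
  · refine hdecay.trans ?_
    gcongr
    calc D * Real.exp (-((∑ i, |y i|) / h)) * (1 / 2) ^ (∑ i, β i)
        ≤ D * 1 * (1 / 2) ^ N := by
          gcongr ?_ * ?_ * ?_
          · rw [Real.exp_le_one_iff, neg_nonpos]
            positivity
          · exact pow_le_pow_of_le_one (by norm_num) (by norm_num) hβ
      _ ≤ ε / 2 := by rw [mul_one]; exact hN.le

theorem continuous_conjShift (φ : SigmaOne d) :
    Continuous fun z : Rd d × Rd d => conjShift φ z.1 z.2 := by
  rw [continuous_iff_continuousAt]
  refine fun z₀ => continuousAt_sigmaOne (fun h => ?_) (continuous_wordDeriv_conjShift φ)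
  obtain ⟨C, k, hC, hk, hCk⟩ := gsSeminorm_conjShift_le h.2 φ
  refine ⟨C * Real.exp (k * (‖z₀.1‖ + 1 + (‖z₀.2‖ + 1))), ?_⟩
  filter_upwards [Metric.ball_mem_nhds z₀ one_pos] with z hz
  refine (hCk z.1 z.2).trans ?_
  rw [mem_ball_iff_norm] at hz
  have h1 : ‖z.1 - z₀.1‖ ≤ ‖z - z₀‖ := norm_fst_le (z - z₀)
  have h2 : ‖z.2 - z₀.2‖ ≤ ‖z - z₀‖ := norm_snd_le (z - z₀)
  have h3 := norm_le_norm_add_norm_sub' z.1 z₀.1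
  have h4 := norm_le_norm_add_norm_sub' z.2 z₀.2
  gcongr <;> linarith

/-! ### Isometric embeddings into `ℓ^∞` and extension of functionals -/

/-- The factor of `‖∂^β f(x)‖` in `gsQuot`. -/
noncomputable def gsCoeff (h : ℝ) (p : (Fin d → ℕ) × (Fin d → ℕ) × Rd d) : ℝ :=
  (∏ i, |p.2.2 i| ^ p.1 i) / (h ^ (∑ i, (p.1 i + p.2.1 i)) * (∏ i, ((p.1 i).factorial : ℝ)) *
      ∏ i, ((p.2.1 i).factorial : ℝ))

theorem norm_gsCoeff_mul {h : ℝ} (hh : 0 < h) (f : Rd d → ℂ)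
    (p : (Fin d → ℕ) × (Fin d → ℕ) × Rd d) :
    ‖(gsCoeff h p : ℂ) * multiDeriv p.2.1 f p.2.2‖ = gsQuot h f p := by
  have h0 : 0 ≤ gsCoeff h p := by
    unfold gsCoeff
    positivity
  rw [norm_mul, Complex.norm_real, Real.norm_of_nonneg h0, gsCoeff, gsQuot]
  ring

/-- The isometric embedding of `Σ₁(ℝᵈ)`, with the norm `‖·‖_[h]`, into a space `ℓ^∞`. -/
noncomputable def gsEmbed (h : {h : ℝ // 0 < h}) :
    SigmaOne d →ₗ[ℂ] lp (fun _ : (Fin d → ℕ) × (Fin d → ℕ) × Rd d => ℂ) ∞ where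
  toFun g := ⟨fun p => (gsCoeff h.1 p : ℂ) * multiDeriv p.2.1 g.1 p.2.2, by
    refine memℓp_infty ?_
    simp only [norm_gsCoeff_mul h.2]
    exact g.2.2 h.1 h.2⟩
  map_add' f g := by
    ext p
    change (gsCoeff h.1 p : ℂ) * wordDeriv _ (f.1 + g.1) p.2.2 = _ + _
    rw [wordDeriv_add _ f.2.1 g.2.1, Pi.add_apply, mul_add]
    rfl
  map_smul' c f := by
    ext p
    change (gsCoeff h.1 p : ℂ) * wordDeriv _ (c • f.1) p.2.2 = c * _
    rw [wordDeriv_smul _ _ f.2.1, Pi.smul_apply, smul_eq_mul, mul_left_comm]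
    rfl

theorem gsEmbed_apply (h : {h : ℝ // 0 < h}) (g : SigmaOne d)
    (p : (Fin d → ℕ) × (Fin d → ℕ) × Rd d) :
    gsEmbed h g p = (gsCoeff h.1 p : ℂ) * multiDeriv p.2.1 g.1 p.2.2 := rfl

theorem norm_gsEmbed (h : {h : ℝ // 0 < h}) (g : SigmaOne d) :
    ‖gsEmbed h g‖ = gsSeminorm d h g := by
  rw [lp.norm_eq_ciSup]
  change _ = ⨆ p, gsQuot h.1 g.1 p
  refine iSup_congr fun p => ?_
  rw [gsEmbed_apply, norm_gsCoeff_mul h.2]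

theorem norm_apply_le_gsSeminorm (h : {h : ℝ // 0 < h}) (g : SigmaOne d) (x : Rd d) :
    ‖g x‖ ≤ gsSeminorm d h g := by
  have h1 := gsQuot_le_gsSeminorm h g (0, 0, x)
  simpa [gsQuot, multiDeriv, multiWord_zero, wordDeriv] using h1

theorem SigmaOne.ext {f g : SigmaOne d} (H : ∀ x, f x = g x) : f = g :=
  Subtype.ext (funext H)

theorem gsEmbed_injective (h : {h : ℝ // 0 < h}) :
    Function.Injective (gsEmbed h : SigmaOne d →ₗ[ℂ] _) := by
  rw [injective_iff_map_eq_zero]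
  intro g hg
  refine SigmaOne.ext fun x => ?_
  have h1 := norm_apply_le_gsSeminorm h g x
  rw [← norm_gsEmbed, hg, norm_zero] at h1
  exact norm_le_zero_iff.mp h1

theorem gsSeminorm_anti {h h' : {h : ℝ // 0 < h}} (hle : h ≤ h') (g : SigmaOne d) :
    gsSeminorm d h' g ≤ gsSeminorm d h g := by
  refine gsSeminorm_le fun p => ?_
  refine le_trans ?_ (gsQuot_le_gsSeminorm h g p)
  unfold gsQuot
  have h1 : (h : ℝ) ≤ h' := hle
  have h2 : (0 : ℝ) < h := h.2
  gcongr

/-- The seminorms increase as `h` decreases, so a finite family is dominated by the one with the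
smallest `h`. -/
theorem exists_gsSeminorm_bound (f : SigmaOneDual d) :
    ∃ (h : {h : ℝ // 0 < h}) (C : ℝ), 0 ≤ C ∧ ∀ g, ‖f g‖ ≤ C * gsSeminorm d h g := by
  have : Nonempty {h : ℝ // 0 < h} := ⟨⟨1, one_pos⟩⟩
  obtain ⟨s, C, -, hC⟩ := Seminorm.bound_of_continuous (sigmaOne_withSeminorms d)
    ((normSeminorm ℂ ℂ).comp f.toLinearMap) (continuous_norm.comp f.continuous)
  obtain ⟨h, hs⟩ : ∃ h : {h : ℝ // 0 < h}, ∀ h' ∈ s, h ≤ h' := by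
    clear hC
    induction s using Finset.induction_on with
    | empty => exact ⟨⟨1, one_pos⟩, by simp⟩
    | insert a t _ ih =>
      obtain ⟨h, hh⟩ := ih
      exact ⟨min a h, by simpa using fun b hb hbt => Or.inr (hh ⟨b, hb⟩ hbt)⟩
  refine ⟨h, C, C.2, fun g => (hC g).trans ?_⟩
  change (C : ℝ) * (s.sup (gsSeminorm d)) g ≤ _
  gcongr
  exact Seminorm.finset_sup_apply_le (apply_nonneg _ _) fun i hi => gsSeminorm_anti (hs i hi) g

/-- A functional bounded by one norm is a bounded functional on the range of the isometry `gsEmbed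
h`, and Hahn–Banach extends it. This allows Bochner integration in a Banach space in place of
integration in the Fréchet space `Σ₁`. -/
theorem exists_extension_gsEmbed (f : SigmaOneDual d) :
    ∃ (h : {h : ℝ // 0 < h})
      (L : lp (fun _ : (Fin d → ℕ) × (Fin d → ℕ) × Rd d => ℂ) ∞ →L[ℂ] ℂ),
      ∀ g, f g = L (gsEmbed h g) := by
  obtain ⟨h, C, hC, hf⟩ := exists_gsSeminorm_bound f
  let e := LinearEquiv.ofInjective (gsEmbed h) (gsEmbed_injective (d := d) h)
  let L₀ : LinearMap.range (gsEmbed (d := d) h) →L[ℂ] ℂ :=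
    (f.toLinearMap ∘ₗ e.symm.toLinearMap).mkContinuous C (by
      intro u
      obtain ⟨g, rfl⟩ := e.surjective u
      have : ‖e g‖ = gsSeminorm d h g := norm_gsEmbed h g
      simpa [this] using hf g)
  obtain ⟨L, hL, -⟩ := exists_extension_norm_eq _ L₀
  refine ⟨h, L, fun g => ?_⟩
  have h1 := hL (e g)
  have h2 : L₀ (e g) = f g := by
    simp [L₀]
  rw [← h2, ← h1]
  rfl

/-- Evaluation of a derivative at a point, as a linear functional on `Σ₁(ℝᵈ)`. -/
noncomputable def wordEvalLin (w : List (Fin d)) (y : Rd d) : SigmaOne d →ₗ[ℂ] ℂ where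
  toFun g := wordDeriv w g.1 y
  map_add' f g := by
    change wordDeriv w (f.1 + g.1) y = _
    rw [wordDeriv_add _ f.2.1 g.2.1]
    rfl
  map_smul' c f := by
    change wordDeriv w (c • f.1) y = _
    rw [wordDeriv_smul _ _ f.2.1]
    rfl

theorem norm_wordEvalLin_le (w : List (Fin d)) (y : Rd d) (g : SigmaOne d) :
    ‖wordEvalLin w y g‖ ≤
      2 ^ d * (w.length.factorial : ℝ) * gsSeminorm d ⟨1 / 2, by norm_num⟩ g := by
  have h1 := norm_wordDeriv_le one_pos g w y
  refine h1.trans ?_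
  rw [one_pow, one_mul]
  have h2 : Real.exp (-((∑ i, |y i|) / 1)) ≤ 1 := by
    rw [Real.exp_le_one_iff, neg_nonpos]
    positivity
  have h3 : 0 ≤ gsSeminorm d ⟨1 / 2, by norm_num⟩ g := apply_nonneg _ _
  calc _ ≤ 2 ^ d * gsSeminorm d ⟨1 / 2, by norm_num⟩ g * 1 * (w.length.factorial : ℝ) := by
        gcongr
    _ = _ := by ring

/-- Evaluation of a derivative at a point, as an element of `Σ₁'(ℝᵈ)`. -/
noncomputable def wordEval (w : List (Fin d)) (y : Rd d) : SigmaOneDual d :=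
  ⟨wordEvalLin w y, by
    refine (sigmaOne_withSeminorms d).continuous_normedSpace_rng ℂ (wordEvalLin w y)
      ⟨{⟨1 / 2, by norm_num⟩}, ⟨2 ^ d * w.length.factorial, by positivity⟩, fun g => ?_⟩
    rw [Finset.sup_singleton]
    exact norm_wordEvalLin_le w y g⟩

theorem norm_wordEval_le (w : List (Fin d)) (y : Rd d) (g : SigmaOne d) :
    ‖wordEval w y g‖ ≤ 2 ^ d * (w.length.factorial : ℝ) * gsSeminorm d ⟨1 / 2, by norm_num⟩ g :=
  norm_wordEvalLin_le w y g

/-! ### Superpositions of elements of `Σ₁(ℝᵈ)` -/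

theorem fderiv_eq_sum_partialDeriv (f : Rd d → ℂ) (x : Rd d) :
    fderiv ℝ f x = ∑ i, (EuclideanSpace.proj i : Rd d →L[ℝ] ℝ).smulRight (partialDeriv i f x) := by
  ext v
  have hv : v = ∑ i, v i • EuclideanSpace.single i (1 : ℝ) := by
    ext j
    simp [Finset.sum_apply, Pi.single_apply]
  conv_lhs => rw [hv]
  rw [map_sum, sum_apply]
  refine Finset.sum_congr rfl fun i _ => ?_
  rw [map_smul]
  rfl

theorem norm_proj_smulRight_le (i : Fin d) (c : ℂ) :
    ‖(EuclideanSpace.proj i : Rd d →L[ℝ] ℝ).smulRight c‖ ≤ ‖c‖ := by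
  refine ContinuousLinearMap.opNorm_le_bound _ (norm_nonneg _) fun v => ?_
  rw [ContinuousLinearMap.smulRight_apply, norm_smul, mul_comm]
  gcongr
  exact abs_apply_le_norm v i

theorem hasFDerivAt_integral_of_partial {Z : Type*} [MeasurableSpace Z] {μ : Measure Z}
    {A : Rd d → Z → ℂ} {A' : Fin d → Rd d → Z → ℂ} {b : Z → ℝ} (y : Rd d)
    (hA : ∀ x, Integrable (A x) μ) (hA' : ∀ i, Integrable (A' i y) μ) (hb : Integrable b μ)
    (hbound : ∀ i x z, ‖A' i x z‖ ≤ b z)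
    (hd : ∀ x z, HasFDerivAt (fun x => A x z)
      (∑ i, (EuclideanSpace.proj i : Rd d →L[ℝ] ℝ).smulRight (A' i x z)) x) :
    HasFDerivAt (fun x => ∫ z, A x z ∂μ)
      (∑ i, (EuclideanSpace.proj i : Rd d →L[ℝ] ℝ).smulRight (∫ z, A' i y z ∂μ)) y := by
  have hI' : ∀ i ∈ Finset.univ, Integrable (fun z =>
      (EuclideanSpace.proj i : Rd d →L[ℝ] ℝ).smulRight (A' i y z)) μ :=
    fun i _ => (ContinuousLinearMap.smulRightL ℝ (Rd d) ℂ
      (EuclideanSpace.proj i : Rd d →L[ℝ] ℝ)).integrable_comp (hA' i)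
  have hm := Finset.aestronglyMeasurable_fun_sum Finset.univ fun i hi =>
    (hI' i hi).aestronglyMeasurable
  have hn : ∀ x z, ‖∑ i, (EuclideanSpace.proj i : Rd d →L[ℝ] ℝ).smulRight (A' i x z)‖ ≤
      (d : ℝ) * b z := by
    intro x z
    refine (norm_sum_le _ _).trans ?_
    calc _ ≤ ∑ _i : Fin d, b z := Finset.sum_le_sum fun i _ =>
          (norm_proj_smulRight_le i _).trans (hbound i x z)
      _ = _ := by simp
  have key := hasFDerivAt_integral_of_dominated_of_fderiv_le (𝕜 := ℝ) (μ := μ) (x₀ := y)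
    (F := A) (F' := fun x z => ∑ i, (EuclideanSpace.proj i : Rd d →L[ℝ] ℝ).smulRight (A' i x z))
    (bound := fun z => (d : ℝ) * b z) (s := Set.univ) univ_mem
    (Eventually.of_forall fun x => (hA x).aestronglyMeasurable) (hA y) hm
    (Eventually.of_forall fun z x _ => hn x z) (hb.const_mul _)
    (Eventually.of_forall fun z x _ => hd x z)
  rw [integral_finsetSum _ hI'] at key
  have e : ∀ i, ∫ z, (EuclideanSpace.proj i : Rd d →L[ℝ] ℝ).smulRight (A' i y z) ∂μ =
      (EuclideanSpace.proj i : Rd d →L[ℝ] ℝ).smulRight (∫ z, A' i y z ∂μ) := fun i =>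
    (ContinuousLinearMap.smulRightL ℝ (Rd d) ℂ
      (EuclideanSpace.proj i : Rd d →L[ℝ] ℝ)).integral_comp_comm (hA' i)
  rw [Finset.sum_congr rfl fun i _ => e i] at key
  exact key

section Superposition

variable {Z : Type*} [TopologicalSpace Z] [MeasurableSpace Z] [OpensMeasurableSpace Z]
  {μ : Measure Z} {Φ : Z → SigmaOne d} {G : Z → ℂ}

theorem integrable_mul_dual (hΦ : Continuous Φ) (hG : AEStronglyMeasurable G μ)
    (hGint : ∀ h, Integrable (fun z => ‖G z‖ * gsSeminorm d h (Φ z)) μ) (f : SigmaOneDual d) :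
    Integrable (fun z => G z * f (Φ z)) μ := by
  obtain ⟨h, C, hC, hf⟩ := exists_gsSeminorm_bound f
  refine ((hGint h).const_mul C).mono'
    (hG.mul (f.continuous.comp hΦ).aestronglyMeasurable) (Eventually.of_forall fun z => ?_)
  rw [norm_mul]
  calc ‖G z‖ * ‖f (Φ z)‖ ≤ ‖G z‖ * (C * gsSeminorm d h (Φ z)) := by gcongr; exact hf _
    _ = _ := by ring

/-- Stated for every word, so that the derivative involves integrals of the same kind and can be
differentiated again. -/
theorem hasFDerivAt_superposition (hΦ : Continuous Φ) (hG : AEStronglyMeasurable G μ)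
    (hGint : ∀ h, Integrable (fun z => ‖G z‖ * gsSeminorm d h (Φ z)) μ) (w : List (Fin d))
    (y : Rd d) :
    HasFDerivAt (fun y => ∫ z, G z * wordEval w y (Φ z) ∂μ)
      (∑ i, (EuclideanSpace.proj i : Rd d →L[ℝ] ℝ).smulRight
        (∫ z, G z * wordEval (i :: w) y (Φ z) ∂μ)) y := by
  have hI : ∀ (u : List (Fin d)) (x : Rd d),
      Integrable (fun z => G z * wordEval u x (Φ z)) μ := fun u x =>
    integrable_mul_dual hΦ hG hGint (wordEval u x)
  have hbound : ∀ (i : Fin d) (x : Rd d) (z : Z), ‖G z * wordEval (i :: w) x (Φ z)‖ ≤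
      2 ^ d * ((w.length + 1).factorial : ℝ) *
      (‖G z‖ * gsSeminorm d ⟨1 / 2, by norm_num⟩ (Φ z)) := by
    intro i x z
    rw [norm_mul]
    have h1 := norm_wordEval_le (i :: w) x (Φ z)
    rw [List.length_cons] at h1
    calc _ ≤ ‖G z‖ * _ := mul_le_mul_of_nonneg_left h1 (norm_nonneg _)
      _ = _ := by ring
  have hdiff : ∀ (z : Z) (x : Rd d), HasFDerivAt (fun x => G z * wordEval w x (Φ z))
      (∑ i, (EuclideanSpace.proj i : Rd d →L[ℝ] ℝ).smulRight
        (G z * wordEval (i :: w) x (Φ z))) x := by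
    intro z x
    have h1 : HasFDerivAt (wordDeriv w (Φ z).1) (fderiv ℝ (wordDeriv w (Φ z).1) x) x :=
      ((wordDeriv_smooth w (Φ z).2.1).differentiable (by simp) x).hasFDerivAt
    have h2 := h1.const_mul (G z)
    rw [fderiv_eq_sum_partialDeriv, Finset.smul_sum] at h2
    have e : ∀ i, (EuclideanSpace.proj i : Rd d →L[ℝ] ℝ).smulRight
        (G z * wordEval (i :: w) x (Φ z)) = G z • (EuclideanSpace.proj i : Rd d →L[ℝ] ℝ).smulRight
          (partialDeriv i (wordDeriv w (Φ z).1) x) := by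
      intro i
      ext v
      simp only [ContinuousLinearMap.smulRight_apply, smul_apply,
        Complex.real_smul, smul_eq_mul]
      change _ * (_ * partialDeriv i (wordDeriv w (Φ z).1) x) = _
      ring
    rw [Finset.sum_congr rfl fun i _ => e i]
    exact h2
  exact hasFDerivAt_integral_of_partial (A := fun x z => G z * wordEval w x (Φ z))
    (A' := fun i x z => G z * wordEval (i :: w) x (Φ z)) y (hI w) (fun i => hI (i :: w) y)
    ((hGint _).const_mul _) hbound fun x z => hdiff z x

/-- The integral is formed pointwise and differentiated under the integral sign. Its image under
`gsEmbed h` is a Bochner integral in `ℓ^∞`. -/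
theorem exists_superposition [SecondCountableTopology Z] (hΦ : Continuous Φ)
    (hG : AEStronglyMeasurable G μ)
    (hGint : ∀ h, Integrable (fun z => ‖G z‖ * gsSeminorm d h (Φ z)) μ) :
    ∃ g : SigmaOne d, (∀ y, g y = ∫ z, G z * Φ z y ∂μ) ∧
      ∀ f : SigmaOneDual d, f g = ∫ z, G z * f (Φ z) ∂μ := by
  set I : List (Fin d) → Rd d → ℂ := fun w y => ∫ z, G z * wordEval w y (Φ z) ∂μ with hI
  have hd : ∀ w y, HasFDerivAt (I w) (∑ i, (EuclideanSpace.proj i : Rd d →L[ℝ] ℝ).smulRight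
      (I (i :: w) y)) y := fun w y => hasFDerivAt_superposition hΦ hG hGint w y
  have hsmooth : ∀ (n : ℕ) (w : List (Fin d)), ContDiff ℝ n (I w) := by
    intro n
    induction n with
    | zero =>
      intro w
      rw [Nat.cast_zero, contDiff_zero]
      exact continuous_iff_continuousAt.mpr fun y => (hd w y).continuousAt
    | succ n ih =>
      intro w
      refine (contDiff_succ_iff_hasFDerivAt (n := n)).mpr ⟨_, ?_, hd w⟩
      refine ContDiff.sum fun i _ => ?_
      exact (ContinuousLinearMap.smulRightL ℝ (Rd d) ℂ
        (EuclideanSpace.proj i : Rd d →L[ℝ] ℝ)).contDiff.comp (ih (i :: w))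
  have hw : ∀ w, wordDeriv w (I []) = I w := by
    intro w
    induction w with
    | nil => rfl
    | cons i w ih =>
      change partialDeriv i (wordDeriv w (I [])) = _
      rw [ih]
      funext y
      unfold partialDeriv
      rw [(hd w y).fderiv, sum_apply, Finset.sum_eq_single i]
      · simp
      · intro j _ hj
        simp [hj]
      · simp
  have hmem : I [] ∈ sigmaOneSubmodule d := by
    refine ⟨contDiff_infty.mpr fun n => hsmooth n [], fun h hh => ?_⟩
    refine ⟨∫ z, ‖G z‖ * gsSeminorm d ⟨h, hh⟩ (Φ z) ∂μ, ?_⟩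
    rintro _ ⟨p, rfl⟩
    rw [← norm_gsCoeff_mul hh, multiDeriv, hw, hI, ← integral_const_mul]
    refine norm_integral_le_of_norm_le (hGint _) (Eventually.of_forall fun z => ?_)
    rw [mul_left_comm, norm_mul]
    refine mul_le_mul_of_nonneg_left ?_ (norm_nonneg _)
    exact (norm_gsCoeff_mul hh (Φ z).1 p).le.trans (gsQuot_le_gsSeminorm ⟨h, hh⟩ (Φ z) p)
  obtain ⟨g, hg⟩ : ∃ g : SigmaOne d, g.1 = I [] := ⟨⟨I [], hmem⟩, rfl⟩
  refine ⟨g, fun y => congrFun hg y, fun f => ?_⟩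
  -- The functional `f` cannot be applied to a pointwise integral directly, but its extension `L`
  -- commutes with the Bochner integral.
  obtain ⟨h, L, hL⟩ := exists_extension_gsEmbed f
  have hcont : Continuous fun z => gsEmbed h (Φ z) := by
    rw [continuous_iff_continuousAt]
    intro z₀
    rw [ContinuousAt, tendsto_iff_norm_sub_tendsto_zero]
    simp only [← map_sub, norm_gsEmbed]
    have h1 : Continuous (gsSeminorm d h) := (sigmaOne_withSeminorms d).continuous_seminorm h
    have h2 : Continuous fun z => Φ z - Φ z₀ := by
      have := (sigmaOne_withSeminorms d).topologicalAddGroup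
      exact hΦ.sub continuous_const
    have h3 := (h1.comp h2).tendsto z₀
    simpa [Function.comp_def] using h3
  have hBint : Integrable (fun z => G z • gsEmbed h (Φ z)) μ := by
    refine (hGint h).mono' (hG.smul hcont.aestronglyMeasurable) (Eventually.of_forall fun z => ?_)
    rw [norm_smul, norm_gsEmbed]
  have hrep : gsEmbed h g = ∫ z, G z • gsEmbed h (Φ z) ∂μ := by
    ext p
    have h1 := (lp.evalCLM ℂ (fun _ : (Fin d → ℕ) × (Fin d → ℕ) × Rd d => ℂ) ∞ p).integral_comp_comm
      hBint
    refine Eq.trans ?_ h1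
    rw [gsEmbed_apply, multiDeriv, hg, hw, hI, ← integral_const_mul]
    refine integral_congr_ae (Eventually.of_forall fun z => ?_)
    exact mul_left_comm _ _ _
  rw [hL, hrep, ← L.integral_comp_comm hBint]
  refine integral_congr_ae (Eventually.of_forall fun z => ?_)
  simp only [map_smul, smul_eq_mul, hL]

end Superposition

end Synthesis

/-! ### Superexponential decay of the pairing of test functions with shifts of `φ`. -/

section Analysis

open scoped ContDiff ComplexConjugate ENNReal

variable {d : ℕ}

/-! ### Derivatives of products -/

theorem partialDeriv_mul (i : Fin d) {f g : Rd d → ℂ} (hf : ContDiff ℝ ∞ f)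
    (hg : ContDiff ℝ ∞ g) :
    partialDeriv i (f * g) = partialDeriv i f * g + f * partialDeriv i g := by
  funext x
  have h1 := (hf.differentiable (by simp)) x
  have h2 := (hg.differentiable (by simp)) x
  simp only [partialDeriv, Pi.mul_def, Pi.add_apply]
  rw [fderiv_fun_mul h1 h2]
  simp
  ring

/-- Leibniz's rule as a recursion: the innermost derivative falls on one factor or the other, which
lengthens `u` or `v` by one letter. The total order is unchanged, so each letter costs only a factor
`2`. -/
theorem norm_wordDeriv_mul_le {f g : Rd d → ℂ} (hf : ContDiff ℝ ∞ f) (hg : ContDiff ℝ ∞ g)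
    {y : Rd d} {A B t : ℝ} (hA : 0 ≤ A) (hB : 0 ≤ B) (ht : 0 < t)
    (hfA : ∀ u : List (Fin d), ‖wordDeriv u f y‖ ≤ A * (t ^ u.length * u.length.factorial))
    (hgB : ∀ u : List (Fin d), ‖wordDeriv u g y‖ ≤ B * (t ^ u.length * u.length.factorial))
    (w : List (Fin d)) : ∀ u v : List (Fin d),
    ‖wordDeriv w (wordDeriv u f * wordDeriv v g) y‖ ≤
      A * B * (t ^ (u.length + v.length + w.length) *
        (u.length + v.length + w.length).factorial) * 2 ^ w.length := by
  induction w using List.reverseRecOn with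
  | nil =>
    intro u v
    have h1 : ((u.length.factorial : ℝ)) * v.length.factorial ≤
        ((u.length + v.length).factorial : ℝ) := by
      exact_mod_cast Nat.le_of_dvd (Nat.factorial_pos _)
        (Nat.factorial_mul_factorial_dvd_factorial_add _ _)
    have h2 : ‖wordDeriv [] (wordDeriv u f * wordDeriv v g) y‖ =
        ‖wordDeriv u f y‖ * ‖wordDeriv v g y‖ := norm_mul _ _
    rw [h2]
    calc _ ≤ (A * (t ^ u.length * u.length.factorial)) *
          (B * (t ^ v.length * v.length.factorial)) :=
          mul_le_mul (hfA u) (hgB v) (norm_nonneg _) (by positivity)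
      _ = A * B * (t ^ (u.length + v.length) * (u.length.factorial * v.length.factorial)) := by
          rw [pow_add]
          ring
      _ ≤ A * B * (t ^ (u.length + v.length) * (u.length + v.length).factorial) := by gcongr
      _ = _ := by simp
  | append_singleton w i ih =>
    intro u v
    have hu := wordDeriv_smooth u hf
    have hv := wordDeriv_smooth v hg
    have hu' := wordDeriv_smooth (i :: u) hf
    have hv' := wordDeriv_smooth (i :: v) hg
    have e : wordDeriv (w ++ [i]) (wordDeriv u f * wordDeriv v g) =
        wordDeriv w (wordDeriv (i :: u) f * wordDeriv v g) +
          wordDeriv w (wordDeriv u f * wordDeriv (i :: v) g) := by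
      have hm₁ : ContDiff ℝ ∞ (wordDeriv (i :: u) f * wordDeriv v g) := hu'.mul hv
      have hm₂ : ContDiff ℝ ∞ (wordDeriv u f * wordDeriv (i :: v) g) := hu.mul hv'
      rw [wordDeriv_append, ← wordDeriv_add w hm₁ hm₂]
      congr 1
      exact partialDeriv_mul i hu hv
    rw [e, Pi.add_apply]
    refine (norm_add_le _ _).trans ((add_le_add (ih (i :: u) v) (ih u (i :: v))).trans ?_)
    have l1 : (i :: u).length + v.length + w.length = u.length + v.length + (w ++ [i]).length := by
      simp; ring
    have l2 : u.length + (i :: v).length + w.length = u.length + v.length + (w ++ [i]).length := by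
      simp; ring
    rw [l1, l2, List.length_append, List.length_singleton, pow_succ]
    apply le_of_eq
    ring

/-! ### Exponentials -/

theorem integrable_exp_neg_norm {k : ℝ} (hk : 0 < k) :
    Integrable (fun x : Rd d => Real.exp (-(k * ‖x‖))) volume := by
  set r : ℝ := d + 1 with hr
  have hr0 : 0 < r := by positivity
  -- `c ≤ 1` gives `c (1 + ‖x‖) ≤ exp(c ‖x‖)`, and `c r ≤ k` lets the power `-r` of this inequality
  -- dominate `exp(-k ‖x‖)`.
  set c : ℝ := min 1 (k / r) with hc
  have hc0 : 0 < c := lt_min one_pos (by positivity)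
  have hGint : Integrable (fun x : Rd d => c ^ (-r) * (1 + ‖x‖) ^ (-r)) volume :=
    (integrable_one_add_norm (by simp [hr])).const_mul _
  refine hGint.mono' (by fun_prop) (Eventually.of_forall fun x => ?_)
  rw [Real.norm_of_nonneg (Real.exp_pos _).le, ← Real.mul_rpow hc0.le (by positivity)]
  have h1 : c * (1 + ‖x‖) ≤ Real.exp (c * ‖x‖) := by
    have h2 := Real.add_one_le_exp (c * ‖x‖)
    have h3 : c ≤ 1 := min_le_left _ _
    linarith
  have h2 : Real.exp (c * ‖x‖) ^ (-r) ≤ (c * (1 + ‖x‖)) ^ (-r) :=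
    Real.rpow_le_rpow_of_nonpos (by positivity) h1 (by linarith)
  refine le_trans ?_ h2
  rw [← Real.exp_mul]
  gcongr
  have h3 : c ≤ k / r := min_le_right _ _
  rw [le_div_iff₀ hr0] at h3
  nlinarith [norm_nonneg x]

theorem integrable_exp_neg_norm_add {k : ℝ} (hk : 0 < k) :
    Integrable (fun z : Rd d × Rd d => Real.exp (-(k * (‖z.1‖ + ‖z.2‖)))) volume := by
  have h := (integrable_exp_neg_norm (d := d) hk).mul_prod (integrable_exp_neg_norm (d := d) hk)
  refine h.congr (Eventually.of_forall fun z => ?_)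
  simp only
  rw [← Real.exp_add]
  congr 1
  ring

/-! ### Decay of the short-time Fourier transform on `Σ₁(ℝᵈ)` -/

/-- `|y| + |y - x|` is at least `|x|` and at least `|y|`, hence at least their mean. The decay of
the two factors thus becomes decay in `x` together with an integrable majorant in `y`. -/
theorem norm_wordDeriv_mul_translate_le {t : ℝ} (ht : 0 < t) (φ g : SigmaOne d) (x y : Rd d)
    (w : List (Fin d)) :
    ‖wordDeriv w (g.1 * fun y => conj (φ (y - x))) y‖ ≤
      (2 ^ d * gsSeminorm d ⟨t / 2, by positivity⟩ g) *
        (2 ^ d * gsSeminorm d ⟨t / 2, by positivity⟩ φ) *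
        Real.exp (-(‖x‖ / (2 * t))) * Real.exp (-(‖y‖ / (2 * t))) *
        ((2 * t) ^ w.length * w.length.factorial) := by
  set A := 2 ^ d * gsSeminorm d ⟨t / 2, by positivity⟩ g with hA
  set B := 2 ^ d * gsSeminorm d ⟨t / 2, by positivity⟩ φ with hB
  have hA0 : 0 ≤ A := mul_nonneg (by positivity) (apply_nonneg _ _)
  have hB0 : 0 ≤ B := mul_nonneg (by positivity) (apply_nonneg _ _)
  set ψ : Rd d → ℂ := fun y => conj (φ (y - x)) with hψ
  have hψs : ContDiff ℝ ∞ ψ := (conj_mem (translate_mem φ.2 x)).1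
  have hψB : ∀ u : List (Fin d), ‖wordDeriv u ψ y‖ ≤
      (B * Real.exp (-((∑ i, |(y - x) i|) / t))) * (t ^ u.length * u.length.factorial) := by
    intro u
    have e : ‖wordDeriv u ψ y‖ = ‖wordDeriv u φ.1 (y - x)‖ := by
      rw [hψ, wordDeriv_conj u (fun y => φ (y - x)), wordDeriv_translate]
      simp
    rw [e]
    exact norm_wordDeriv_le ht φ u (y - x)
  have h1 := norm_wordDeriv_mul_le g.2.1 hψs (mul_nonneg hA0 (Real.exp_pos _).le)
    (mul_nonneg hB0 (Real.exp_pos _).le) ht (norm_wordDeriv_le ht g · y) hψB w [] []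
  simp only [List.length_nil, zero_add] at h1
  refine le_trans h1 ?_
  have h2 : Real.exp (-((∑ i, |y i|) / t)) * Real.exp (-((∑ i, |(y - x) i|) / t)) ≤
      Real.exp (-(‖x‖ / (2 * t))) * Real.exp (-(‖y‖ / (2 * t))) := by
    rw [← Real.exp_add, ← Real.exp_add, Real.exp_le_exp]
    have h3 := norm_le_sum_abs y
    have h4 := norm_le_sum_abs (y - x)
    have h5 : ‖x‖ ≤ ‖y‖ + ‖y - x‖ := by
      have := norm_sub_le y (y - x)
      simpa using this
    have e1 : -((∑ i, |y i|) / t) + -((∑ i, |(y - x) i|) / t) =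
      -((∑ i, |y i|) + ∑ i, |(y - x) i|) / t := by ring
    have e2 : -(‖x‖ / (2 * t)) + -(‖y‖ / (2 * t)) = -((‖x‖ + ‖y‖) / 2) / t := by
      field_simp
      ring
    rw [e1, e2]
    gcongr
    have := norm_nonneg (y - x)
    linarith
  calc _ = A * B * (Real.exp (-((∑ i, |y i|) / t)) * Real.exp (-((∑ i, |(y - x) i|) / t))) *
        ((2 * t) ^ w.length * w.length.factorial) := by
        rw [mul_pow]
        ring
    _ ≤ A * B * (Real.exp (-(‖x‖ / (2 * t))) * Real.exp (-(‖y‖ / (2 * t)))) *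
        ((2 * t) ^ w.length * w.length.factorial) := by gcongr
    _ = _ := by ring

theorem partialDeriv_character (ξ : Rd d) (i : Fin d) (y : Rd d) :
    partialDeriv i (character ξ) y = character ξ y * (-Complex.I * (ξ i : ℂ)) := by
  have h := congrFun (partialDeriv_character_mul ξ i (f := fun _ => (1 : ℂ)) contDiff_const) y
  simp only [mul_one] at h
  rw [show (fun y => character ξ y) = character ξ from rfl] at h
  rw [h]
  simp [shiftDeriv, partialDeriv]

theorem integral_character_mul_partialDeriv (ξ : Rd d) (i : Fin d) {Q : Rd d → ℂ}
    (hQ : ContDiff ℝ ∞ Q) (hQi : Integrable Q volume)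
    (hQ'i : Integrable (partialDeriv i Q) volume) :
    ∫ y, character ξ y * partialDeriv i Q y =
      (Complex.I * (ξ i : ℂ)) * ∫ y, character ξ y * Q y := by
  have hc : Continuous (character ξ) := (character_smooth ξ).continuous
  have hm : ∀ {q : Rd d → ℂ}, Integrable q volume →
      Integrable (fun y => character ξ y * q y) volume := by
    intro q hq
    refine hq.bdd_mul (c := 1) hc.aestronglyMeasurable (Eventually.of_forall fun y => ?_)
    rw [norm_character]
  have e : (fun y => fderiv ℝ (character ξ) y (EuclideanSpace.single i 1) * Q y) =
      fun y => (-Complex.I * (ξ i : ℂ)) * (character ξ y * Q y) := by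
    funext y
    have h := partialDeriv_character ξ i y
    unfold partialDeriv at h
    rw [h]
    ring
  have h := integral_mul_fderiv_eq_neg_fderiv_mul_of_integrable (μ := (volume : Measure (Rd d)))
    (f := character ξ) (g := Q) (v := EuclideanSpace.single i 1)
    (by rw [e]; exact (hm hQi).const_mul _) (hm hQ'i) (hm hQi)
    (fun x _ => (character_smooth ξ).differentiable (by simp) x)
    (fun x _ => hQ.differentiable (by simp) x)
  unfold partialDeriv
  rw [h, e, integral_const_mul]
  ring

/-- The alternative `ξ = 0` is what remains for `d = 0`, where there is no coordinate to choose. -/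
theorem exists_norm_le_mul_abs (ξ : Rd d) : ξ = 0 ∨ ∃ i, ‖ξ‖ ≤ (d + 1) * |ξ i| := by
  by_contra! hcon
  obtain ⟨h0, h1⟩ := hcon
  have h2 : (d + 1) * ∑ i, |ξ i| ≤ d * ‖ξ‖ := by
    rw [Finset.mul_sum]
    calc _ ≤ ∑ _i : Fin d, ‖ξ‖ := Finset.sum_le_sum fun i _ => (h1 i).le
      _ = _ := by simp
  have h3 := norm_le_sum_abs ξ
  have h4 : 0 < ‖ξ‖ := norm_pos_iff.mpr h0
  have h5 : (0 : ℝ) ≤ d := d.cast_nonneg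
  nlinarith

/-- The integral of a fixed function against the time-frequency shifts of `φ` decays faster than
any exponential. -/
theorem exists_pairing_decay (φ : SigmaOne d) {k : ℝ} (hk : 0 < k) :
    ∃ (h : {h : ℝ // 0 < h}) (C : ℝ), 0 ≤ C ∧ ∀ (g : SigmaOne d) (x ξ : Rd d),
      ‖toDual d g (conjShift φ x ξ)‖ ≤
        C * gsSeminorm d h g * Real.exp (-(k * (‖x‖ + ‖ξ‖))) := by
  -- Then `|ξᵢ| / (4t) = (d + 1) k |ξᵢ|`, which is at least `k ‖ξ‖` for a suitable `i`, and `‖x‖ /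
  -- (2t) ≥ k ‖x‖`.
  set t : ℝ := 1 / (4 * (d + 1) * k) with htdef
  have ht : 0 < t := by positivity
  set B := 2 ^ d * gsSeminorm d ⟨t / 2, by positivity⟩ φ with hB
  have hB0 : 0 ≤ B := mul_nonneg (by positivity) (apply_nonneg _ _)
  set E := ∫ y : Rd d, Real.exp (-(‖y‖ / (2 * t))) with hE
  have hE0 : 0 ≤ E := integral_nonneg fun y => (Real.exp_pos _).le
  have hEint : Integrable (fun y : Rd d => Real.exp (-(‖y‖ / (2 * t)))) volume := by
    have := integrable_exp_neg_norm (d := d) (k := 1 / (2 * t)) (by positivity)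
    refine this.congr (Eventually.of_forall fun y => ?_)
    simp only
    congr 2
    ring
  refine ⟨⟨t / 2, by positivity⟩, 2 * (2 ^ d * B * E), by positivity, fun g x ξ => ?_⟩
  set A := gsSeminorm d ⟨t / 2, by positivity⟩ g with hA
  have hA0 : 0 ≤ A := apply_nonneg _ _
  set P : Rd d → ℂ := g.1 * fun y => conj (φ (y - x)) with hP
  have hPs : ContDiff ℝ ∞ P := g.2.1.mul (conj_mem (translate_mem φ.2 x)).1
  set M := 2 ^ d * A * B * Real.exp (-(‖x‖ / (2 * t))) with hM
  have hM0 : 0 ≤ M := by positivity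
  have hPb : ∀ w y, ‖wordDeriv w P y‖ ≤ M * ((2 * t) ^ w.length * w.length.factorial) *
      Real.exp (-(‖y‖ / (2 * t))) := by
    intro w y
    refine (norm_wordDeriv_mul_translate_le ht φ g x y w).trans (le_of_eq ?_)
    rw [hM, hA, hB]
    ring
  have hPi : ∀ w, Integrable (wordDeriv w P) volume := fun w =>
    (hEint.const_mul (M * ((2 * t) ^ w.length * w.length.factorial))).mono'
      (wordDeriv_smooth w hPs).continuous.aestronglyMeasurable (Eventually.of_forall (hPb w))
  set J : List (Fin d) → ℂ := fun w => ∫ y, character ξ y * wordDeriv w P y with hJ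
  have hJb : ∀ w, ‖J w‖ ≤ M * ((2 * t) ^ w.length * w.length.factorial) * E := by
    intro w
    rw [hE, ← integral_const_mul]
    refine norm_integral_le_of_norm_le (hEint.const_mul _) (Eventually.of_forall fun y => ?_)
    rw [norm_mul, norm_character, one_mul]
    exact hPb w y
  have hJc : ∀ i w, J (i :: w) = (Complex.I * (ξ i : ℂ)) * J w := fun i w =>
    integral_character_mul_partialDeriv ξ i (wordDeriv_smooth w hPs) (hPi w) (hPi (i :: w))
  have hJr : ∀ i n, ‖J (List.replicate n i)‖ = |ξ i| ^ n * ‖J []‖ := by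
    intro i n
    induction n with
    | zero => simp
    | succ n ih =>
      rw [List.replicate_succ, hJc, norm_mul, ih]
      simp [pow_succ]
      ring
  have hval : toDual d g (conjShift φ x ξ) = J [] := by
    change ∫ y, g y * (character ξ y * conj (φ (y - x))) = _
    refine integral_congr_ae (Eventually.of_forall fun y => ?_)
    exact mul_left_comm _ _ _
  -- Integration by parts `n` times in direction `i` bounds `|ξᵢ|^n ‖J []‖` by a multiple of `(2t)^n
  -- n!`. The `n` from `exists_exp_le` turns this into an exponential bound.
  have hkey : ∀ i, Real.exp (|ξ i| / (4 * t)) * ‖J []‖ ≤ 2 * (M * E) := by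
    intro i
    obtain ⟨n, hn⟩ := exists_exp_le (|ξ i| / (4 * t))
    have h1 := hJb (List.replicate n i)
    rw [hJr, List.length_replicate] at h1
    have e : (2 * (|ξ i| / (4 * t))) ^ n = |ξ i| ^ n / (2 * t) ^ n := by
      rw [← div_pow]
      congr 1
      field_simp
      ring
    calc _ ≤ 2 * ((2 * (|ξ i| / (4 * t))) ^ n / n.factorial) * ‖J []‖ := by gcongr
      _ = 2 * ((|ξ i| ^ n * ‖J []‖) / ((2 * t) ^ n * n.factorial)) := by
        rw [e]
        field_simp
      _ ≤ 2 * (M * E) := by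
        gcongr
        rw [div_le_iff₀ (by positivity)]
        calc _ ≤ _ := h1
          _ = _ := by ring
  have hξ : Real.exp (k * ‖ξ‖) * ‖J []‖ ≤ 2 * (M * E) := by
    rcases exists_norm_le_mul_abs ξ with h0 | ⟨i, hi⟩
    · have h1 := hJb []
      simp only [List.length_nil, pow_zero, Nat.factorial_zero, Nat.cast_one, mul_one] at h1
      rw [h0, norm_zero, mul_zero, Real.exp_zero, one_mul]
      nlinarith [mul_nonneg hM0 hE0]
    · refine le_trans ?_ (hkey i)
      gcongr
      rw [htdef]
      field_simp
      linarith
  have hx : Real.exp (-(‖x‖ / (2 * t))) ≤ Real.exp (-(k * ‖x‖)) := by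
    gcongr
    rw [htdef]
    field_simp
    have h5 : (0 : ℝ) ≤ d := d.cast_nonneg
    have h6 := norm_nonneg x
    nlinarith [mul_nonneg h5 h6]
  rw [hval]
  have h7 : ‖J []‖ ≤ Real.exp (-(k * ‖ξ‖)) * (2 * (M * E)) := by
    rw [Real.exp_neg, ← div_eq_inv_mul, le_div_iff₀ (Real.exp_pos _), mul_comm]
    exact hξ
  calc _ ≤ _ := h7
    _ ≤ Real.exp (-(k * ‖ξ‖)) * (2 * ((2 ^ d * A * B * Real.exp (-(k * ‖x‖))) * E)) := by
      rw [hM]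
      gcongr
    _ = 2 * (2 ^ d * B * E) * A * (Real.exp (-(k * ‖x‖)) * Real.exp (-(k * ‖ξ‖))) := by ring
    _ = _ := by
      rw [← Real.exp_add]
      congr 2
      ring

end Analysis

/-! ### Fourier inversion and reconstruction of a functional from its transform. -/

section Inversion

open scoped ContDiff ComplexConjugate ENNReal FourierTransform

variable {d : ℕ}

/-! ### The inversion formula -/

/-- Complex conjugation on `Σ₁(ℝᵈ)`. -/
noncomputable def conjSigma (g : SigmaOne d) : SigmaOne d := ⟨fun x => conj (g x), conj_mem g.2⟩

theorem conjSigma_apply (g : SigmaOne d) (x : Rd d) : conjSigma g x = conj (g x) := rfl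

theorem conjShift_apply (φ : SigmaOne d) (x ξ y : Rd d) :
    conjShift φ x ξ y = character ξ y * conj (φ (y - x)) := rfl

theorem conjSigma_conjSigma (g : SigmaOne d) : conjSigma (conjSigma g) = g :=
  SigmaOne.ext fun x => by simp [conjSigma_apply]

theorem gsSeminorm_conjSigma (h : {h : ℝ // 0 < h}) (g : SigmaOne d) :
    gsSeminorm d h (conjSigma g) = gsSeminorm d h g := by
  have : gsQuot h.1 (conjSigma g).1 = gsQuot h.1 g.1 := by
    funext p
    change gsQuot h.1 (fun x => conj (g x)) p = _
    simp [gsQuot, multiDeriv, wordDeriv_conj]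
  change (⨆ p, gsQuot h.1 (conjSigma g).1 p) = ⨆ p, gsQuot h.1 g.1 p
  rw [this]

theorem conj_character (ξ y : Rd d) : conj (character ξ y) = character (-ξ) y := by
  unfold character
  rw [← Complex.exp_conj]
  simp

theorem conjSigma_conjShift (φ : SigmaOne d) (x ξ : Rd d) :
    conjSigma (conjShift φ x ξ) = conjShift (conjSigma φ) x (-ξ) :=
  SigmaOne.ext fun y => by
    rw [conjSigma_apply, conjShift_apply, conjShift_apply, map_mul, conj_character]
    rfl

theorem toDual_apply (f g : SigmaOne d) : toDual d f g = ∫ x, f x * g x := rfl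

theorem toDual_comm (f g : SigmaOne d) : toDual d f g = toDual d g f := by
  simp only [toDual_apply, mul_comm]

theorem conj_toDual (f g : SigmaOne d) :
    conj (toDual d f g) = toDual d (conjSigma f) (conjSigma g) := by
  rw [toDual_apply, toDual_apply, ← integral_conj]
  simp only [map_mul, conjSigma_apply]

/-- The coefficient `∫ g · conj Φ(z)` of `g` in the inversion formula, `Φ(z)` being the conjugated
time-frequency shift of `φ`. -/
noncomputable def analysisCoeff (φ g : SigmaOne d) (z : Rd d × Rd d) : ℂ :=
  toDual d g (conjSigma (conjShift φ z.1 z.2))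

theorem analysisCoeff_eq_conj (φ g : SigmaOne d) (z : Rd d × Rd d) :
    analysisCoeff φ g z = conj (toDual d (conjSigma g) (conjShift φ z.1 z.2)) := by
  rw [conj_toDual, conjSigma_conjSigma, analysisCoeff]

theorem continuous_analysisCoeff (φ g : SigmaOne d) : Continuous (analysisCoeff φ g) := by
  have h1 := (toDual d (conjSigma g)).continuous.comp (continuous_conjShift φ)
  have h2 := Complex.continuous_conj.comp h1
  refine h2.congr fun z => ?_
  rw [analysisCoeff_eq_conj]
  rfl

theorem exists_analysisCoeff_decay (φ : SigmaOne d) {k : ℝ} (hk : 0 < k) :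
    ∃ (h : {h : ℝ // 0 < h}) (C : ℝ), 0 ≤ C ∧ ∀ (g : SigmaOne d) (z : Rd d × Rd d),
      ‖analysisCoeff φ g z‖ ≤
        C * gsSeminorm d h g * Real.exp (-(k * (‖z.1‖ + ‖z.2‖))) := by
  obtain ⟨h, C, hC, H⟩ := exists_pairing_decay φ hk
  refine ⟨h, C, hC, fun g z => ?_⟩
  have h1 := H (conjSigma g) z.1 z.2
  rw [gsSeminorm_conjSigma] at h1
  rwa [analysisCoeff_eq_conj, RCLike.norm_conj]

theorem integrable_mul_gsSeminorm_conjShift (φ : SigmaOne d) {G : Rd d × Rd d → ℂ}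
    (hG : AEStronglyMeasurable G volume)
    (hGb : ∀ k : ℝ, 0 < k → ∃ C : ℝ, ∀ z, ‖G z‖ ≤ C * Real.exp (-(k * (‖z.1‖ + ‖z.2‖))))
    (h : {h : ℝ // 0 < h}) :
    Integrable (fun z => ‖G z‖ * gsSeminorm d h (conjShift φ z.1 z.2)) volume := by
  obtain ⟨B, k, hB, hk, hBk⟩ := gsSeminorm_conjShift_le h.2 φ
  obtain ⟨C, hC⟩ := hGb (k + 1) (by positivity)
  have hs : Continuous (gsSeminorm d h) := (sigmaOne_withSeminorms d).continuous_seminorm h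
  refine ((integrable_exp_neg_norm_add (d := d) one_pos).const_mul (C * B)).mono'
    (hG.norm.mul (hs.comp (continuous_conjShift φ)).aestronglyMeasurable)
    (Eventually.of_forall fun z => ?_)
  have h1 : 0 ≤ gsSeminorm d h (conjShift φ z.1 z.2) := apply_nonneg _ _
  rw [Real.norm_of_nonneg (by positivity)]
  calc _ ≤ (C * Real.exp (-((k + 1) * (‖z.1‖ + ‖z.2‖)))) *
        (B * Real.exp (k * (‖z.1‖ + ‖z.2‖))) :=
        mul_le_mul (hC z) (hBk z.1 z.2) h1 ((norm_nonneg _).trans (hC z))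
    _ = C * B * (Real.exp (-((k + 1) * (‖z.1‖ + ‖z.2‖))) *
        Real.exp (k * (‖z.1‖ + ‖z.2‖))) := by ring
    _ = _ := by
      rw [← Real.exp_add]
      congr 2
      ring

/-- Fourier inversion with the frequency rescaled by `2π`, which produces the Jacobian `(2π)^d`. The
assumed decay makes the transform integrable. -/
theorem fourier_inversion_character {p : Rd d → ℂ} (hp : Continuous p)
    (hpi : Integrable p volume) {C : ℝ}
    (hdec : ∀ ξ : Rd d, ‖∫ t, character (-ξ) t * p t‖ ≤ C * Real.exp (-(1 * ‖ξ‖))) (y : Rd d) :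
    ∫ ξ, (∫ t, character (-ξ) t * p t) * character ξ y = ((2 * Real.pi) ^ d : ℝ) * p y := by
  set H : Rd d → ℂ := fun ξ => ∫ t, character (-ξ) t * p t with hH
  have hchar : ∀ (s : ℝ) (η t : Rd d), character (s • η) t =
      Complex.exp (((-(s * inner ℝ t η) : ℝ) : ℂ) * Complex.I) := by
    intro s η t
    unfold character
    rw [inner_smul_right]
    congr 1
    push_cast
    ring
  have hinv : ∀ η, 𝓕⁻ p η = H ((2 * Real.pi) • η) := by
    intro η
    rw [Real.fourierInv_eq']
    refine integral_congr_ae (Eventually.of_forall fun t => ?_)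
    simp only [smul_eq_mul]
    rw [← neg_smul, hchar]
    congr 3
    push_cast
    ring
  have hcont : Continuous (𝓕⁻ p) := by
    have e : 𝓕⁻ p = fun η => 𝓕 p (-η) := funext fun η => Real.fourierInv_eq_fourier_neg p η
    rw [e]
    exact (VectorFourier.fourierIntegral_continuous Real.continuous_fourierChar
      continuous_inner hpi).comp continuous_neg
  have hinvI : Integrable (𝓕⁻ p) volume := by
    have h1 := (integrable_exp_neg_norm (d := d) (k := 2 * Real.pi) (by positivity)).const_mul C
    refine h1.mono' hcont.aestronglyMeasurable (Eventually.of_forall fun η => ?_)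
    rw [hinv]
    refine (hdec _).trans (le_of_eq ?_)
    rw [norm_smul, one_mul, Real.norm_of_nonneg (by positivity)]
  have hfourI : Integrable (𝓕 p) volume := by
    refine hinvI.comp_neg.congr (Eventually.of_forall fun η => ?_)
    simp only
    rw [Real.fourierInv_eq_fourier_neg, neg_neg]
  have h1 := congrFun (hp.fourier_fourierInv_eq hpi hfourI) y
  rw [Real.fourier_eq'] at h1
  have h2 := Measure.integral_comp_smul (volume : Measure (Rd d)) (fun ξ => H ξ * character ξ y)
    (2 * Real.pi)
  rw [finrank_euclideanSpace_fin, abs_of_pos (by positivity)] at h2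
  have h3 : ∫ η, H ((2 * Real.pi) • η) * character ((2 * Real.pi) • η) y = p y := by
    rw [← h1]
    refine integral_congr_ae (Eventually.of_forall fun η => ?_)
    simp only [smul_eq_mul]
    rw [hinv, mul_comm, hchar, real_inner_comm]
    congr 3
    push_cast
    ring
  rw [h3] at h2
  rw [h2, Complex.real_smul, ← mul_assoc, ← Complex.ofReal_mul, mul_inv_cancel₀ (by positivity),
    Complex.ofReal_one, one_mul]

/-- The square of the `L²` norm. -/
noncomputable def l2Sq (φ : SigmaOne d) : ℝ := ∫ x, ‖φ x‖ ^ 2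

theorem integrable_norm_sq (φ : SigmaOne d) : Integrable (fun x => ‖φ x‖ ^ 2) volume := by
  have h := (sigmaOne_integrable_mul φ (conjSigma φ)).norm
  refine h.congr (Eventually.of_forall fun x => ?_)
  simp only [conjSigma_apply, norm_mul, RCLike.norm_conj]
  ring

theorem l2Sq_pos {φ : SigmaOne d} (hφ : φ ≠ 0) : 0 < l2Sq φ := by
  obtain ⟨x₀, hx₀⟩ : ∃ x, φ x ≠ 0 := by
    by_contra! hcon
    exact hφ (SigmaOne.ext hcon)
  have hc : Continuous fun x => ‖φ x‖ ^ 2 := by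
    have := φ.2.1.continuous
    fun_prop
  exact integral_pos_of_integrable_nonneg_nonzero hc (integrable_norm_sq φ)
    (fun x => by positivity) (by positivity : ‖φ x₀‖ ^ 2 ≠ 0)

/-- For fixed `x`, the integral in `ξ` is Fourier inversion for `t ↦ g(t) φ(t - x)` and gives
`(2π)^d g(y) |φ(y - x)|²`. Integrating in `x` leaves the squared `L²` norm of `φ`. -/
theorem integral_analysisCoeff_mul (φ g : SigmaOne d) (y : Rd d) :
    ∫ z, analysisCoeff φ g z * conjShift φ z.1 z.2 y =
      (((2 * Real.pi) ^ d * l2Sq φ : ℝ) : ℂ) * g y := by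
  obtain ⟨h, C, hC, hdec⟩ := exists_analysisCoeff_decay φ one_pos
  set S := gsSeminorm d ⟨1, one_pos⟩ φ with hS
  have hGint : Integrable (fun z : Rd d × Rd d =>
      analysisCoeff φ g z * conjShift φ z.1 z.2 y) volume := by
    refine ((integrable_exp_neg_norm_add (d := d) one_pos).const_mul
      (C * gsSeminorm d h g * S)).mono' ?_ (Eventually.of_forall fun z => ?_)
    · exact ((continuous_analysisCoeff φ g).mul
        ((wordEval [] y).continuous.comp (continuous_conjShift φ))).aestronglyMeasurable
    · rw [norm_mul, conjShift_apply, norm_mul, norm_character, one_mul, RCLike.norm_conj]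
      calc _ ≤ (C * gsSeminorm d h g * Real.exp (-(1 * (‖z.1‖ + ‖z.2‖)))) * S :=
            mul_le_mul (hdec g z) (sigmaOne_norm_le φ _) (norm_nonneg _)
              ((norm_nonneg _).trans (hdec g z))
        _ = _ := by ring
  have hcoef : ∀ x ξ : Rd d, analysisCoeff φ g (x, ξ) =
      ∫ t, character (-ξ) t * (g t * φ (t - x)) := by
    intro x ξ
    change ∫ t, g t * conjSigma (conjShift φ x ξ) t = _
    refine integral_congr_ae (Eventually.of_forall fun t => ?_)
    simp only [conjSigma_apply, conjShift_apply, map_mul, conj_character, Complex.conj_conj]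
    ring
  have hinner : ∀ x : Rd d, ∫ ξ, analysisCoeff φ g (x, ξ) * conjShift φ x ξ y =
      (((2 * Real.pi) ^ d : ℝ) : ℂ) * g y * ((‖φ (y - x)‖ ^ 2 : ℝ) : ℂ) := by
    intro x
    set p : Rd d → ℂ := fun t => g t * φ (t - x) with hp
    have hpc : Continuous p := by
      have h1 := g.2.1.continuous
      have h2 := φ.2.1.continuous
      exact h1.mul (h2.comp (continuous_id.sub continuous_const))
    have hpi : Integrable p volume := by
      refine (sigmaOne_integrable g).mul_bdd (c := S)
        ((φ.2.1.continuous.comp (continuous_id.sub continuous_const)).aestronglyMeasurable)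
        (Eventually.of_forall fun t => ?_)
      exact sigmaOne_norm_le φ _
    have h1 := fourier_inversion_character hpc hpi (C := C * gsSeminorm d h g) (fun ξ => ?_) y
    · have e : ∀ ξ, analysisCoeff φ g (x, ξ) * conjShift φ x ξ y =
          ((∫ t, character (-ξ) t * p t) * character ξ y) * conj (φ (y - x)) := by
        intro ξ
        rw [hcoef, conjShift_apply]
        ring
      simp only [e]
      rw [integral_mul_const, h1, hp]
      have e2 : ((‖φ (y - x)‖ ^ 2 : ℝ) : ℂ) = φ (y - x) * conj (φ (y - x)) := by
        rw [Complex.mul_conj, Complex.normSq_eq_norm_sq]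
      rw [e2]
      ring
    · rw [← hcoef]
      refine (hdec g (x, ξ)).trans ?_
      gcongr
      have := norm_nonneg x
      simp only
      linarith
  rw [Measure.volume_eq_prod] at hGint ⊢
  rw [integral_prod _ hGint]
  simp only [hinner]
  have e3 : ∫ x, ((‖φ (y - x)‖ ^ 2 : ℝ) : ℂ) = (l2Sq φ : ℂ) := by
    rw [integral_complex_ofReal]
    exact congrArg _ (integral_sub_left_eq_self (fun x => ‖φ x‖ ^ 2) volume y)
  rw [integral_const_mul, e3]
  push_cast
  ring

/-- A functional on `Σ₁(ℝᵈ)` is determined by its values on the time-frequency shifts of `φ`. -/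
theorem dual_apply_eq_integral {φ : SigmaOne d} (hφ : φ ≠ 0) (f : SigmaOneDual d)
    (g : SigmaOne d) :
    f g = ((((2 * Real.pi) ^ d * l2Sq φ)⁻¹ : ℝ) : ℂ) *
      ∫ z, analysisCoeff φ g z * f (conjShift φ z.1 z.2) := by
  have hpos : 0 < (2 * Real.pi) ^ d * l2Sq φ := mul_pos (by positivity) (l2Sq_pos hφ)
  have hG := (continuous_analysisCoeff φ g).aestronglyMeasurable
    (μ := (volume : Measure (Rd d × Rd d)))
  obtain ⟨g', hg', hf⟩ := exists_superposition (continuous_conjShift φ) hG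
    (integrable_mul_gsSeminorm_conjShift φ hG fun k hk => by
      obtain ⟨h, C, -, hdec⟩ := exists_analysisCoeff_decay φ hk
      exact ⟨C * gsSeminorm d h g, hdec g⟩)
  have e : g' = (((2 * Real.pi) ^ d * l2Sq φ : ℝ) : ℂ) • g := by
    refine SigmaOne.ext fun y => ?_
    rw [hg', integral_analysisCoeff_mul]
    rfl
  rw [← hf f, e, map_smul, smul_eq_mul, ← mul_assoc, ← Complex.ofReal_mul,
    inv_mul_cancel₀ hpos.ne', Complex.ofReal_one, one_mul]

end Inversion

/-! ### Reproducing inequalities on phase space, and their version for `q`-th powers. -/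

section Reproducing

open scoped ComplexConjugate ENNReal

variable {d : ℕ}

/-! ### Exponential kernels on phase space -/

/-- The kernel `z ↦ exp(-k(|x| + |ξ|))`, `z = (x, ξ)`. -/
noncomputable def expKer (k : ℝ) (z : Rd d × Rd d) : ℝ≥0∞ :=
  ENNReal.ofReal (Real.exp (-(k * (‖z.1‖ + ‖z.2‖))))

theorem continuous_expKer (k : ℝ) : Continuous (expKer k : Rd d × Rd d → ℝ≥0∞) := by
  unfold expKer
  exact ENNReal.continuous_ofReal.comp (by fun_prop)

theorem measurable_expKer (k : ℝ) : Measurable (expKer k : Rd d × Rd d → ℝ≥0∞) :=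
  (continuous_expKer k).measurable

theorem expKer_ne_top (k : ℝ) (z : Rd d × Rd d) : expKer k z ≠ ∞ := ENNReal.ofReal_ne_top

theorem expKer_zero_right (k : ℝ) : expKer k (0 : Rd d × Rd d) = 1 := by simp [expKer]

theorem expKer_sub_comm (k : ℝ) (z w : Rd d × Rd d) : expKer k (z - w) = expKer k (w - z) := by
  simp only [expKer, Prod.fst_sub, Prod.snd_sub, norm_sub_rev]

theorem expKer_rpow (k : ℝ) {q : ℝ} (hq : 0 ≤ q) (z : Rd d × Rd d) :
    expKer k z ^ q = expKer (q * k) z := by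
  unfold expKer
  rw [ENNReal.ofReal_rpow_of_nonneg (Real.exp_pos _).le hq, ← Real.exp_mul]
  congr 2
  ring

theorem expKer_add (k l : ℝ) (z : Rd d × Rd d) : expKer (k + l) z = expKer k z * expKer l z := by
  unfold expKer
  rw [← ENNReal.ofReal_mul (Real.exp_pos _).le, ← Real.exp_add]
  congr 2
  ring

theorem expKer_mul_le {k : ℝ} (hk : 0 ≤ k) (u v w : Rd d × Rd d) :
    expKer k (u - v) * expKer k (v - w) ≤ expKer k (u - w) := by
  unfold expKer
  rw [← ENNReal.ofReal_mul (Real.exp_pos _).le, ← Real.exp_add]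
  gcongr
  have h1 : ‖u.1 - w.1‖ ≤ ‖u.1 - v.1‖ + ‖v.1 - w.1‖ := norm_sub_le_norm_sub_add_norm_sub _ _ _
  have h2 : ‖u.2 - w.2‖ ≤ ‖u.2 - v.2‖ + ‖v.2 - w.2‖ := norm_sub_le_norm_sub_add_norm_sub _ _ _
  simp only [Prod.fst_sub, Prod.snd_sub]
  nlinarith

theorem expKer_anti {k l : ℝ} (hkl : k ≤ l) (z : Rd d × Rd d) : expKer l z ≤ expKer k z := by
  unfold expKer
  gcongr

theorem lintegral_expKer_lt_top {k : ℝ} (hk : 0 < k) :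
    ∫⁻ z : Rd d × Rd d, expKer k z < ∞ := by
  have h := (integrable_exp_neg_norm_add (d := d) hk).lintegral_lt_top
  exact h

theorem measurable_mul_expKer_sub {b : Rd d × Rd d → ℝ≥0∞} (hb : Measurable b) (k : ℝ)
    (w : Rd d × Rd d) : Measurable fun z => b z * expKer k (w - z) :=
  hb.mul ((measurable_expKer k).comp (measurable_const.sub measurable_id))

theorem lintegral_expKer_sub (k : ℝ) (w : Rd d × Rd d) :
    ∫⁻ z, expKer k (w - z) = ∫⁻ z : Rd d × Rd d, expKer k z := by
  have : (volume : Measure (Rd d × Rd d)).IsAddRightInvariant := by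
    rw [Measure.volume_eq_prod]
    infer_instance
  simp only [expKer_sub_comm k w]
  exact lintegral_sub_right_eq_self (expKer k) w

/-! ### The reproducing inequality -/

/-- Covariance: up to a unimodular factor, the pairing of two shifts of `φ` depends only on the
difference of their parameters. Decay of the pairing thereby becomes off-diagonal decay of the
reproducing kernel. -/
theorem norm_analysisCoeff_conjShift (φ : SigmaOne d) (w z : Rd d × Rd d) :
    ‖analysisCoeff φ (conjShift φ w.1 w.2) z‖ =
      ‖toDual d φ (conjShift φ (w.1 - z.1) (w.2 - z.2))‖ := by
  have h1 : analysisCoeff φ (conjShift φ w.1 w.2) z =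
      ∫ y, (character (w.2 - z.2) y * conj (φ (y - w.1))) * φ (y - z.1) := by
    change ∫ y, conjShift φ w.1 w.2 y * conjSigma (conjShift φ z.1 z.2) y = _
    refine integral_congr_ae (Eventually.of_forall fun y => ?_)
    simp only [conjSigma_apply, conjShift_apply, map_mul, conj_character, Complex.conj_conj]
    have e : character (w.2 - z.2) y = character w.2 y * character (-z.2) y := by
      unfold character
      rw [← Complex.exp_add, sub_eq_add_neg, inner_add_right]
      congr 1
      push_cast
      ring
    rw [e]
    ring
  have h2 : analysisCoeff φ (conjShift φ w.1 w.2) z =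
      character (w.2 - z.2) z.1 * toDual d φ (conjShift φ (w.1 - z.1) (w.2 - z.2)) := by
    rw [h1, ← integral_add_right_eq_self _ z.1, toDual_apply, ← integral_const_mul]
    refine integral_congr_ae (Eventually.of_forall fun y => ?_)
    simp only [conjShift_apply]
    have e : character (w.2 - z.2) (y + z.1) =
        character (w.2 - z.2) y * character (w.2 - z.2) z.1 := by
      unfold character
      rw [← Complex.exp_add, inner_add_left]
      congr 1
      push_cast
      ring
    rw [e, add_sub_cancel_right, show y + z.1 - w.1 = y - (w.1 - z.1) by abel]
    ring
  rw [h2, norm_mul, norm_character, one_mul]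

theorem exists_enorm_analysisCoeff_le (φ : SigmaOne d) {k : ℝ} (hk : 0 < k) :
    ∃ C : ℝ≥0∞, C ≠ ∞ ∧ ∀ w z : Rd d × Rd d,
      ‖analysisCoeff φ (conjShift φ w.1 w.2) z‖ₑ ≤ C * expKer k (w - z) := by
  obtain ⟨h, C, hC, H⟩ := exists_pairing_decay φ hk
  have h0 : 0 ≤ gsSeminorm d h φ := apply_nonneg _ _
  refine ⟨ENNReal.ofReal (C * gsSeminorm d h φ), ENNReal.ofReal_ne_top, fun w z => ?_⟩
  rw [expKer, ← ENNReal.ofReal_mul (by positivity), ← ofReal_norm, norm_analysisCoeff_conjShift]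
  exact ENNReal.ofReal_le_ofReal (H φ _ _)

/-- The values of `f` on the conjugated time-frequency shifts of `φ`; up to a constant factor this
is the short-time Fourier transform. -/
noncomputable def stftCore (φ : SigmaOne d) (f : SigmaOneDual d) (z : Rd d × Rd d) : ℂ :=
  f (conjShift φ z.1 z.2)

theorem continuous_stftCore (φ : SigmaOne d) (f : SigmaOneDual d) : Continuous (stftCore φ f) :=
  f.continuous.comp (continuous_conjShift φ)

theorem measurable_enorm_stftCore (φ : SigmaOne d) (f : SigmaOneDual d) :
    Measurable fun z => ‖stftCore φ f z‖ₑ :=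
  (continuous_stftCore φ f).enorm.measurable

theorem exists_reproducing {φ : SigmaOne d} (hφ : φ ≠ 0) {k : ℝ} (hk : 0 < k) :
    ∃ C : ℝ≥0∞, C ≠ ∞ ∧ ∀ (f : SigmaOneDual d) (w : Rd d × Rd d),
      ‖stftCore φ f w‖ₑ ≤ C * ∫⁻ z, ‖stftCore φ f z‖ₑ * expKer k (w - z) := by
  obtain ⟨C, hC, H⟩ := exists_enorm_analysisCoeff_le φ hk
  set c : ℂ := ((((2 * Real.pi) ^ d * l2Sq φ)⁻¹ : ℝ) : ℂ) with hc
  refine ⟨‖c‖ₑ * C, ENNReal.mul_ne_top enorm_ne_top hC, fun f w => ?_⟩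
  have h1 : stftCore φ f w = _ := dual_apply_eq_integral hφ f (conjShift φ w.1 w.2)
  rw [h1, enorm_mul, mul_assoc]
  gcongr
  refine (enorm_integral_le_lintegral_enorm _).trans ?_
  rw [← lintegral_const_mul _ (measurable_mul_expKer_sub (measurable_enorm_stftCore φ f) k w)]
  refine lintegral_mono fun z => ?_
  rw [enorm_mul]
  calc _ ≤ C * expKer k (w - z) * ‖stftCore φ f z‖ₑ := by
        gcongr
        · exact H w z
        · exact le_rfl
    _ = _ := by ring

/-- Here `k` and `B` depend on `f`. The bound serves only to make maximal functions finite and does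
not enter the final constants. -/
theorem exists_growth (φ : SigmaOne d) (f : SigmaOneDual d) :
    ∃ (k : ℝ) (B : ℝ≥0∞), 0 < k ∧ B ≠ ∞ ∧ ∀ z, ‖stftCore φ f z‖ₑ * expKer k z ≤ B := by
  obtain ⟨h, C, hC, hf⟩ := exists_gsSeminorm_bound f
  obtain ⟨D, k, hD, hk, hDk⟩ := gsSeminorm_conjShift_le h.2 φ
  refine ⟨k + 1, ENNReal.ofReal (C * D), by positivity, ENNReal.ofReal_ne_top, fun z => ?_⟩
  rw [expKer, ← ofReal_norm, ← ENNReal.ofReal_mul (norm_nonneg _)]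
  refine ENNReal.ofReal_le_ofReal ?_
  calc ‖stftCore φ f z‖ * Real.exp (-((k + 1) * (‖z.1‖ + ‖z.2‖)))
      ≤ (C * (D * Real.exp (k * (‖z.1‖ + ‖z.2‖)))) *
        Real.exp (-((k + 1) * (‖z.1‖ + ‖z.2‖))) := by
        gcongr
        refine (hf _).trans ?_
        gcongr
        exact hDk z.1 z.2
    _ = C * D * Real.exp (-(‖z.1‖ + ‖z.2‖)) := by
        rw [← mul_assoc, mul_assoc (C * D), ← Real.exp_add]
        congr 2
        ring
    _ ≤ C * D * 1 := by
        gcongr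
        rw [Real.exp_le_one_iff, neg_nonpos]
        positivity
    _ = C * D := mul_one _

/-! ### Maximal functions -/

theorem le_of_le_mul_rpow {M A : ℝ≥0∞} {q : ℝ} (hq : 0 < q) (hM : M ≠ ∞)
    (h : M ≤ A * M ^ (1 - q)) : M ^ q ≤ A := by
  rcases eq_or_ne M 0 with h0 | h0
  · simp [h0, ENNReal.zero_rpow_of_pos hq]
  · have e : M = M ^ q * M ^ (1 - q) := by
      rw [← ENNReal.rpow_add _ _ h0 hM]
      simp
    have h1 : M ^ q * M ^ (1 - q) ≤ A * M ^ (1 - q) := by rwa [← e]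
    exact (ENNReal.mul_le_mul_iff_left (by simp [h0, hM]) (by simp [h0, hM])).mp h1

section Maximal

variable {a : Rd d × Rd d → ℝ≥0∞} {q : ℝ}

/-- Let `M` be the maximal function. Writing the integrand of the reproducing inequality as its
`q`-th power times its `(1 - q)`-th power, and bounding the latter by `M^(1 - q)`, gives `M ≤ A M^(1
- q)`. A finite `M` can then be divided out. -/
theorem iSup_rpow_le_of_reproducing (hq : 0 < q) (hq1 : q ≤ 1) {s : ℝ} (hs : 0 < s)
    {C : ℝ≥0∞} (ha : Measurable a)
    (hrep : ∀ w, a w ≤ C * ∫⁻ z, a z * expKer s (w - z)) (z : Rd d × Rd d)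
    (hfin : ⨆ w, a w * expKer s (z - w) ≠ ∞) :
    (⨆ w, a w * expKer s (z - w)) ^ q ≤ C * ∫⁻ w, a w ^ q * expKer (q * s) (z - w) := by
  set M := ⨆ w, a w * expKer s (z - w) with hM
  refine le_of_le_mul_rpow hq hfin (iSup_le fun z' => ?_)
  calc a z' * expKer s (z - z')
      ≤ (C * ∫⁻ w, a w * expKer s (z' - w)) * expKer s (z - z') := by
        gcongr
        exact hrep z'
    _ = C * ∫⁻ w, a w * expKer s (z' - w) * expKer s (z - z') := by
        rw [mul_assoc, lintegral_mul_const _ (measurable_mul_expKer_sub ha s z')]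
    _ ≤ C * ∫⁻ w, (a w ^ q * expKer (q * s) (z - w)) * M ^ (1 - q) := by
        refine mul_le_mul' le_rfl (lintegral_mono fun w => ?_)
        rw [mul_assoc, mul_comm (expKer s _)]
        calc _ ≤ a w * expKer s (z - w) := by
              gcongr
              exact expKer_mul_le hs.le _ _ _
          _ = (a w * expKer s (z - w)) ^ q * (a w * expKer s (z - w)) ^ (1 - q) := by
              rw [← ENNReal.rpow_add_of_nonneg _ _ hq.le (by linarith)]
              simp
          _ ≤ (a w * expKer s (z - w)) ^ q * M ^ (1 - q) := by
              gcongr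
              exact le_iSup (fun w => a w * expKer s (z - w)) w
          _ = _ := by rw [ENNReal.mul_rpow_of_nonneg _ _ hq.le, expKer_rpow _ hq.le]
    _ = _ := by
        rw [lintegral_mul_const _ (measurable_mul_expKer_sub (ha.pow_const q) _ _), ← mul_assoc]

/-- Growth of `a` makes its maximal function finite only for rates at least `k`. The resulting
inequality at rate `max k r` has the wrong constant, but it shows that the maximal function at rate
`r` is finite whenever the right-hand integral is. The argument can then be run at rate `r`, with a
constant independent of `k` and `B`. -/
theorem rpow_le_lintegral_of_le_one (hq : 0 < q) (hq1 : q ≤ 1) {C : ℝ → ℝ≥0∞}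
    (hC : ∀ s, 0 < s → C s ≠ ∞) (ha : Measurable a)
    (hrep : ∀ s, 0 < s → ∀ w, a w ≤ C s * ∫⁻ z, a z * expKer s (w - z))
    (hgrow : ∃ (k : ℝ) (B : ℝ≥0∞), 0 < k ∧ B ≠ ∞ ∧ ∀ z, a z * expKer k z ≤ B)
    {r : ℝ} (hr : 0 < r) (z : Rd d × Rd d) :
    a z ^ q ≤ C r * ∫⁻ w, a w ^ q * expKer (q * r) (z - w) := by
  obtain ⟨k, B, hk, hB, hgrow⟩ := hgrow
  set I := ∫⁻ w, a w ^ q * expKer (q * r) (z - w) with hI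
  have hle : ∀ s z, a z ≤ ⨆ w, a w * expKer s (z - w) := fun s z => by
    refine le_trans ?_ (le_iSup (fun w => a w * expKer s (z - w)) z)
    simp [expKer_zero_right]
  -- If `I = ∞` the bound is trivial unless `C r = 0`, since `0 * ∞ = 0`; in that case the
  -- reproducing inequality itself gives `a z = 0`.
  rcases eq_or_ne I ∞ with hItop | hItop
  · rcases eq_or_ne (C r) 0 with h0 | h0
    · have h1 := hrep r hr z
      rw [h0, zero_mul] at h1
      have h2 : a z = 0 := le_antisymm h1 bot_le
      simp [h2, ENNReal.zero_rpow_of_pos hq]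
    · rw [hItop, ENNReal.mul_top h0]
      exact le_top
  · set s := max k r with hs
    have hs0 : 0 < s := lt_max_of_lt_left hk
    have hfin : ∀ z', ⨆ w, a w * expKer s (z' - w) ≠ ∞ := by
      intro z'
      have h1 : ⨆ w, a w * expKer s (z' - w) ≤ B * (expKer k z')⁻¹ := by
        refine iSup_le fun w => ?_
        rw [← div_eq_mul_inv, ENNReal.le_div_iff_mul_le
          (Or.inl (by simp [expKer, Real.exp_pos])) (Or.inl (expKer_ne_top _ _))]
        calc a w * expKer s (z' - w) * expKer k z'
            ≤ a w * expKer k (w - z') * expKer k (z' - 0) := by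
              rw [sub_zero, expKer_sub_comm k w]
              gcongr
              exact expKer_anti (le_max_left _ _) _
          _ ≤ a w * expKer k (w - 0) := by
              rw [mul_assoc]
              gcongr
              exact expKer_mul_le hk.le _ _ _
          _ ≤ B := by
              rw [sub_zero]
              exact hgrow w
      refine ne_top_of_le_ne_top (ENNReal.mul_ne_top hB ?_) h1
      simp [expKer, Real.exp_pos]
    have h2 : ∀ z', a z' ^ q ≤ C s * ∫⁻ w, a w ^ q * expKer (q * s) (z' - w) := fun z' =>
      (ENNReal.rpow_le_rpow (hle s z') hq.le).trans
        (iSup_rpow_le_of_reproducing hq hq1 hs0 ha (hrep s hs0) z' (hfin z'))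
    have h3 : ∀ z', (a z' * expKer r (z - z')) ^ q ≤ C s * I := by
      intro z'
      rw [ENNReal.mul_rpow_of_nonneg _ _ hq.le, expKer_rpow _ hq.le]
      calc _ ≤ (C s * ∫⁻ w, a w ^ q * expKer (q * r) (z' - w)) * expKer (q * r) (z - z') := by
            gcongr
            refine (h2 z').trans ?_
            gcongr with w
            apply expKer_anti
            gcongr
            exact le_max_right _ _
        _ = C s * ∫⁻ w, a w ^ q * expKer (q * r) (z' - w) * expKer (q * r) (z - z') := by
            rw [mul_assoc, lintegral_mul_const _ (measurable_mul_expKer_sub (ha.pow_const q) _ z')]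
        _ ≤ C s * I := by
            rw [hI]
            refine mul_le_mul' le_rfl (lintegral_mono fun w => ?_)
            rw [mul_assoc, mul_comm (expKer _ (z' - w))]
            gcongr
            exact expKer_mul_le (by positivity) _ _ _
    have h4 : ⨆ w, a w * expKer r (z - w) ≠ ∞ := by
      have h5 : ⨆ w, a w * expKer r (z - w) ≤ (C s * I) ^ q⁻¹ :=
        iSup_le fun w => (ENNReal.le_rpow_inv_iff hq).mpr (h3 w)
      exact ne_top_of_le_ne_top
        (ENNReal.rpow_ne_top_of_nonneg (by positivity) (ENNReal.mul_ne_top (hC s hs0) hItop)) h5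
    exact (ENNReal.rpow_le_rpow (hle r z) hq.le).trans
      (iSup_rpow_le_of_reproducing hq hq1 hr ha (hrep r hr) z h4)

/-- Hölder, with the kernel split into its powers `1/q` and `1 - 1/q`. -/
theorem rpow_le_lintegral_of_one_lt (hq : 1 < q) {k : ℝ} {C : ℝ≥0∞} (ha : Measurable a)
    (hrep : ∀ w, a w ≤ C * ∫⁻ z, a z * expKer k (w - z)) (w : Rd d × Rd d) :
    a w ^ q ≤ (C * (∫⁻ z : Rd d × Rd d, expKer k z) ^ (1 - q⁻¹)) ^ q *
      ∫⁻ z, a z ^ q * expKer k (w - z) := by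
  have hq0 : 0 < q := by linarith
  have hm : ∀ (l : ℝ) (v : Rd d × Rd d), Measurable fun w => expKer l (v - w) := fun l v =>
    (measurable_expKer l).comp (measurable_const.sub measurable_id)
  have hpq : q.HolderConjugate (1 - q⁻¹)⁻¹ := by
    rw [Real.holderConjugate_iff]
    exact ⟨hq, by simp⟩
  have hp : 0 < 1 - q⁻¹ := by
    have := inv_lt_one_of_one_lt₀ hq
    linarith
  have h1 := ENNReal.lintegral_mul_le_Lp_mul_Lq (volume : Measure (Rd d × Rd d)) hpq
    (f := fun z => a z * expKer (q⁻¹ * k) (w - z)) (g := fun z => expKer ((1 - q⁻¹) * k) (w - z))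
    (ha.mul (hm _ w)).aemeasurable (hm _ w).aemeasurable
  have e1 : ∀ z, (a z * expKer (q⁻¹ * k) (w - z)) * expKer ((1 - q⁻¹) * k) (w - z) =
      a z * expKer k (w - z) := by
    intro z
    rw [mul_assoc, ← expKer_add]
    congr 2
    ring
  have e2 : ∀ z, (a z * expKer (q⁻¹ * k) (w - z)) ^ q = a z ^ q * expKer k (w - z) := by
    intro z
    rw [ENNReal.mul_rpow_of_nonneg _ _ hq0.le, expKer_rpow _ hq0.le]
    congr 2
    field_simp
  have e3 : ∀ z, expKer ((1 - q⁻¹) * k) (w - z) ^ (1 - q⁻¹)⁻¹ = expKer k (w - z) := by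
    intro z
    rw [expKer_rpow _ (by positivity), ← mul_assoc, inv_mul_cancel₀ hp.ne', one_mul]
  simp only [Pi.mul_apply, e1, e2, e3, one_div, inv_inv, lintegral_expKer_sub] at h1
  calc a w ^ q ≤ (C * ((∫⁻ z, a z ^ q * expKer k (w - z)) ^ q⁻¹ *
        (∫⁻ z : Rd d × Rd d, expKer k z) ^ (1 - q⁻¹))) ^ q := by
        gcongr
        refine (hrep w).trans ?_
        gcongr
    _ = ((C * (∫⁻ z : Rd d × Rd d, expKer k z) ^ (1 - q⁻¹)) *
        (∫⁻ z, a z ^ q * expKer k (w - z)) ^ q⁻¹) ^ q := by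
        congr 1
        ring
    _ = _ := by
        rw [ENNReal.mul_rpow_of_nonneg _ _ hq0.le, ← ENNReal.rpow_mul, inv_mul_cancel₀ hq0.ne',
          ENNReal.rpow_one]

end Maximal

/-- Local `L^q` control of the short-time Fourier transform, for all `0 < q < ∞`. -/
theorem exists_rpow_le_lintegral {φ : SigmaOne d} (hφ : φ ≠ 0) {q k : ℝ} (hq : 0 < q)
    (hk : 0 < k) :
    ∃ C : ℝ≥0∞, C ≠ ∞ ∧ ∀ (f : SigmaOneDual d) (w : Rd d × Rd d),
      ‖stftCore φ f w‖ₑ ^ q ≤ C * ∫⁻ z, ‖stftCore φ f z‖ₑ ^ q * expKer k (w - z) := by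
  choose! C hC hrep using fun (s : ℝ) (hs : 0 < s) => exists_reproducing hφ hs
  rcases le_or_gt q 1 with hq1 | hq1
  · refine ⟨C (k / q), hC _ (by positivity), fun f w => ?_⟩
    have h1 := rpow_le_lintegral_of_le_one hq hq1 hC (measurable_enorm_stftCore φ f)
      (fun s hs => hrep s hs f) (exists_growth φ f) (r := k / q) (by positivity) w
    rwa [mul_div_cancel₀ _ hq.ne'] at h1
  · refine ⟨_, ?_, fun f w => rpow_le_lintegral_of_one_lt hq1 (measurable_enorm_stftCore φ f)
      (hrep k hk f) w⟩
    refine ENNReal.rpow_ne_top_of_nonneg hq.le (ENNReal.mul_ne_top (hC k hk) ?_)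
    refine ENNReal.rpow_ne_top_of_nonneg ?_ (lintegral_expKer_lt_top hk).ne
    have := inv_lt_one_of_one_lt₀ hq1
    linarith

end Reproducing

/-! ### Moderate weights. -/

section Weights

open scoped ENNReal

/-! ### Moderate weights grow at most exponentially -/

section General

variable {E : Type*} [NormedAddCommGroup E] [NormedSpace ℝ E] [FiniteDimensional ℝ E]
  [MeasureSpace E]

theorem IsWeight.exists_ae_le [BorelSpace E] {v : E → ℝ} (hv : IsWeight v) :
    ∃ M : ℝ, 0 ≤ M ∧ ∀ᵐ y ∂(volume : Measure E), y ∈ Metric.closedBall (0 : E) 1 → v y ≤ M := by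
  have h := hv.locBdd _ (isCompact_closedBall (0 : E) 1)
  refine ⟨(eLpNorm v ∞ (volume.restrict (Metric.closedBall (0 : E) 1))).toReal,
    ENNReal.toReal_nonneg, ?_⟩
  rw [← ae_restrict_iff' measurableSet_closedBall]
  have h1 := ae_le_eLpNormEssSup (f := v) (μ := volume.restrict (Metric.closedBall (0 : E) 1))
  filter_upwards [h1] with y hy
  rw [← eLpNorm_exponent_top] at hy
  have h2 : ENNReal.ofReal (v y) ≤ eLpNorm v ∞ (volume.restrict (Metric.closedBall (0 : E) 1)) := by
    rwa [← Real.enorm_of_nonneg (hv.pos y).le]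
  exact (ENNReal.ofReal_le_iff_le_toReal h.eLpNorm_lt_top.ne).mp h2

/-- The bound for `v` holds only almost everywhere, so it may fail at `y` itself. For almost every
`a` in the ball of radius `1/2` about `y/2`, however, both `a` and `y - a` lie in the unit ball and
satisfy it. -/
theorem IsWeight.exists_add_eq [BorelSpace E] [(volume : Measure E).IsAddHaarMeasure]
    {v : E → ℝ} {M : ℝ}
    (hM : ∀ᵐ y ∂(volume : Measure E), y ∈ Metric.closedBall (0 : E) 1 → v y ≤ M) {y : E}
    (hy : ‖y‖ ≤ 1) : ∃ a b, a + b = y ∧ v a ≤ M ∧ v b ≤ M := by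
  have h2 :=
    (Measure.measurePreserving_sub_left (volume : Measure E) y).quasiMeasurePreserving.ae hM
  set B := Metric.ball ((1 / 2 : ℝ) • y) (1 / 2) with hB
  have hne : NeBot (ae ((volume : Measure E).restrict B)) := by
    rw [ae_neBot, Ne, Measure.restrict_eq_zero]
    exact (Metric.measure_ball_pos _ _ (by norm_num)).ne'
  obtain ⟨a, ⟨h3, h4⟩, ha⟩ := ((ae_restrict_of_ae (s := B) (hM.and h2)).and
    (ae_restrict_mem measurableSet_ball)).exists
  rw [hB, mem_ball_iff_norm] at ha
  have hhalf : ‖(1 / 2 : ℝ) • y‖ ≤ 1 / 2 := by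
    rw [norm_smul, Real.norm_of_nonneg (by norm_num)]
    linarith
  refine ⟨a, y - a, by abel, h3 ?_, h4 ?_⟩
  · rw [mem_closedBall_zero_iff]
    have := norm_add_le (a - (1 / 2 : ℝ) • y) ((1 / 2 : ℝ) • y)
    rw [sub_add_cancel] at this
    linarith
  · rw [mem_closedBall_zero_iff]
    have e : y - a = (1 / 2 : ℝ) • y - (a - (1 / 2 : ℝ) • y) := by
      have : y = (1 / 2 : ℝ) • y + (1 / 2 : ℝ) • y := by
        rw [← add_smul]
        norm_num
      nth_rewrite 1 [this]
      abel
    rw [e]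
    have := norm_sub_le ((1 / 2 : ℝ) • y) (a - (1 / 2 : ℝ) • y)
    linarith

theorem IsModerateWeight.exists_exp_bound [BorelSpace E]
    [(volume : Measure E).IsAddHaarMeasure] {ω : E → ℝ} (hω : IsModerateWeight ω) :
    ∃ A a : ℝ, 0 < A ∧ 0 < a ∧ ∀ x y, ω (x + y) ≤ A * ω x * Real.exp (a * ‖y‖) := by
  obtain ⟨hw, v, C, hv, hC, hmod⟩ := hω
  obtain ⟨M, hM0, hM⟩ := hv.exists_ae_le
  -- A step of length at most `1` is made in two pieces, each costing `C * M`. The maximum with `exp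
  -- 1` keeps the growth rate `log D` positive.
  set D : ℝ := max ((C * M) ^ 2) (Real.exp 1) with hD
  have hD0 : 0 < D := lt_max_of_lt_right (Real.exp_pos _)
  have hlog : 1 ≤ Real.log D := (Real.le_log_iff_exp_le hD0).mpr (le_max_right _ _)
  have hloc : ∀ x y, ‖y‖ ≤ 1 → ω (x + y) ≤ D * ω x := by
    intro x y hy
    obtain ⟨a, b, rfl, ha, hb⟩ := IsWeight.exists_add_eq hM hy
    have hp := hw.pos x
    have hva := hv.pos a
    have hvb := hv.pos b
    calc ω (x + (a + b)) = ω ((x + a) + b) := by rw [add_assoc]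
      _ ≤ C * ω (x + a) * v b := hmod _ _
      _ ≤ C * (C * ω x * v a) * v b := by
        gcongr
        exact hmod _ _
      _ ≤ C * (C * ω x * M) * M := by gcongr
      _ = (C * M) ^ 2 * ω x := by ring
      _ ≤ D * ω x := by
        gcongr
        exact le_max_left _ _
  have hiter : ∀ (n : ℕ) (x u : E), ‖u‖ ≤ 1 → ω (x + n • u) ≤ D ^ n * ω x := by
    intro n x u hu
    induction n with
    | zero => simp
    | succ n ih =>
      rw [succ_nsmul, ← add_assoc]
      calc _ ≤ D * ω (x + n • u) := hloc _ _ hu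
        _ ≤ D * (D ^ n * ω x) := by gcongr
        _ = _ := by ring
  refine ⟨D, Real.log D, hD0, by linarith, fun x y => ?_⟩
  set n : ℕ := ⌊‖y‖⌋₊ + 1 with hn
  have hn0 : (0 : ℝ) < n := by positivity
  have hyn : ‖y‖ ≤ n := by
    rw [hn]
    push_cast
    exact (Nat.lt_floor_add_one _).le
  have h1 := hiter n x ((n : ℝ)⁻¹ • y) (by
    rw [norm_smul, norm_inv, Real.norm_of_nonneg hn0.le, inv_mul_le_iff₀ hn0, mul_one]
    exact hyn)
  rw [← Nat.cast_smul_eq_nsmul ℝ, smul_smul, mul_inv_cancel₀ hn0.ne', one_smul] at h1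
  refine h1.trans ?_
  have hp := hw.pos x
  have h2 : D ^ n ≤ D * Real.exp (Real.log D * ‖y‖) := by
    have h3 : D ^ n = Real.exp (Real.log D * n) := by
      rw [mul_comm, Real.exp_nat_mul, Real.exp_log hD0]
    have h4 : D * Real.exp (Real.log D * ‖y‖) = Real.exp (Real.log D * (‖y‖ + 1)) := by
      nth_rewrite 1 [← Real.exp_log hD0]
      rw [← Real.exp_add]
      congr 1
      ring
    rw [h3, h4]
    gcongr
    rw [hn]
    push_cast
    gcongr
    exact Nat.floor_le (norm_nonneg _)
  calc D ^ n * ω x ≤ (D * Real.exp (Real.log D * ‖y‖)) * ω x := by gcongr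
    _ = _ := by ring

theorem IsWeight.aemeasurable {ω : E → ℝ} (hω : IsWeight ω) : AEMeasurable ω volume := by
  rw [← Measure.restrict_univ (μ := (volume : Measure E)), ← Metric.iUnion_closedBall_nat (0 : E),
    aemeasurable_iUnion_iff]
  exact fun n => (hω.locBdd _ (isCompact_closedBall _ _)).aestronglyMeasurable.aemeasurable

end General

variable {d : ℕ}

instance : (volume : Measure (Rd d × Rd d)).IsAddHaarMeasure := by
  rw [Measure.volume_eq_prod]
  infer_instance

theorem IsModerateWeight.exists_expKer_bound {ω : Rd d × Rd d → ℝ} (hω : IsModerateWeight ω) :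
    ∃ (A : ℝ≥0∞) (a : ℝ), A ≠ ∞ ∧ 0 < a ∧ ∀ w z,
      ENNReal.ofReal (ω w) * expKer a (w - z) ≤ A * ENNReal.ofReal (ω z) := by
  obtain ⟨A, a, hA, ha, H⟩ := hω.exists_exp_bound
  refine ⟨ENNReal.ofReal A, a, ENNReal.ofReal_ne_top, ha, fun w z => ?_⟩
  have hz := hω.1.pos z
  rw [expKer, ← ENNReal.ofReal_mul (hω.1.pos w).le, ← ENNReal.ofReal_mul hA.le]
  refine ENNReal.ofReal_le_ofReal ?_
  have h1 := H z (w - z)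
  rw [add_sub_cancel] at h1
  rw [Real.exp_neg, ← div_eq_mul_inv, div_le_iff₀ (Real.exp_pos _)]
  refine h1.trans ?_
  gcongr
  rw [Prod.norm_def]
  exact max_le (le_add_of_nonneg_right (norm_nonneg _)) (le_add_of_nonneg_left (norm_nonneg _))

end Weights

/-! ### Measurability of slicewise essential suprema, and the mixed quasi-norm. -/

section MixedNorms

open scoped ENNReal

variable {d : ℕ}

/-! ### Essential suprema over slices -/

/-- `ξ ↦ ess sup_{x ∈ S} u(x, ξ)`. -/
noncomputable def sliceSup (S : Set (Rd d)) (u : Rd d × Rd d → ℝ≥0∞) (ξ : Rd d) : ℝ≥0∞ :=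
  essSup (fun x => u (x, ξ)) (volume.restrict S)

/-- The essential supremum exceeds `c` exactly when the section of `{c < u}` has positive measure,
and measures of sections depend measurably on the parameter. -/
theorem measurable_essSup_slice {α β : Type*} [MeasurableSpace α] [MeasurableSpace β]
    (μ : Measure α) [SFinite μ] {u : α × β → ℝ≥0∞} (hu : Measurable u) :
    Measurable fun y => essSup (fun x => u (x, y)) μ := by
  refine measurable_of_Ioi fun c => ?_
  have e : (fun y => essSup (fun x => u (x, y)) μ) ⁻¹' Set.Ioi c =
      {y | μ ((fun x => (x, y)) ⁻¹' {p | c < u p}) ≠ 0} := by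
    ext y
    rw [Set.mem_preimage, Set.mem_Ioi, ← not_le, Set.mem_ofPred_eq, not_iff_not]
    constructor
    · intro h
      have h1 : ∀ᵐ x ∂μ, u (x, y) ≤ c :=
        (ENNReal.ae_le_essSup (fun x => u (x, y))).mono fun x hx => hx.trans h
      rw [ae_iff] at h1
      simpa using h1
    · intro h
      refine essSup_le_of_ae_le c ?_
      change ∀ᵐ x ∂μ, u (x, y) ≤ c
      rw [ae_iff]
      simpa using h
  rw [e]
  exact (measurable_measure_prodMk_right (measurableSet_lt measurable_const hu))
    (measurableSet_singleton (0 : ℝ≥0∞)).compl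

/-- By Fubini, a measurable representative of `u` agrees with `u` almost everywhere on almost every
slice, so both have the same slicewise essential supremum there. -/
theorem aemeasurable_sliceSup (S : Set (Rd d)) {u : Rd d × Rd d → ℝ≥0∞}
    (hu : AEMeasurable u volume) : AEMeasurable (sliceSup S u) volume := by
  rw [Measure.volume_eq_prod] at hu
  have hac : ((volume : Measure (Rd d)).restrict S).prod (volume : Measure (Rd d)) ≪
      (volume : Measure (Rd d)).prod volume :=
    Measure.AbsolutelyContinuous.prod Measure.restrict_le_self.absolutelyContinuous
      Measure.AbsolutelyContinuous.rfl
  have hu' := hu.mono_ac hac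
  refine ⟨_, measurable_essSup_slice ((volume : Measure (Rd d)).restrict S) hu'.measurable_mk, ?_⟩
  have h1 := hu'.ae_eq_mk
  have h3 : ∀ᵐ ξ ∂(volume : Measure (Rd d)), ∀ᵐ x ∂((volume : Measure (Rd d)).restrict S),
      u (x, ξ) = hu'.mk u (x, ξ) := by
    have h4 := (Measure.measurePreserving_swap (μ := (volume : Measure (Rd d)))
      (ν := (volume : Measure (Rd d)).restrict S)).quasiMeasurePreserving.ae h1
    exact Measure.ae_ae_of_ae_prod h4
  filter_upwards [h3] with ξ hξ
  exact essSup_congr_ae hξ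

theorem le_sliceSup_ae (S : Set (Rd d)) (u : Rd d × Rd d → ℝ≥0∞) (ξ : Rd d) :
    ∀ᵐ x ∂(volume.restrict S), u (x, ξ) ≤ sliceSup S u ξ :=
  ENNReal.ae_le_essSup _

theorem sliceSup_le {S : Set (Rd d)} {u : Rd d × Rd d → ℝ≥0∞} {ξ : Rd d} {c : ℝ≥0∞}
    (h : ∀ x, u (x, ξ) ≤ c) : sliceSup S u ξ ≤ c :=
  essSup_le_of_ae_le c (Eventually.of_forall h)

/-- The weighted absolute value `|F| ω`. -/
noncomputable def wabs (ω : Rd d × Rd d → ℝ) (F : Rd d × Rd d → ℂ) (z : Rd d × Rd d) : ℝ≥0∞ :=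
  ‖F z‖ₑ * ENNReal.ofReal (ω z)

theorem aemeasurable_wabs {ω : Rd d × Rd d → ℝ} (hω : IsWeight ω) {F : Rd d × Rd d → ℂ}
    (hF : Continuous F) : AEMeasurable (wabs ω F) volume := by
  have h1 : AEMeasurable (fun z => ‖F z‖ₑ) volume := hF.enorm.measurable.aemeasurable
  have h2 : AEMeasurable (fun z => ENNReal.ofReal (ω z)) volume :=
    hω.aemeasurable.ennreal_ofReal
  exact h1.mul h2

theorem enorm_mul_ofReal_eq_wabs {ω : Rd d × Rd d → ℝ} {z : Rd d × Rd d} (hω : 0 < ω z)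
    (F : Rd d × Rd d → ℂ) : ‖F z * (ω z : ℂ)‖ₑ = wabs ω F z := by
  have h : ‖(ω z : ℂ)‖ₑ = ENNReal.ofReal (ω z) := by
    rw [← ofReal_norm, Complex.norm_real, Real.norm_of_nonneg hω.le]
  rw [enorm_mul, h, wabs]

theorem mixedNormOn_top_rpow {S : Set (Rd d)} {q : ℝ≥0∞} (hq₀ : q ≠ 0) (hq : q ≠ ∞)
    {ω : Rd d × Rd d → ℝ} (hω : ∀ z, 0 < ω z) (F : Rd d × Rd d → ℂ) :
    mixedNormOn S ∞ q ω F ^ q.toReal = ∫⁻ ξ, sliceSup S (wabs ω F) ξ ^ q.toReal := by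
  have hq' : q.toReal ≠ 0 := (ENNReal.toReal_pos hq₀ hq).ne'
  unfold mixedNormOn
  rw [eLpNorm_eq_lintegral_rpow_enorm_toReal hq₀ hq, one_div, ENNReal.rpow_inv_rpow hq']
  refine lintegral_congr fun ξ => ?_
  rw [enorm_eq_self, eLpNorm_exponent_top]
  simp only [eLpNormEssSup, enorm_mul_ofReal_eq_wabs (hω _), sliceSup]

end MixedNorms

/-! ### Quasi-norm properties, linear structure, and convolution with exponential kernels. -/

section NormStructure

open scoped ENNReal

variable {d : ℕ}

/-! ### The mixed quasi-norm -/

theorem sliceSup_mono_set {S T : Set (Rd d)} (hST : S ⊆ T) (u : Rd d × Rd d → ℝ≥0∞) (ξ : Rd d) :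
    sliceSup S u ξ ≤ sliceSup T u ξ :=
  essSup_mono_measure' (Measure.restrict_mono hST le_rfl)

theorem sliceSup_mono {S : Set (Rd d)} {u v : Rd d × Rd d → ℝ≥0∞} (huv : ∀ z, u z ≤ v z)
    (ξ : Rd d) : sliceSup S u ξ ≤ sliceSup S v ξ :=
  essSup_mono_ae (Eventually.of_forall fun x => huv (x, ξ))

theorem sliceSup_add_le (S : Set (Rd d)) (u v : Rd d × Rd d → ℝ≥0∞) (ξ : Rd d) :
    sliceSup S (fun z => u z + v z) ξ ≤ sliceSup S u ξ + sliceSup S v ξ :=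
  ENNReal.essSup_add_le _ _

theorem sliceSup_const_mul (S : Set (Rd d)) (c : ℝ≥0∞) (u : Rd d × Rd d → ℝ≥0∞) (ξ : Rd d) :
    sliceSup S (fun z => c * u z) ξ = c * sliceSup S u ξ :=
  ENNReal.essSup_const_mul

theorem wabs_add_le (ω : Rd d × Rd d → ℝ) (F G : Rd d × Rd d → ℂ) (z : Rd d × Rd d) :
    wabs ω (fun z => F z + G z) z ≤ wabs ω F z + wabs ω G z := by
  unfold wabs
  rw [← add_mul]
  gcongr
  exact enorm_add_le _ _

theorem wabs_const_mul (ω : Rd d × Rd d → ℝ) (c : ℂ) (F : Rd d × Rd d → ℂ) (z : Rd d × Rd d) :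
    wabs ω (fun z => c * F z) z = ‖c‖ₑ * wabs ω F z := by
  unfold wabs
  rw [enorm_mul, mul_assoc]

section Norm

variable {q : ℝ≥0∞} {ω : Rd d × Rd d → ℝ}

theorem mixedNormOn_top_eq (hq₀ : q ≠ 0) (hq : q ≠ ∞) (hω : ∀ z, 0 < ω z) (S : Set (Rd d))
    (F : Rd d × Rd d → ℂ) :
    mixedNormOn S ∞ q ω F = (∫⁻ ξ, sliceSup S (wabs ω F) ξ ^ q.toReal) ^ (1 / q.toReal) := by
  rw [← mixedNormOn_top_rpow hq₀ hq hω, one_div,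
    ENNReal.rpow_rpow_inv (ENNReal.toReal_pos hq₀ hq).ne']

theorem mixedNormOn_top_const_mul (hq₀ : q ≠ 0) (hq : q ≠ ∞) (hω : ∀ z, 0 < ω z)
    (S : Set (Rd d)) (c : ℂ) (F : Rd d × Rd d → ℂ) :
    mixedNormOn S ∞ q ω (fun z => c * F z) = ‖c‖ₑ * mixedNormOn S ∞ q ω F := by
  have hp := ENNReal.toReal_pos hq₀ hq
  have e : wabs ω (fun z => c * F z) = fun z => ‖c‖ₑ * wabs ω F z :=
    funext (wabs_const_mul ω c F)
  rw [mixedNormOn_top_eq hq₀ hq hω, mixedNormOn_top_eq hq₀ hq hω, e]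
  simp only [sliceSup_const_mul, ENNReal.mul_rpow_of_nonneg _ _ hp.le]
  rw [lintegral_const_mul' _ _ (ENNReal.rpow_ne_top_of_nonneg hp.le enorm_ne_top),
    ENNReal.mul_rpow_of_nonneg _ _ (by positivity), one_div, ENNReal.rpow_rpow_inv hp.ne']

theorem mixedNormOn_top_mono_set (hq₀ : q ≠ 0) (hq : q ≠ ∞) (hω : ∀ z, 0 < ω z)
    {S T : Set (Rd d)} (hST : S ⊆ T) (F : Rd d × Rd d → ℂ) :
    mixedNormOn S ∞ q ω F ≤ mixedNormOn T ∞ q ω F := by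
  rw [mixedNormOn_top_eq hq₀ hq hω, mixedNormOn_top_eq hq₀ hq hω]
  gcongr with ξ
  exact sliceSup_mono_set hST _ ξ

/-- Minkowski's inequality in `ξ` for `q ≥ 1`; for `q < 1`, the pointwise inequality `(a + b)^q ≤
a^q + b^q`. -/
theorem mixedNormOn_top_add_rpow_le (hq₀ : q ≠ 0) (hq : q ≠ ∞) (hω : IsWeight ω)
    (S : Set (Rd d)) {F G : Rd d × Rd d → ℂ} (hF : Continuous F) (hG : Continuous G) :
    mixedNormOn S ∞ q ω (fun z => F z + G z) ^ (min 1 q).toReal ≤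
      mixedNormOn S ∞ q ω F ^ (min 1 q).toReal + mixedNormOn S ∞ q ω G ^ (min 1 q).toReal := by
  have hp := ENNReal.toReal_pos hq₀ hq
  have hmF := aemeasurable_sliceSup S (aemeasurable_wabs hω hF)
  have hmG := aemeasurable_sliceSup S (aemeasurable_wabs hω hG)
  have hle : ∀ ξ, sliceSup S (wabs ω fun z => F z + G z) ξ ≤
      sliceSup S (wabs ω F) ξ + sliceSup S (wabs ω G) ξ := fun ξ =>
    (sliceSup_mono (wabs_add_le ω F G) ξ).trans (sliceSup_add_le S _ _ ξ)
  rcases le_or_gt 1 q with h1 | h1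
  · rw [min_eq_left h1, ENNReal.toReal_one, ENNReal.rpow_one, ENNReal.rpow_one, ENNReal.rpow_one]
    simp only [mixedNormOn_top_eq hq₀ hq hω.pos]
    have h1' : 1 ≤ q.toReal := by
      rw [← ENNReal.toReal_one]
      exact ENNReal.toReal_mono hq h1
    refine le_trans ?_ (ENNReal.lintegral_Lp_add_le hmF hmG h1')
    gcongr with ξ
    exact hle ξ
  · rw [min_eq_right h1.le]
    simp only [mixedNormOn_top_rpow hq₀ hq hω.pos]
    have h1' : q.toReal ≤ 1 := by
      rw [← ENNReal.toReal_one]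
      exact ENNReal.toReal_mono ENNReal.one_ne_top h1.le
    rw [← lintegral_add_left' (hmF.pow_const _)]
    refine lintegral_mono fun ξ => ?_
    exact (ENNReal.rpow_le_rpow (hle ξ) hp.le).trans
      (ENNReal.rpow_add_le_add_rpow _ _ hp.le h1')

end Norm

/-! ### Linearity of the short-time Fourier transform -/

theorem stft_eq (φ : SigmaOne d) (f : SigmaOneDual d) (z : Rd d × Rd d) :
    stft φ f z = (((2 * Real.pi) ^ (-(d : ℝ) / 2) : ℝ) : ℂ) * stftCore φ f z := rfl

theorem continuous_stft (φ : SigmaOne d) (f : SigmaOneDual d) : Continuous (stft φ f) :=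
  continuous_const.mul (continuous_stftCore φ f)

theorem stft_add (φ : SigmaOne d) (f g : SigmaOneDual d) :
    stft φ (f + g) = fun z => stft φ f z + stft φ g z := by
  funext z
  simp only [stft, add_apply, mul_add]

theorem stft_smul (φ : SigmaOne d) (c : ℂ) (f : SigmaOneDual d) :
    stft φ (c • f) = fun z => c * stft φ f z := by
  funext z
  simp only [stft, smul_apply, smul_eq_mul]
  ring

section Sharp

variable {q : ℝ≥0∞} {ω : Rd d × Rd d → ℝ} {φ : SigmaOne d}

theorem modNorm_rpow (hq₀ : q ≠ 0) (hq : q ≠ ∞) (hω : IsWeight ω) (f : SigmaOneDual d) :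
    modNorm φ ω ∞ q f ^ q.toReal =
      ∫⁻ ξ, sliceSup Set.univ (wabs ω (stft φ f)) ξ ^ q.toReal :=
  mixedNormOn_top_rpow hq₀ hq hω.pos _

theorem modNorm_smul (hq₀ : q ≠ 0) (hq : q ≠ ∞) (hω : IsWeight ω) (c : ℂ) (f : SigmaOneDual d) :
    modNorm φ ω ∞ q (c • f) = ‖c‖ₑ * modNorm φ ω ∞ q f := by
  unfold modNorm mixedNorm
  rw [stft_smul, mixedNormOn_top_const_mul hq₀ hq hω.pos]

theorem modNorm_add_rpow_le (hq₀ : q ≠ 0) (hq : q ≠ ∞) (hω : IsWeight ω)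
    (f g : SigmaOneDual d) :
    modNorm φ ω ∞ q (f + g) ^ (min 1 q).toReal ≤
      modNorm φ ω ∞ q f ^ (min 1 q).toReal + modNorm φ ω ∞ q g ^ (min 1 q).toReal := by
  unfold modNorm mixedNorm
  rw [stft_add]
  exact mixedNormOn_top_add_rpow_le hq₀ hq hω _ (continuous_stft φ f) (continuous_stft φ g)

theorem min_one_toReal_pos (hq₀ : q ≠ 0) : 0 < (min 1 q).toReal :=
  ENNReal.toReal_pos (by simp [hq₀]) (ne_top_of_le_ne_top ENNReal.one_ne_top (min_le_left _ _))

theorem modNorm_add_lt_top (hq₀ : q ≠ 0) (hq : q ≠ ∞) (hω : IsWeight ω) {f g : SigmaOneDual d}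
    (hf : modNorm φ ω ∞ q f < ∞) (hg : modNorm φ ω ∞ q g < ∞) :
    modNorm φ ω ∞ q (f + g) < ∞ := by
  have hr := min_one_toReal_pos hq₀
  have h := (modNorm_add_rpow_le (φ := φ) hq₀ hq hω f g).trans_lt (ENNReal.add_lt_top.mpr
    ⟨ENNReal.rpow_lt_top_of_nonneg hr.le hf.ne, ENNReal.rpow_lt_top_of_nonneg hr.le hg.ne⟩)
  exact (ENNReal.rpow_lt_top_iff_of_pos hr).mp h

theorem tendsto_zero_of_rpow {α : Type*} {l : Filter α} {u : α → ℝ≥0∞} {r : ℝ} (hr : 0 < r)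
    (h : Tendsto (fun x => u x ^ r) l (𝓝 0)) : Tendsto u l (𝓝 0) := by
  have h1 := ((ENNReal.continuous_rpow_const (y := r⁻¹)).tendsto 0).comp h
  rw [ENNReal.zero_rpow_of_pos (by positivity)] at h1
  refine h1.congr fun x => ?_
  simp only [Function.comp_apply]
  rw [ENNReal.rpow_rpow_inv hr.ne']

theorem tendsto_rpow_zero {α : Type*} {l : Filter α} {u : α → ℝ≥0∞} {r : ℝ} (hr : 0 < r)
    (h : Tendsto u l (𝓝 0)) : Tendsto (fun x => u x ^ r) l (𝓝 0) := by
  have h1 := ((ENNReal.continuous_rpow_const (y := r)).tendsto 0).comp h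
  rwa [ENNReal.zero_rpow_of_pos hr] at h1

theorem add_mem_modSharp (hq₀ : q ≠ 0) (hq : q ≠ ∞) (hω : IsWeight ω) {f g : SigmaOneDual d}
    (hf : f ∈ modSharp φ ω q) (hg : g ∈ modSharp φ ω q) : f + g ∈ modSharp φ ω q := by
  have hr := min_one_toReal_pos hq₀
  refine ⟨modNorm_add_lt_top hq₀ hq hω hf.1 hg.1, tendsto_zero_of_rpow hr ?_⟩
  have h1 := (tendsto_rpow_zero hr hf.2).add (tendsto_rpow_zero hr hg.2)
  rw [add_zero] at h1
  refine tendsto_of_tendsto_of_tendsto_of_le_of_le tendsto_const_nhds h1 (fun _ => bot_le)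
    fun R => ?_
  simp only [stft_add]
  exact mixedNormOn_top_add_rpow_le hq₀ hq hω _ (continuous_stft φ f) (continuous_stft φ g)

theorem smul_mem_modSharp (hq₀ : q ≠ 0) (hq : q ≠ ∞) (hω : IsWeight ω) (c : ℂ)
    {f : SigmaOneDual d} (hf : f ∈ modSharp φ ω q) : c • f ∈ modSharp φ ω q := by
  refine ⟨?_, ?_⟩
  · change modNorm φ ω ∞ q (c • f) < ∞
    rw [modNorm_smul hq₀ hq hω]
    exact ENNReal.mul_lt_top enorm_lt_top hf.1
  · simp only [stft_smul, mixedNormOn_top_const_mul hq₀ hq hω.pos]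
    have := ENNReal.Tendsto.const_mul hf.2 (Or.inr (enorm_ne_top (x := c)))
    rwa [mul_zero] at this

/-- The space `M^{♯,q}_{(ω)}(ℝᵈ)` as a linear subspace of `Σ₁'(ℝᵈ)`. -/
def modSharpSubmodule (φ : SigmaOne d) (hq₀ : q ≠ 0) (hq : q ≠ ∞) (hω : IsWeight ω) :
    Submodule ℂ (SigmaOneDual d) where
  carrier := modSharp φ ω q
  zero_mem' := by
    have h0 : stft φ (0 : SigmaOneDual d) = fun z => (0 : ℂ) * stft φ (0 : SigmaOneDual d) z := by
      funext z
      simp [stft]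
    have h1 : ∀ S : Set (Rd d), mixedNormOn S ∞ q ω (stft φ (0 : SigmaOneDual d)) = 0 := by
      intro S
      rw [h0, mixedNormOn_top_const_mul hq₀ hq hω.pos, enorm_zero, zero_mul]
    refine ⟨?_, ?_⟩
    · change mixedNormOn Set.univ ∞ q ω (stft φ (0 : SigmaOneDual d)) < ∞
      rw [h1]
      exact ENNReal.zero_lt_top
    · simp only [h1]
      exact tendsto_const_nhds
  add_mem' := add_mem_modSharp hq₀ hq hω
  smul_mem' c _ := smul_mem_modSharp hq₀ hq hω c

end Sharp

/-! ### Convolution estimates in mixed norms -/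

/-- The kernel `ξ ↦ exp(-|ξ|)`. -/
noncomputable def expNorm (ξ : Rd d) : ℝ≥0∞ := ENNReal.ofReal (Real.exp (-(1 * ‖ξ‖)))

theorem measurable_expNorm : Measurable (expNorm : Rd d → ℝ≥0∞) := by
  unfold expNorm
  fun_prop

theorem expKer_one_eq (z : Rd d × Rd d) : expKer 1 z = expNorm z.1 * expNorm z.2 := by
  unfold expKer expNorm
  rw [← ENNReal.ofReal_mul (Real.exp_pos _).le, ← Real.exp_add]
  congr 2
  ring

theorem lintegral_expNorm_lt_top : ∫⁻ ξ : Rd d, expNorm ξ < ∞ :=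
  (integrable_exp_neg_norm (d := d) one_pos).lintegral_lt_top

theorem lintegral_expNorm_sub (x : Rd d) : ∫⁻ y, expNorm (x - y) = ∫⁻ y : Rd d, expNorm y :=
  lintegral_sub_left_eq_self expNorm x

theorem lintegral_mul_expKer_le {u : Rd d × Rd d → ℝ≥0∞} (hu : AEMeasurable u volume) {p : ℝ}
    (hp : 0 < p) (w : Rd d × Rd d) :
    ∫⁻ z, u z ^ p * expKer 1 (w - z) ≤
      (∫⁻ x : Rd d, expNorm x) * ∫⁻ η, sliceSup Set.univ u η ^ p * expNorm (w.2 - η) := by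
  have hm : AEMeasurable (fun z => u z ^ p * expKer 1 (w - z)) volume :=
    (hu.pow_const p).mul
      ((measurable_expKer 1).comp (measurable_const.sub measurable_id)).aemeasurable
  rw [Measure.volume_eq_prod] at hm ⊢
  have hms := (aemeasurable_sliceSup Set.univ hu).pow_const p
  have hme : Measurable fun η : Rd d => expNorm (w.2 - η) :=
    measurable_expNorm.comp (measurable_const.sub measurable_id)
  have hmm : AEMeasurable (fun η => sliceSup Set.univ u η ^ p * expNorm (w.2 - η)) volume :=
    hms.mul hme.aemeasurable
  rw [lintegral_prod_symm _ hm, ← lintegral_const_mul'' _ hmm]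
  refine lintegral_mono fun η => ?_
  have h1 := le_sliceSup_ae Set.univ u η
  rw [Measure.restrict_univ] at h1
  have hmx : Measurable fun x : Rd d => expNorm (w.1 - x) :=
    measurable_expNorm.comp (measurable_const.sub measurable_id)
  calc ∫⁻ x, u (x, η) ^ p * expKer 1 (w - (x, η))
      ≤ ∫⁻ x, (sliceSup Set.univ u η ^ p * expNorm (w.2 - η)) * expNorm (w.1 - x) := by
        refine lintegral_mono_ae ?_
        filter_upwards [h1] with x hx
        rw [expKer_one_eq]
        calc _ ≤ sliceSup Set.univ u η ^ p * (expNorm (w.1 - x) * expNorm (w.2 - η)) :=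
              mul_le_mul' (ENNReal.rpow_le_rpow hx hp.le) le_rfl
          _ = _ := by ring
    _ = _ := by
        rw [lintegral_const_mul _ hmx, lintegral_expNorm_sub, mul_comm]

/-- After the `x`-integration the remaining kernel in `ξ` is at most `1`. Dropping it turns an `L^p`
norm in `ξ` into a bound at every point. -/
theorem rpow_le_of_convolution {u v : Rd d × Rd d → ℝ≥0∞} (hu : AEMeasurable u volume) {p : ℝ}
    (hp : 0 < p) {C : ℝ≥0∞} (h : ∀ w, v w ^ p ≤ C * ∫⁻ z, u z ^ p * expKer 1 (w - z))
    (w : Rd d × Rd d) :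
    v w ^ p ≤ C * (∫⁻ x : Rd d, expNorm x) * ∫⁻ η, sliceSup Set.univ u η ^ p := by
  refine (h w).trans ?_
  rw [mul_assoc]
  gcongr
  refine (lintegral_mul_expKer_le hu hp w).trans ?_
  gcongr with η
  refine (mul_le_mul' le_rfl ?_).trans (mul_one _).le
  unfold expNorm
  rw [← ENNReal.ofReal_one]
  refine ENNReal.ofReal_le_ofReal ?_
  rw [Real.exp_le_one_iff, neg_nonpos]
  positivity

/-- Taking the essential supremum in `x` leaves an `L¹` convolution in `ξ` of `p`-th powers, so
Tonelli's theorem suffices for every `p > 0`. -/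
theorem lintegral_sliceSup_le_of_convolution {u v : Rd d × Rd d → ℝ≥0∞}
    (hu : AEMeasurable u volume) {p : ℝ} (hp : 0 < p) {C : ℝ≥0∞}
    (h : ∀ w, v w ^ p ≤ C * ∫⁻ z, u z ^ p * expKer 1 (w - z)) :
    ∫⁻ ξ, sliceSup Set.univ v ξ ^ p ≤
      C * (∫⁻ x : Rd d, expNorm x) ^ 2 * ∫⁻ η, sliceSup Set.univ u η ^ p := by
  set c := ∫⁻ x : Rd d, expNorm x with hc
  have hms := (aemeasurable_sliceSup Set.univ hu).pow_const p
  have h1 : ∀ ξ, sliceSup Set.univ v ξ ^ p ≤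
      C * c * ∫⁻ η, sliceSup Set.univ u η ^ p * expNorm (ξ - η) := by
    intro ξ
    rw [← ENNReal.le_rpow_inv_iff hp]
    refine sliceSup_le fun x => ?_
    rw [ENNReal.le_rpow_inv_iff hp]
    refine (h (x, ξ)).trans ?_
    rw [mul_assoc]
    gcongr
    exact lintegral_mul_expKer_le hu hp (x, ξ)
  have hm2 : AEMeasurable (fun y : Rd d × Rd d =>
      sliceSup Set.univ u y.2 ^ p * expNorm (y.1 - y.2))
      ((volume : Measure (Rd d)).prod volume) :=
    (hms.comp_quasiMeasurePreserving Measure.quasiMeasurePreserving_snd).mul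
      (measurable_expNorm.comp (measurable_fst.sub measurable_snd)).aemeasurable
  have hmint : AEMeasurable (fun ξ : Rd d =>
      ∫⁻ η, sliceSup Set.univ u η ^ p * expNorm (ξ - η)) volume :=
    hm2.lintegral_prod_right'
  calc ∫⁻ ξ, sliceSup Set.univ v ξ ^ p
      ≤ ∫⁻ ξ, C * c * ∫⁻ η, sliceSup Set.univ u η ^ p * expNorm (ξ - η) := lintegral_mono h1
    _ = C * c * ∫⁻ ξ, ∫⁻ η, sliceSup Set.univ u η ^ p * expNorm (ξ - η) :=
        lintegral_const_mul'' _ hmint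
    _ = C * c * ∫⁻ η, ∫⁻ ξ, sliceSup Set.univ u η ^ p * expNorm (ξ - η) := by
        rw [lintegral_lintegral_swap hm2]
    _ = C * c * ∫⁻ η, sliceSup Set.univ u η ^ p * c := by
        congr 1
        refine lintegral_congr fun η => ?_
        have hme : Measurable fun ξ : Rd d => expNorm (ξ - η) :=
          measurable_expNorm.comp (measurable_id.sub measurable_const)
        rw [lintegral_const_mul _ hme, lintegral_sub_right_eq_self expNorm η]
    _ = _ := by
        rw [lintegral_mul_const'' _ hms]
        ring

end NormStructure

/-! ### Weighted pointwise bounds, embedding into `Σ₁'`, and the inclusion of `Σ₁`. -/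

section Estimates

open scoped ENNReal

variable {d : ℕ} {q : ℝ≥0∞} {ω : Rd d × Rd d → ℝ} {φ : SigmaOne d}

/-! ### Pointwise estimates -/

theorem rpow_mul_expKer_le {A : ℝ≥0∞} {a p : ℝ} (hp : 0 < p)
    (H : ∀ w z, ENNReal.ofReal (ω w) * expKer a (w - z) ≤ A * ENNReal.ofReal (ω z)) (k : ℝ)
    (w z : Rd d × Rd d) :
    ENNReal.ofReal (ω w) ^ p * expKer (p * a + k) (w - z) ≤
      A ^ p * (ENNReal.ofReal (ω z) ^ p * expKer k (w - z)) := by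
  rw [expKer_add, ← expKer_rpow _ hp.le, ← mul_assoc, ← mul_assoc,
    ← ENNReal.mul_rpow_of_nonneg _ _ hp.le, ← ENNReal.mul_rpow_of_nonneg _ _ hp.le]
  exact mul_le_mul' (ENNReal.rpow_le_rpow (H w z) hp.le) le_rfl

/-- Passage from unweighted to weighted convolution estimates. -/
theorem exists_weighted_convolution (hω : IsModerateWeight ω) {p : ℝ} (hp : 0 < p) :
    ∃ (τ : ℝ) (B : ℝ≥0∞), 0 < τ ∧ B ≠ ∞ ∧ ∀ (C : ℝ≥0∞) (F G : Rd d × Rd d → ℂ)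
      (θ : Rd d × Rd d → ℝ≥0∞), Continuous G → Measurable θ →
      (∀ w, ‖F w‖ₑ ^ p ≤ C * ∫⁻ z, ‖G z‖ₑ ^ p * θ z * expKer τ (w - z)) →
      ∀ w, wabs ω F w ^ p ≤ C * B * ∫⁻ z, wabs ω G z ^ p * θ z * expKer 1 (w - z) := by
  obtain ⟨A, a, hA, ha, H⟩ := hω.exists_expKer_bound
  -- Of the rate `p * a + 1`, the part `p * a` pays for moving `ω ^ p` from `w` to `z`, and rate `1`
  -- is left over.
  refine ⟨p * a + 1, A ^ p, by positivity, ENNReal.rpow_ne_top_of_nonneg hp.le hA,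
    fun C F G θ hG hθ h w => ?_⟩
  have hm : Measurable fun z => ‖G z‖ₑ ^ p * θ z * expKer (p * a + 1) (w - z) :=
    measurable_mul_expKer_sub ((hG.enorm.measurable.pow_const p).mul hθ) _ w
  unfold wabs
  rw [ENNReal.mul_rpow_of_nonneg _ _ hp.le]
  calc _ ≤ (C * ∫⁻ z, ‖G z‖ₑ ^ p * θ z * expKer (p * a + 1) (w - z)) *
        ENNReal.ofReal (ω w) ^ p := by
        gcongr
        exact h w
    _ = C * ∫⁻ z, ‖G z‖ₑ ^ p * θ z * expKer (p * a + 1) (w - z) * ENNReal.ofReal (ω w) ^ p := by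
        rw [mul_assoc, lintegral_mul_const _ hm]
    _ ≤ C * ∫⁻ z, A ^ p * ((‖G z‖ₑ * ENNReal.ofReal (ω z)) ^ p * θ z * expKer 1 (w - z)) := by
        refine mul_le_mul' le_rfl (lintegral_mono fun z => ?_)
        rw [ENNReal.mul_rpow_of_nonneg _ _ hp.le]
        calc _ = ‖G z‖ₑ ^ p * θ z *
              (ENNReal.ofReal (ω w) ^ p * expKer (p * a + 1) (w - z)) := by ring
          _ ≤ ‖G z‖ₑ ^ p * θ z * (A ^ p * (ENNReal.ofReal (ω z) ^ p * expKer 1 (w - z))) :=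
              mul_le_mul' le_rfl (rpow_mul_expKer_le hp H 1 w z)
          _ = _ := by ring
    _ = _ := by
        rw [lintegral_const_mul' _ _ (ENNReal.rpow_ne_top_of_nonneg hp.le hA), mul_assoc]

theorem enorm_stft (φ : SigmaOne d) (f : SigmaOneDual d) (z : Rd d × Rd d) :
    ‖stft φ f z‖ₑ = ENNReal.ofReal ((2 * Real.pi) ^ (-(d : ℝ) / 2)) * ‖stftCore φ f z‖ₑ := by
  have h : ‖(((2 * Real.pi) ^ (-(d : ℝ) / 2) : ℝ) : ℂ)‖ₑ =
      ENNReal.ofReal ((2 * Real.pi) ^ (-(d : ℝ) / 2)) := by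
    rw [← ofReal_norm, Complex.norm_real, Real.norm_of_nonneg (by positivity)]
  rw [stft_eq, enorm_mul, h]

theorem exists_stft_rpow_le (hφ : φ ≠ 0) {p k : ℝ} (hp : 0 < p) (hk : 0 < k) :
    ∃ C : ℝ≥0∞, C ≠ ∞ ∧ ∀ (f : SigmaOneDual d) (w : Rd d × Rd d),
      ‖stft φ f w‖ₑ ^ p ≤ C * ∫⁻ z, ‖stft φ f z‖ₑ ^ p * expKer k (w - z) := by
  obtain ⟨C, hC, H⟩ := exists_rpow_le_lintegral hφ hp hk
  refine ⟨C, hC, fun f w => ?_⟩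
  simp only [enorm_stft, ENNReal.mul_rpow_of_nonneg _ _ hp.le, mul_assoc]
  rw [lintegral_const_mul' _ _ (ENNReal.rpow_ne_top_of_nonneg hp.le ENNReal.ofReal_ne_top),
    mul_left_comm]
  gcongr
  exact H f w

/-- The embedding of `M^{∞,q}` into `M^{∞,∞}`, with a bound at every point rather than almost
everywhere; it comes from the convolution inequality for `p`-th powers. -/
theorem exists_wabs_le_modNorm (hφ : φ ≠ 0) (hω : IsModerateWeight ω) (hq₀ : q ≠ 0)
    (hq : q ≠ ∞) : ∃ C : ℝ≥0∞, C ≠ ∞ ∧ ∀ (f : SigmaOneDual d) (w : Rd d × Rd d),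
      wabs ω (stft φ f) w ≤ C * modNorm φ ω ∞ q f := by
  set p := q.toReal with hp_def
  have hp : 0 < p := ENNReal.toReal_pos hq₀ hq
  obtain ⟨τ, B, hτ, hB, hconv⟩ := exists_weighted_convolution hω hp
  obtain ⟨C, hC, H⟩ := exists_stft_rpow_le hφ hp hτ
  set K := C * B * ∫⁻ x : Rd d, expNorm x with hK
  have hK' : K ≠ ∞ :=
    ENNReal.mul_ne_top (ENNReal.mul_ne_top hC hB) lintegral_expNorm_lt_top.ne
  refine ⟨K ^ p⁻¹, ENNReal.rpow_ne_top_of_nonneg (by positivity) hK', fun f w => ?_⟩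
  have h1 := hconv C (stft φ f) (stft φ f) (fun _ => 1) (continuous_stft φ f) measurable_const
    (fun w => by simpa only [mul_one] using H f w)
  simp only [mul_one] at h1
  have h2 := rpow_le_of_convolution (aemeasurable_wabs hω.1 (continuous_stft φ f)) hp h1 w
  rw [← hK, ← modNorm_rpow hq₀ hq hω.1, ← ENNReal.le_rpow_inv_iff hp,
    ENNReal.mul_rpow_of_nonneg _ _ (by positivity), ENNReal.rpow_rpow_inv hp.ne'] at h2
  exact h2

theorem eq_zero_of_stftCore_eq_zero (hφ : φ ≠ 0) {f : SigmaOneDual d}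
    (h : ∀ z, stftCore φ f z = 0) : f = 0 := by
  ext g
  rw [dual_apply_eq_integral hφ f g]
  have : ∀ z : Rd d × Rd d, f (conjShift φ z.1 z.2) = 0 := h
  simp [this]

theorem eq_zero_of_modNorm_eq_zero (hφ : φ ≠ 0) (hω : IsModerateWeight ω) (hq₀ : q ≠ 0)
    (hq : q ≠ ∞) {f : SigmaOneDual d} (hf : modNorm φ ω ∞ q f = 0) : f = 0 := by
  obtain ⟨C, -, H⟩ := exists_wabs_le_modNorm hφ hω hq₀ hq
  refine eq_zero_of_stftCore_eq_zero hφ fun z => ?_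
  have h1 := H f z
  rw [hf, mul_zero, nonpos_iff_eq_zero, wabs, mul_eq_zero, enorm_stft, mul_eq_zero] at h1
  rcases h1 with (h1 | h1) | h1
  · rw [ENNReal.ofReal_eq_zero] at h1
    exact absurd h1 (not_le.mpr (by positivity))
  · simpa using h1
  · rw [ENNReal.ofReal_eq_zero] at h1
    exact absurd h1 (not_le.mpr (hω.1.pos z))

/-- The pointwise bound is inserted into the inversion formula for `f g`. That one seminorm works
for all `f` at once is what makes limits of Cauchy sequences continuous functionals. -/
theorem exists_enorm_apply_le (hφ : φ ≠ 0) (hω : IsModerateWeight ω) (hq₀ : q ≠ 0)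
    (hq : q ≠ ∞) : ∃ (h : {h : ℝ // 0 < h}) (C : ℝ≥0∞), C ≠ ∞ ∧
      ∀ (f : SigmaOneDual d) (g : SigmaOne d),
        ‖f g‖ₑ ≤ C * modNorm φ ω ∞ q f * ENNReal.ofReal (gsSeminorm d h g) := by
  obtain ⟨C, hC, H⟩ := exists_wabs_le_modNorm hφ hω hq₀ hq
  obtain ⟨A, a, hA, ha, Hω⟩ := hω.exists_expKer_bound
  -- The rate `a` compensates the possible growth of `1 / ω`; the extra `1` leaves an integrable
  -- kernel.
  obtain ⟨h, K, hK, hdec⟩ := exists_analysisCoeff_decay φ (k := a + 1) (by positivity)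
  set c : ℂ := ((((2 * Real.pi) ^ d * l2Sq φ)⁻¹ : ℝ) : ℂ) with hc
  set c₀ := ENNReal.ofReal ((2 * Real.pi) ^ (-(d : ℝ) / 2)) with hc₀
  have hc₀0 : c₀ ≠ 0 := by
    rw [hc₀, Ne, ENNReal.ofReal_eq_zero, not_le]
    positivity
  have hc₀t : c₀ ≠ ∞ := ENNReal.ofReal_ne_top
  set ω₀ := ENNReal.ofReal (ω 0) with hω₀
  have hω₀0 : ω₀ ≠ 0 := by
    rw [hω₀, Ne, ENNReal.ofReal_eq_zero, not_le]
    exact hω.1.pos 0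
  have hω₀t : ω₀ ≠ ∞ := ENNReal.ofReal_ne_top
  set E := ∫⁻ z : Rd d × Rd d, expKer 1 z with hE
  refine ⟨h, ‖c‖ₑ * (ENNReal.ofReal K * ((c₀ * ω₀)⁻¹ * (A * C)) * E), ?_, fun f g => ?_⟩
  · refine ENNReal.mul_ne_top enorm_ne_top (ENNReal.mul_ne_top (ENNReal.mul_ne_top
      ENNReal.ofReal_ne_top (ENNReal.mul_ne_top ?_ (ENNReal.mul_ne_top hA hC)))
      (lintegral_expKer_lt_top one_pos).ne)
    exact ENNReal.inv_ne_top.mpr (mul_ne_zero hc₀0 hω₀0)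
  have hcore : ∀ z, ‖stftCore φ f z‖ₑ * expKer a z ≤
      (c₀ * ω₀)⁻¹ * (A * C) * modNorm φ ω ∞ q f := by
    intro z
    have h1 : c₀ * ω₀ * (‖stftCore φ f z‖ₑ * expKer a z) ≤ A * C * modNorm φ ω ∞ q f := by
      have h2 := Hω 0 z
      rw [expKer_sub_comm, sub_zero] at h2
      calc _ = c₀ * ‖stftCore φ f z‖ₑ * (ω₀ * expKer a z) := by ring
        _ ≤ c₀ * ‖stftCore φ f z‖ₑ * (A * ENNReal.ofReal (ω z)) := mul_le_mul' le_rfl h2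
        _ = A * wabs ω (stft φ f) z := by
          rw [wabs, enorm_stft]
          ring
        _ ≤ A * (C * modNorm φ ω ∞ q f) := mul_le_mul' le_rfl (H f z)
        _ = _ := by ring
    rw [mul_assoc, mul_comm (c₀ * ω₀)⁻¹, ← div_eq_mul_inv, ENNReal.le_div_iff_mul_le
      (Or.inl (mul_ne_zero hc₀0 hω₀0)) (Or.inl (ENNReal.mul_ne_top hc₀t hω₀t)), mul_comm]
    exact h1
  have hcoef : ∀ z, ‖analysisCoeff φ g z‖ₑ ≤
      ENNReal.ofReal K * ENNReal.ofReal (gsSeminorm d h g) * expKer (a + 1) z := by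
    intro z
    rw [expKer, ← ENNReal.ofReal_mul hK, ← ENNReal.ofReal_mul (mul_nonneg hK (apply_nonneg _ _)),
      ← ofReal_norm]
    exact ENNReal.ofReal_le_ofReal (hdec g z)
  rw [dual_apply_eq_integral hφ f g, enorm_mul]
  calc _ ≤ ‖c‖ₑ * ∫⁻ z, ‖analysisCoeff φ g z * f (conjShift φ z.1 z.2)‖ₑ := by
        gcongr
        exact enorm_integral_le_lintegral_enorm _
    _ ≤ ‖c‖ₑ * ∫⁻ z, (ENNReal.ofReal K * ENNReal.ofReal (gsSeminorm d h g) *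
          ((c₀ * ω₀)⁻¹ * (A * C) * modNorm φ ω ∞ q f)) * expKer 1 z := by
        refine mul_le_mul' le_rfl (lintegral_mono fun z => ?_)
        rw [enorm_mul]
        calc _ ≤ (ENNReal.ofReal K * ENNReal.ofReal (gsSeminorm d h g) * expKer (a + 1) z) *
              ‖stftCore φ f z‖ₑ := mul_le_mul' (hcoef z) le_rfl
          _ = ENNReal.ofReal K * ENNReal.ofReal (gsSeminorm d h g) *
              (‖stftCore φ f z‖ₑ * expKer a z) * expKer 1 z := by
              rw [expKer_add]
              ring
          _ ≤ _ := mul_le_mul' (mul_le_mul' le_rfl (hcore z)) le_rfl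
    _ = _ := by
        rw [lintegral_const_mul _ (measurable_expKer 1)]
        ring

/-! ### `Σ₁(ℝᵈ)` is contained in `M^{♯,q}_{(ω)}(ℝᵈ)` -/

theorem exists_wabs_stft_toDual_le (φ : SigmaOne d) (hω : IsModerateWeight ω) (g : SigmaOne d) :
    ∃ K : ℝ≥0∞, K ≠ ∞ ∧ ∀ z, wabs ω (stft φ (toDual d g)) z ≤ K * expKer 1 z := by
  obtain ⟨A, a, hA, ha, Hω⟩ := hω.exists_expKer_bound
  obtain ⟨h, C, hC, hdec⟩ := exists_pairing_decay φ (k := a + 1) (by positivity)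
  set c₀ := ENNReal.ofReal ((2 * Real.pi) ^ (-(d : ℝ) / 2)) with hc₀
  set D := ENNReal.ofReal (C * gsSeminorm d h g) with hD
  refine ⟨c₀ * D * (A * ENNReal.ofReal (ω 0)), ENNReal.mul_ne_top
    (ENNReal.mul_ne_top ENNReal.ofReal_ne_top ENNReal.ofReal_ne_top)
    (ENNReal.mul_ne_top hA ENNReal.ofReal_ne_top), fun z => ?_⟩
  have h1 : ‖stftCore φ (toDual d g) z‖ₑ ≤ D * expKer (a + 1) z := by
    rw [expKer, hD, ← ENNReal.ofReal_mul (mul_nonneg hC (apply_nonneg _ _)), ← ofReal_norm]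
    exact ENNReal.ofReal_le_ofReal (hdec g z.1 z.2)
  have h2 := Hω z 0
  rw [sub_zero] at h2
  rw [wabs, enorm_stft]
  calc _ ≤ c₀ * (D * expKer (a + 1) z) * ENNReal.ofReal (ω z) :=
        mul_le_mul' (mul_le_mul' le_rfl h1) le_rfl
    _ = c₀ * D * (ENNReal.ofReal (ω z) * expKer a z) * expKer 1 z := by
        rw [expKer_add]
        ring
    _ ≤ _ := mul_le_mul' (mul_le_mul' le_rfl h2) le_rfl

theorem lintegral_expNorm_rpow_lt_top {p : ℝ} (hp : 0 < p) :
    ∫⁻ ξ : Rd d, expNorm ξ ^ p < ∞ := by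
  have h := (integrable_exp_neg_norm (d := d) hp).lintegral_lt_top
  refine lt_of_eq_of_lt (lintegral_congr fun ξ => ?_) h
  unfold expNorm
  rw [ENNReal.ofReal_rpow_of_nonneg (Real.exp_pos _).le hp.le, ← Real.exp_mul]
  congr 2
  ring

theorem toDual_mem_modSharp (φ : SigmaOne d) (hω : IsModerateWeight ω) (hq₀ : q ≠ 0)
    (hq : q ≠ ∞) (g : SigmaOne d) : toDual d g ∈ modSharp φ ω q := by
  set p := q.toReal with hp_def
  have hp : 0 < p := ENNReal.toReal_pos hq₀ hq
  obtain ⟨K, hK, H⟩ := exists_wabs_stft_toDual_le φ hω g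
  set I := ∫⁻ ξ : Rd d, expNorm ξ ^ p with hI
  have hIt : I ≠ ∞ := (lintegral_expNorm_rpow_lt_top hp).ne
  -- One estimate for both conditions: `S = univ` with `c = 1` gives finiteness, and `S = {R ≤ ‖x‖}`
  -- with `c = exp(-R)` gives the vanishing tail.
  have key : ∀ (S : Set (Rd d)) (c : ℝ≥0∞), MeasurableSet S → c ≠ ∞ →
      (∀ x ∈ S, expNorm x ≤ c) →
      mixedNormOn S ∞ q ω (stft φ (toDual d g)) ^ p ≤ (K * c) ^ p * I := by
    intro S c hS hc hSc
    rw [mixedNormOn_top_rpow hq₀ hq hω.1.pos, hI,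
      ← lintegral_const_mul' _ _ (ENNReal.rpow_ne_top_of_nonneg hp.le (ENNReal.mul_ne_top hK hc))]
    refine lintegral_mono fun ξ => ?_
    rw [← ENNReal.mul_rpow_of_nonneg _ _ hp.le]
    refine ENNReal.rpow_le_rpow (essSup_le_of_ae_le _ ?_) hp.le
    filter_upwards [ae_restrict_mem hS] with x hx
    refine (H (x, ξ)).trans ?_
    rw [expKer_one_eq, mul_assoc]
    exact mul_le_mul' le_rfl (mul_le_mul' (hSc x hx) le_rfl)
  constructor
  · change mixedNormOn Set.univ ∞ q ω (stft φ (toDual d g)) < ∞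
    rw [← ENNReal.rpow_lt_top_iff_of_pos hp]
    refine (key Set.univ 1 MeasurableSet.univ ENNReal.one_ne_top fun x _ => ?_).trans_lt ?_
    · unfold expNorm
      rw [← ENNReal.ofReal_one]
      refine ENNReal.ofReal_le_ofReal ?_
      rw [Real.exp_le_one_iff, neg_nonpos]
      positivity
    · exact ENNReal.mul_lt_top (ENNReal.rpow_lt_top_of_nonneg hp.le
        (ENNReal.mul_ne_top hK ENNReal.one_ne_top)) hIt.lt_top
  · refine tendsto_zero_of_rpow hp ?_
    have h1 : Tendsto (fun R : ℝ => ENNReal.ofReal (Real.exp (-R))) atTop (𝓝 0) := by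
      have := ENNReal.tendsto_ofReal Real.tendsto_exp_neg_atTop_nhds_zero
      rwa [ENNReal.ofReal_zero] at this
    have h2 : Tendsto (fun R : ℝ => (K * ENNReal.ofReal (Real.exp (-R))) ^ p * I) atTop (𝓝 0) := by
      have h3 := ENNReal.Tendsto.const_mul h1 (Or.inr hK)
      rw [mul_zero] at h3
      have h4 := ENNReal.Tendsto.mul_const (tendsto_rpow_zero hp h3) (Or.inr hIt)
      rwa [zero_mul] at h4
    refine tendsto_of_tendsto_of_tendsto_of_le_of_le tendsto_const_nhds h2 (fun _ => bot_le)
      fun R => ?_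
    refine key _ _ (measurableSet_le measurable_const measurable_norm) ENNReal.ofReal_ne_top
      fun x hx => ?_
    unfold expNorm
    refine ENNReal.ofReal_le_ofReal ?_
    rw [one_mul]
    gcongr
    exact hx

/-- Testing against the complex conjugate of `f` yields the squared `L²` norm. -/
theorem toDual_injective : Function.Injective (toDual d) := by
  rw [injective_iff_map_eq_zero]
  intro f hf
  by_contra hne
  have h1 : toDual d f (conjSigma f) = 0 := by rw [hf]; rfl
  have h2 : toDual d f (conjSigma f) = (l2Sq f : ℂ) := by
    rw [toDual_apply, l2Sq, ← integral_complex_ofReal]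
    refine integral_congr_ae (Eventually.of_forall fun x => ?_)
    simp only [conjSigma_apply]
    rw [Complex.mul_conj, Complex.normSq_eq_norm_sq]
  rw [h2, Complex.ofReal_eq_zero] at h1
  exact (l2Sq_pos hne).ne' h1

end Estimates

/-! ### Weak limits, Fatou's lemma and completeness. -/

section Limits

open scoped ENNReal

variable {d : ℕ} {q : ℝ≥0∞} {ω : Rd d × Rd d → ℝ} {φ : SigmaOne d}

/-! ### Completeness -/

/-- The pointwise limit differs from a fixed `s n₀` by a functional bounded by the seminorm of index
`h`. This makes it continuous without a uniform boundedness principle. -/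
theorem exists_tendsto_apply {N : SigmaOneDual d → ℝ≥0∞} {h : {h : ℝ // 0 < h}} {C : ℝ≥0∞}
    (hC : C ≠ ∞)
    (H : ∀ (f : SigmaOneDual d) (g : SigmaOne d),
      ‖f g‖ₑ ≤ C * N f * ENNReal.ofReal (gsSeminorm d h g))
    {s : ℕ → SigmaOneDual d}
    (hs : ∀ ε : ℝ≥0∞, 0 < ε → ∃ n₀, ∀ m n, n₀ ≤ m → n₀ ≤ n → N (s m - s n) < ε) :
    ∃ u : SigmaOneDual d, ∀ g, Tendsto (fun n => s n g) atTop (𝓝 (u g)) := by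
  have hlim : ∀ g, ∃ y, Tendsto (fun n => s n g) atTop (𝓝 y) := by
    intro g
    refine cauchySeq_tendsto_of_complete (EMetric.cauchySeq_iff.mpr fun ε hε => ?_)
    obtain ⟨δ, hδ, hlt⟩ := ENNReal.exists_nnreal_pos_mul_lt
      (ENNReal.mul_ne_top hC (ENNReal.ofReal_ne_top (r := gsSeminorm d h g))) hε.ne'
    obtain ⟨n₀, hn₀⟩ := hs δ (by exact_mod_cast hδ)
    refine ⟨n₀, fun m hm n hn => ?_⟩
    rw [edist_eq_enorm_sub]
    calc ‖s m g - s n g‖ₑ ≤ C * N (s m - s n) * ENNReal.ofReal (gsSeminorm d h g) :=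
          H (s m - s n) g
      _ ≤ C * δ * ENNReal.ofReal (gsSeminorm d h g) :=
          mul_le_mul' (mul_le_mul' le_rfl (hn₀ m n hm hn).le) le_rfl
      _ = δ * (C * ENNReal.ofReal (gsSeminorm d h g)) := by ring
      _ < ε := hlt
  choose y hy using hlim
  set U : SigmaOne d →ₗ[ℂ] ℂ := linearMapOfTendsto y (fun n => (s n : SigmaOne d →ₗ[ℂ] ℂ))
    (tendsto_pi_nhds.mpr hy) with hU
  obtain ⟨n₀, hn₀⟩ := hs 1 one_pos
  have hbound : ∀ g, ‖(U - (s n₀ : SigmaOne d →ₗ[ℂ] ℂ)) g‖ ≤ C.toReal * gsSeminorm d h g := by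
    intro g
    have h1 : Tendsto (fun n => ‖s n g - s n₀ g‖ₑ) atTop (𝓝 ‖y g - s n₀ g‖ₑ) :=
      ((hy g).sub_const _).enorm
    have h2 : ‖y g - s n₀ g‖ₑ ≤ C * 1 * ENNReal.ofReal (gsSeminorm d h g) := by
      refine le_of_tendsto h1 ((eventually_ge_atTop n₀).mono fun n hn => ?_)
      exact (H (s n - s n₀) g).trans
        (mul_le_mul' (mul_le_mul' le_rfl (hn₀ n n₀ hn le_rfl).le) le_rfl)
    rw [mul_one, ← ENNReal.ofReal_toReal hC, ← ENNReal.ofReal_mul ENNReal.toReal_nonneg,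
      ← ofReal_norm, ENNReal.ofReal_le_ofReal_iff
        (mul_nonneg ENNReal.toReal_nonneg (apply_nonneg _ _))] at h2
    exact h2
  have hcont : Continuous (U - (s n₀ : SigmaOne d →ₗ[ℂ] ℂ)) := by
    refine (sigmaOne_withSeminorms d).continuous_normedSpace_rng ℂ _
      ⟨{h}, ⟨C.toReal, ENNReal.toReal_nonneg⟩, fun g => ?_⟩
    rw [Finset.sup_singleton]
    exact hbound g
  refine ⟨(⟨U - (s n₀ : SigmaOne d →ₗ[ℂ] ℂ), hcont⟩ : SigmaOneDual d) + s n₀, fun g => ?_⟩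
  have e : ((⟨U - (s n₀ : SigmaOne d →ₗ[ℂ] ℂ), hcont⟩ : SigmaOneDual d) + s n₀) g = y g :=
    sub_add_cancel (y g) (s n₀ g)
  rw [e]
  exact hy g

/-- Weak convergence gives pointwise convergence of the transforms. Essential suprema are lower
semicontinuous under it, and Fatou's lemma in `ξ` handles the `q`-th powers. -/
theorem modNorm_le_of_tendsto (hq₀ : q ≠ 0) (hq : q ≠ ∞) (hω : IsWeight ω)
    {t : ℕ → SigmaOneDual d} {v : SigmaOneDual d}
    (ht : ∀ g, Tendsto (fun m => t m g) atTop (𝓝 (v g))) {ε : ℝ≥0∞}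
    (hε : ∀ᶠ m in atTop, modNorm φ ω ∞ q (t m) ≤ ε) : modNorm φ ω ∞ q v ≤ ε := by
  set p := q.toReal with hp_def
  have hp : 0 < p := ENNReal.toReal_pos hq₀ hq
  have hpt : ∀ z, Tendsto (fun m => wabs ω (stft φ (t m)) z ^ p) atTop
      (𝓝 (wabs ω (stft φ v) z ^ p)) := by
    intro z
    have h1 : Tendsto (fun m => stft φ (t m) z) atTop (𝓝 (stft φ v z)) :=
      (ht (conjShift φ z.1 z.2)).const_mul _
    have h2 : Tendsto (fun m => wabs ω (stft φ (t m)) z) atTop (𝓝 (wabs ω (stft φ v) z)) :=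
      ENNReal.Tendsto.mul_const h1.enorm (Or.inr ENNReal.ofReal_ne_top)
    have h3 := ((ENNReal.continuous_rpow_const (y := p)).tendsto _).comp h2
    exact h3
  have hslice : ∀ ξ, sliceSup Set.univ (wabs ω (stft φ v)) ξ ^ p ≤
      liminf (fun m => sliceSup Set.univ (wabs ω (stft φ (t m))) ξ ^ p) atTop := by
    intro ξ
    rw [← ENNReal.le_rpow_inv_iff hp]
    refine essSup_le_of_ae_le _ ?_
    have h1 := ae_all_iff.mpr fun m => le_sliceSup_ae Set.univ (wabs ω (stft φ (t m))) ξ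
    filter_upwards [h1] with x hx
    rw [ENNReal.le_rpow_inv_iff hp, ← (hpt (x, ξ)).liminf_eq]
    exact liminf_le_liminf (Eventually.of_forall fun m => ENNReal.rpow_le_rpow (hx m) hp.le)
  rw [← ENNReal.rpow_le_rpow_iff hp, modNorm_rpow hq₀ hq hω]
  calc _ ≤ ∫⁻ ξ, liminf (fun m => sliceSup Set.univ (wabs ω (stft φ (t m))) ξ ^ p) atTop :=
        lintegral_mono hslice
    _ ≤ liminf (fun m => ∫⁻ ξ, sliceSup Set.univ (wabs ω (stft φ (t m))) ξ ^ p) atTop :=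
        lintegral_liminf_le' fun m => (aemeasurable_sliceSup _
          (aemeasurable_wabs hω (continuous_stft φ (t m)))).pow_const p
    _ ≤ liminf (fun _ : ℕ => ε ^ p) atTop := by
        refine liminf_le_liminf (hε.mono fun m hm => ?_)
        simp only [hp_def]
        rw [← modNorm_rpow hq₀ hq hω]
        exact ENNReal.rpow_le_rpow hm hp.le
    _ = ε ^ p := liminf_const _

/-- The tail of `u` is controlled by the tail of `s n` and the full quasi-norm of `u - s n`, through
`r`-subadditivity. -/
theorem mem_modSharp_of_tendsto (hq₀ : q ≠ 0) (hq : q ≠ ∞) (hω : IsWeight ω)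
    {s : ℕ → SigmaOneDual d} (hs : ∀ n, s n ∈ modSharp φ ω q) {u : SigmaOneDual d}
    (hu : Tendsto (fun n => modNorm φ ω ∞ q (u - s n)) atTop (𝓝 0)) : u ∈ modSharp φ ω q := by
  have hr := min_one_toReal_pos hq₀
  set r := (min 1 q).toReal with hr_def
  have e : ∀ n, s n + (u - s n) = u := fun n => add_sub_cancel _ _
  refine ⟨?_, tendsto_zero_of_rpow hr (ENNReal.tendsto_nhds_zero.mpr fun ε hε => ?_)⟩
  · obtain ⟨n, hn⟩ := (hu.eventually_lt_const ENNReal.zero_lt_top).exists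
    have h1 := modNorm_add_lt_top hq₀ hq hω (hs n).1 hn
    rw [e] at h1
    exact h1
  · have hε2 : 0 < ε / 2 := ENNReal.half_pos hε.ne'
    obtain ⟨n, hn⟩ := ((tendsto_rpow_zero hr hu).eventually_lt_const hε2).exists
    filter_upwards [(tendsto_rpow_zero hr (hs n).2).eventually_lt_const hε2] with R hR
    have h1 := mixedNormOn_top_add_rpow_le hq₀ hq hω {x | R ≤ ‖x‖} (continuous_stft φ (s n))
      (continuous_stft φ (u - s n))
    rw [← stft_add, e] at h1
    refine h1.trans ((add_le_add hR.le (le_trans ?_ hn.le)).trans (ENNReal.add_halves ε).le)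
    exact ENNReal.rpow_le_rpow
      (mixedNormOn_top_mono_set hq₀ hq hω.pos (Set.subset_univ _) _) hr.le

theorem modNorm_sub_comm (hq₀ : q ≠ 0) (hq : q ≠ ∞) (hω : IsWeight ω) (f g : SigmaOneDual d) :
    modNorm φ ω ∞ q (f - g) = modNorm φ ω ∞ q (g - f) := by
  have h := modNorm_smul (φ := φ) hq₀ hq hω (-1) (g - f)
  have e : (-1 : ℂ) • (g - f) = f - g := by
    ext x
    simp
  rwa [e, enorm_neg, enorm_one, one_mul] at h

theorem modSharp_complete (hφ : φ ≠ 0) (hω : IsModerateWeight ω) (hq₀ : q ≠ 0) (hq : q ≠ ∞)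
    {s : ℕ → SigmaOneDual d} (hmem : ∀ n, s n ∈ modSharp φ ω q)
    (hs : ∀ ε : ℝ≥0∞, 0 < ε → ∃ n₀, ∀ m n, n₀ ≤ m → n₀ ≤ n →
      modNorm φ ω ∞ q (s m - s n) < ε) :
    ∃ u ∈ modSharp φ ω q, Tendsto (fun n => modNorm φ ω ∞ q (s n - u)) atTop (𝓝 0) := by
  obtain ⟨h, C, hC, H⟩ := exists_enorm_apply_le hφ hω hq₀ hq
  obtain ⟨u, hu⟩ := exists_tendsto_apply hC H hs
  have hlim : Tendsto (fun n => modNorm φ ω ∞ q (s n - u)) atTop (𝓝 0) := by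
    refine ENNReal.tendsto_nhds_zero.mpr fun ε hε => ?_
    obtain ⟨n₀, hn₀⟩ := hs ε hε
    filter_upwards [eventually_ge_atTop n₀] with n hn
    refine modNorm_le_of_tendsto hq₀ hq hω.1 (t := fun m => s n - s m) (fun g => ?_)
      ((eventually_ge_atTop n₀).mono fun m hm => (hn₀ n m hn hm).le)
    exact (hu g).const_sub (s n g)
  refine ⟨u, mem_modSharp_of_tendsto hq₀ hq hω.1 hmem ?_, hlim⟩
  simpa only [modNorm_sub_comm hq₀ hq hω.1 u] using hlim

end Limits

/-! ### Density of `Σ₁` by truncating the inversion formula. -/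

section Density

open scoped ENNReal

variable {d : ℕ} {q : ℝ≥0∞} {ω : Rd d × Rd d → ℝ} {φ : SigmaOne d}

/-! ### Approximation by elements of `Σ₁(ℝᵈ)` -/

/-- Truncating the inversion formula for `f` to a bounded region gives an element of `Σ₁(ℝᵈ)`. -/
theorem exists_truncation (hφ : φ ≠ 0) (f : SigmaOneDual d) (R : ℝ) :
    ∃ g : SigmaOne d, ∀ w, stftCore φ (f - toDual d g) w =
      ((((2 * Real.pi) ^ d * l2Sq φ)⁻¹ : ℝ) : ℂ) * ∫ z in {z | R < ‖z.1‖ + ‖z.2‖},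
        analysisCoeff φ (conjShift φ w.1 w.2) z * stftCore φ f z := by
  set c : ℂ := ((((2 * Real.pi) ^ d * l2Sq φ)⁻¹ : ℝ) : ℂ) with hc
  set K : Set (Rd d × Rd d) := {z | R < ‖z.1‖ + ‖z.2‖}ᶜ with hK
  have hKm : MeasurableSet K :=
    (measurableSet_lt measurable_const (measurable_fst.norm.add measurable_snd.norm)).compl
  have hKmem : ∀ z ∈ K, ‖z.1‖ + ‖z.2‖ ≤ R := fun z hz => not_lt.mp hz
  set G : Rd d × Rd d → ℂ := K.indicator fun z => c * stftCore φ f z with hG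
  have hcont : Continuous fun z => c * stftCore φ f z :=
    continuous_const.mul (continuous_stftCore φ f)
  have hGm : AEStronglyMeasurable G volume :=
    (hcont.stronglyMeasurable.indicator hKm).aestronglyMeasurable
  obtain ⟨M, hM⟩ := (isCompact_closedBall (0 : Rd d × Rd d) R).exists_bound_of_continuousOn
    hcont.continuousOn
  have hGb : ∀ k : ℝ, 0 < k →
      ∃ C : ℝ, ∀ z, ‖G z‖ ≤ C * Real.exp (-(k * (‖z.1‖ + ‖z.2‖))) := by
    intro k hk
    refine ⟨|M| * Real.exp (k * R), fun z => ?_⟩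
    by_cases hz : z ∈ K
    · have h1 : z ∈ Metric.closedBall (0 : Rd d × Rd d) R := by
        rw [mem_closedBall_zero_iff, Prod.norm_def]
        exact le_trans (max_le (le_add_of_nonneg_right (norm_nonneg _))
          (le_add_of_nonneg_left (norm_nonneg _))) (hKmem z hz)
      rw [hG, Set.indicator_of_mem hz, mul_assoc, ← Real.exp_add]
      refine (hM z h1).trans ((le_abs_self M).trans (le_mul_of_one_le_right (abs_nonneg M) ?_))
      rw [Real.one_le_exp_iff]
      nlinarith [hKmem z hz]
    · rw [hG, Set.indicator_of_notMem hz, norm_zero]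
      positivity
  have hΦ : Continuous fun z : Rd d × Rd d => conjSigma (conjShift φ z.1 z.2) := by
    have h1 : Continuous fun z : Rd d × Rd d => (z.1, -z.2) :=
      continuous_fst.prodMk continuous_snd.neg
    have h2 := (continuous_conjShift (conjSigma φ)).comp h1
    refine h2.congr fun z => ?_
    rw [conjSigma_conjShift]
    rfl
  obtain ⟨g, -, hg⟩ := exists_superposition hΦ hGm fun h => by
    simp only [gsSeminorm_conjSigma]
    exact integrable_mul_gsSeminorm_conjShift φ hGm hGb h
  refine ⟨g, fun w => ?_⟩
  set A := analysisCoeff φ (conjShift φ w.1 w.2) with hA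
  have hGint : Integrable (fun z => A z * stftCore φ f z) volume := by
    refine integrable_mul_dual (continuous_conjShift φ)
      (continuous_analysisCoeff φ _).aestronglyMeasurable (fun h => ?_) f
    refine integrable_mul_gsSeminorm_conjShift φ
      (continuous_analysisCoeff φ _).aestronglyMeasurable (fun k hk => ?_) h
    obtain ⟨h', C, -, H⟩ := exists_analysisCoeff_decay φ hk
    exact ⟨_, H (conjShift φ w.1 w.2)⟩
  have h1 : stftCore φ f w = c * ∫ z, A z * stftCore φ f z :=
    dual_apply_eq_integral hφ f (conjShift φ w.1 w.2)
  -- By symmetry of the pairing this is a functional applied to `g`, so it passes under the integral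
  -- defining `g`.
  have h2 : toDual d g (conjShift φ w.1 w.2) = c * ∫ z in K, A z * stftCore φ f z := by
    rw [toDual_comm, hg, ← integral_const_mul, ← integral_indicator hKm]
    refine integral_congr_ae (Eventually.of_forall fun z => ?_)
    change G z * A z = _
    by_cases hz : z ∈ K
    · rw [hG, Set.indicator_of_mem hz, Set.indicator_of_mem hz]
      ring
    · rw [hG, Set.indicator_of_notMem hz, Set.indicator_of_notMem hz, zero_mul]
  have h3 := integral_add_compl hKm hGint
  have h4 : stftCore φ (f - toDual d g) w =
      stftCore φ f w - toDual d g (conjShift φ w.1 w.2) := rfl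
  rw [h4, h1, h2, ← h3, hK, compl_compl]
  ring

theorem expKer_le_one {k : ℝ} (hk : 0 ≤ k) (z : Rd d × Rd d) : expKer k z ≤ 1 := by
  unfold expKer
  rw [← ENNReal.ofReal_one]
  refine ENNReal.ofReal_le_ofReal ?_
  rw [Real.exp_le_one_iff, neg_nonpos]
  positivity

/-- The function `exp(-max(R - |x| - |ξ|, 0))`. -/
noncomputable def cutoff (R : ℝ) (z : Rd d × Rd d) : ℝ≥0∞ :=
  ENNReal.ofReal (Real.exp (-max (R - (‖z.1‖ + ‖z.2‖)) 0))

theorem measurable_cutoff (R : ℝ) : Measurable (cutoff R : Rd d × Rd d → ℝ≥0∞) := by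
  unfold cutoff
  exact (ENNReal.continuous_ofReal.comp (by fun_prop)).measurable

theorem expKer_one_le_cutoff {R : ℝ} {z : Rd d × Rd d} (hz : R < ‖z.1‖ + ‖z.2‖)
    (y : Rd d × Rd d) : expKer 1 (z - y) ≤ cutoff R y := by
  unfold expKer cutoff
  refine ENNReal.ofReal_le_ofReal (Real.exp_le_exp.mpr (neg_le_neg ?_))
  have h1 := norm_sub_norm_le z.1 y.1
  have h2 := norm_sub_norm_le z.2 y.2
  rw [Prod.fst_sub, Prod.snd_sub]
  refine max_le ?_ (by positivity)
  linarith

/-- The error is a reproducing integral of first powers over the complement of the truncated region.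
For `p < 1` it cannot be passed to `p`-th powers directly, so `|F| exp(-σ|w - ·|)` is first bounded
in the supremum norm over that complement, using the inequality for `p`-th powers. -/
theorem exists_core_truncation_le (hφ : φ ≠ 0) {p τ : ℝ} (hp : 0 < p) (hτ : 0 < τ) :
    ∃ C : ℝ≥0∞, C ≠ ∞ ∧ ∀ (f : SigmaOneDual d) (R : ℝ), ∃ g : SigmaOne d, ∀ w,
      ‖stftCore φ (f - toDual d g) w‖ₑ ^ p ≤
        C * ∫⁻ z, ‖stftCore φ f z‖ₑ ^ p * cutoff R z * expKer τ (w - z) := by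
  -- The `p`-th power has rate `τ + 1`. The parts of rate `τ` in `w - z` and `z - y` combine to a
  -- kernel in `w - y`, and the spare unit in `z - y` becomes the cutoff. The further unit in `σ +
  -- 1` below makes the kernel integrable in `z`.
  set σ := (τ + 1) / p with hσ
  have hσ0 : 0 < σ := by positivity
  have hpσ : p * σ = τ + 1 := mul_div_cancel₀ _ hp.ne'
  obtain ⟨C₁, hC₁, H₁⟩ := exists_enorm_analysisCoeff_le φ (k := σ + 1) (by positivity)
  obtain ⟨C₂, hC₂, H₂⟩ := exists_rpow_le_lintegral hφ hp (k := τ + 1) (by positivity)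
  set c : ℂ := ((((2 * Real.pi) ^ d * l2Sq φ)⁻¹ : ℝ) : ℂ) with hc
  set E := ∫⁻ z : Rd d × Rd d, expKer 1 z with hE
  refine ⟨(‖c‖ₑ * C₁ * E) ^ p * C₂, ENNReal.mul_ne_top (ENNReal.rpow_ne_top_of_nonneg hp.le
    (ENNReal.mul_ne_top (ENNReal.mul_ne_top enorm_ne_top hC₁)
      (lintegral_expKer_lt_top one_pos).ne)) hC₂, fun f R => ?_⟩
  obtain ⟨g, hg⟩ := exists_truncation hφ f R
  refine ⟨g, fun w => ?_⟩
  set I := ∫⁻ z, ‖stftCore φ f z‖ₑ ^ p * cutoff R z * expKer τ (w - z) with hI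
  have hm : MeasurableSet {z : Rd d × Rd d | R < ‖z.1‖ + ‖z.2‖} :=
    measurableSet_lt measurable_const (measurable_fst.norm.add measurable_snd.norm)
  have hmE : Measurable fun z : Rd d × Rd d => expKer 1 (w - z) :=
    (measurable_expKer 1).comp (measurable_const.sub measurable_id)
  have hsup : ∀ z : Rd d × Rd d, R < ‖z.1‖ + ‖z.2‖ →
      ‖stftCore φ f z‖ₑ * expKer σ (w - z) ≤ (C₂ * I) ^ p⁻¹ := by
    intro z hz
    rw [ENNReal.le_rpow_inv_iff hp, ENNReal.mul_rpow_of_nonneg _ _ hp.le, expKer_rpow _ hp.le,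
      hpσ]
    calc _ ≤ (C₂ * ∫⁻ y, ‖stftCore φ f y‖ₑ ^ p * expKer (τ + 1) (z - y)) *
          expKer (τ + 1) (w - z) := mul_le_mul' (H₂ f z) le_rfl
      _ = C₂ * ∫⁻ y, ‖stftCore φ f y‖ₑ ^ p * expKer (τ + 1) (z - y) *
          expKer (τ + 1) (w - z) := by
          rw [mul_assoc, lintegral_mul_const' _ _ (expKer_ne_top _ _)]
      _ ≤ C₂ * I := by
          refine mul_le_mul' le_rfl (lintegral_mono fun y => ?_)
          calc _ = ‖stftCore φ f y‖ₑ ^ p * (expKer 1 (z - y) * expKer 1 (w - z)) *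
                (expKer τ (w - z) * expKer τ (z - y)) := by
                rw [expKer_add, expKer_add]
                ring
            _ ≤ ‖stftCore φ f y‖ₑ ^ p * (cutoff R y * 1) * expKer τ (w - y) :=
                mul_le_mul' (mul_le_mul' le_rfl (mul_le_mul' (expKer_one_le_cutoff hz y)
                  (expKer_le_one zero_le_one _))) (expKer_mul_le hτ.le w z y)
            _ = _ := by rw [mul_one]
  have hmain : ‖stftCore φ (f - toDual d g) w‖ₑ ≤ ‖c‖ₑ * C₁ * E * (C₂ * I) ^ p⁻¹ := by
    rw [hg w, enorm_mul]
    calc _ ≤ ‖c‖ₑ * ∫⁻ z in {z | R < ‖z.1‖ + ‖z.2‖},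
          ‖analysisCoeff φ (conjShift φ w.1 w.2) z * stftCore φ f z‖ₑ :=
          mul_le_mul' le_rfl (enorm_integral_le_lintegral_enorm _)
      _ ≤ ‖c‖ₑ * ∫⁻ z in {z | R < ‖z.1‖ + ‖z.2‖},
          (C₁ * (C₂ * I) ^ p⁻¹) * expKer 1 (w - z) := by
          refine mul_le_mul' le_rfl (setLIntegral_mono' hm fun z hz => ?_)
          rw [enorm_mul]
          calc _ ≤ C₁ * expKer (σ + 1) (w - z) * ‖stftCore φ f z‖ₑ :=
                mul_le_mul' (H₁ w z) le_rfl
            _ = C₁ * (‖stftCore φ f z‖ₑ * expKer σ (w - z)) * expKer 1 (w - z) := by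
                rw [expKer_add]
                ring
            _ ≤ _ := mul_le_mul' (mul_le_mul' le_rfl (hsup z hz)) le_rfl
      _ ≤ ‖c‖ₑ * ∫⁻ z, (C₁ * (C₂ * I) ^ p⁻¹) * expKer 1 (w - z) :=
          mul_le_mul' le_rfl (setLIntegral_le_lintegral _ _)
      _ = _ := by
          rw [lintegral_const_mul _ hmE, lintegral_expKer_sub]
          ring
  refine (ENNReal.rpow_le_rpow hmain hp.le).trans_eq ?_
  rw [ENNReal.mul_rpow_of_nonneg _ _ hp.le, ENNReal.rpow_inv_rpow hp.ne', ← mul_assoc]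

theorem exists_modNorm_truncation_le (hφ : φ ≠ 0) (hω : IsModerateWeight ω) (hq₀ : q ≠ 0)
    (hq : q ≠ ∞) : ∃ C : ℝ≥0∞, C ≠ ∞ ∧ ∀ (f : SigmaOneDual d) (R : ℝ), ∃ g : SigmaOne d,
      modNorm φ ω ∞ q (f - toDual d g) ^ q.toReal ≤
        C * ∫⁻ ξ, sliceSup Set.univ
          (fun z => wabs ω (stft φ f) z * cutoff R z ^ q.toReal⁻¹) ξ ^ q.toReal := by
  set p := q.toReal with hp_def
  have hp : 0 < p := ENNReal.toReal_pos hq₀ hq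
  obtain ⟨τ, B, hτ, hB, hconv⟩ := exists_weighted_convolution hω hp
  obtain ⟨C, hC, H⟩ := exists_core_truncation_le hφ hp hτ
  refine ⟨C * B * (∫⁻ x : Rd d, expNorm x) ^ 2, ENNReal.mul_ne_top (ENNReal.mul_ne_top hC hB)
    (ENNReal.pow_ne_top lintegral_expNorm_lt_top.ne), fun f R => ?_⟩
  obtain ⟨g, hg⟩ := H f R
  refine ⟨g, ?_⟩
  have h1 : ∀ w, ‖stft φ (f - toDual d g) w‖ₑ ^ p ≤
      C * ∫⁻ z, ‖stft φ f z‖ₑ ^ p * cutoff R z * expKer τ (w - z) := by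
    intro w
    simp only [enorm_stft, ENNReal.mul_rpow_of_nonneg _ _ hp.le, mul_assoc]
    rw [lintegral_const_mul' _ _ (ENNReal.rpow_ne_top_of_nonneg hp.le ENNReal.ofReal_ne_top),
      mul_left_comm]
    refine mul_le_mul' le_rfl ?_
    simpa only [mul_assoc] using hg w
  have h2 := hconv C _ _ (cutoff R) (continuous_stft φ f) (measurable_cutoff R) h1
  rw [modNorm_rpow hq₀ hq hω.1]
  refine lintegral_sliceSup_le_of_convolution ((aemeasurable_wabs hω.1
    (continuous_stft φ f)).mul ((measurable_cutoff R).pow_const _).aemeasurable) hp fun w => ?_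
  refine (h2 w).trans_eq ?_
  congr 1
  refine lintegral_congr fun z => ?_
  rw [Pi.mul_apply, ENNReal.mul_rpow_of_nonneg _ _ hp.le, ENNReal.rpow_inv_rpow hp.ne']

/-- For `|x| ≥ T` the cutoff is discarded, leaving the tail that the definition of `modSharp`
controls. For `|x| < T` the cutoff has a bound independent of `x` that vanishes as `R → ∞` for fixed
`ξ`. -/
theorem sliceSup_mul_cutoff_le {p : ℝ} (hp : 0 < p) (u : Rd d × Rd d → ℝ≥0∞) (R T : ℝ)
    (ξ : Rd d) :
    sliceSup Set.univ (fun z => u z * cutoff R z ^ p⁻¹) ξ ^ p ≤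
      sliceSup {x | T ≤ ‖x‖} u ξ ^ p +
        sliceSup Set.univ u ξ ^ p * ENNReal.ofReal (Real.exp (-max (R - T - ‖ξ‖) 0)) := by
  have hm : MeasurableSet {x : Rd d | T ≤ ‖x‖} :=
    measurableSet_le measurable_const measurable_norm
  rw [← ENNReal.le_rpow_inv_iff hp]
  refine essSup_le_of_ae_le _ ?_
  have h1 := le_sliceSup_ae Set.univ u ξ
  have h2 := (ae_restrict_iff' hm).mp (le_sliceSup_ae {x | T ≤ ‖x‖} u ξ)
  rw [Measure.restrict_univ] at h1 ⊢
  filter_upwards [h1, h2] with x hx₁ hx₂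
  rw [ENNReal.le_rpow_inv_iff hp, ENNReal.mul_rpow_of_nonneg _ _ hp.le,
    ENNReal.rpow_inv_rpow hp.ne']
  rcases le_or_gt T ‖x‖ with hT | hT
  · refine le_trans ?_ le_self_add
    refine (mul_le_mul' (ENNReal.rpow_le_rpow (hx₂ hT) hp.le) ?_).trans_eq (mul_one _)
    unfold cutoff
    rw [← ENNReal.ofReal_one]
    refine ENNReal.ofReal_le_ofReal ?_
    rw [Real.exp_le_one_iff, neg_nonpos]
    exact le_max_right _ _
  · refine le_trans ?_ le_add_self
    refine mul_le_mul' (ENNReal.rpow_le_rpow hx₁ hp.le) (ENNReal.ofReal_le_ofReal ?_)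
    refine Real.exp_le_exp.mpr (neg_le_neg (max_le_max ?_ le_rfl))
    change R - T - ‖ξ‖ ≤ R - (‖x‖ + ‖ξ‖)
    linarith

/-- Dominated convergence with majorant `S`. A supremum over `ξ` would not allow this: the
convergence is not uniform in `ξ`. -/
theorem tendsto_lintegral_mul_exp {S : Rd d → ℝ≥0∞} (hS : AEMeasurable S volume)
    (hfin : ∫⁻ ξ, S ξ ≠ ∞) (T : ℝ) :
    Tendsto (fun n : ℕ => ∫⁻ ξ, S ξ * ENNReal.ofReal (Real.exp (-max ((n : ℝ) - T - ‖ξ‖) 0)))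
      atTop (𝓝 0) := by
  have hlim : ∀ ξ : Rd d, Tendsto
      (fun n : ℕ => ENNReal.ofReal (Real.exp (-max ((n : ℝ) - T - ‖ξ‖) 0))) atTop (𝓝 0) := by
    intro ξ
    have h1 : Tendsto (fun n : ℕ => max ((n : ℝ) - T - ‖ξ‖) 0) atTop atTop := by
      refine tendsto_atTop_mono (fun n => le_max_left _ _) ?_
      have h2 := tendsto_atTop_add_const_right atTop (-T - ‖ξ‖)
        (tendsto_natCast_atTop_atTop (R := ℝ))
      refine h2.congr fun n => ?_
      ring
    have h3 := ENNReal.tendsto_ofReal (Real.tendsto_exp_neg_atTop_nhds_zero.comp h1)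
    rw [ENNReal.ofReal_zero] at h3
    exact h3
  have h := tendsto_lintegral_of_dominated_convergence' (μ := (volume : Measure (Rd d)))
    (F := fun (n : ℕ) ξ => S ξ * ENNReal.ofReal (Real.exp (-max ((n : ℝ) - T - ‖ξ‖) 0)))
    (f := fun _ => 0) S
    (fun n => hS.mul (ENNReal.continuous_ofReal.comp (by fun_prop)).measurable.aemeasurable)
    (fun n => Eventually.of_forall fun ξ => ?_) hfin ?_
  · simpa using h
  · refine (mul_le_mul' le_rfl ?_).trans_eq (mul_one _)
    rw [← ENNReal.ofReal_one]
    refine ENNReal.ofReal_le_ofReal ?_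
    rw [Real.exp_le_one_iff, neg_nonpos]
    exact le_max_right _ _
  · filter_upwards [ae_lt_top' hS hfin] with ξ hξ
    have h1 := ENNReal.Tendsto.const_mul (hlim ξ) (Or.inr hξ.ne)
    rwa [mul_zero] at h1

theorem exists_modNorm_sub_toDual_lt (hφ : φ ≠ 0) (hω : IsModerateWeight ω) (hq₀ : q ≠ 0)
    (hq : q ≠ ∞) {f : SigmaOneDual d} (hf : f ∈ modSharp φ ω q) {ε : ℝ≥0∞} (hε : 0 < ε) :
    ∃ g : SigmaOne d, modNorm φ ω ∞ q (f - toDual d g) < ε := by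
  obtain ⟨C, hC, H⟩ := exists_modNorm_truncation_le hφ hω hq₀ hq
  have hp : 0 < q.toReal := ENNReal.toReal_pos hq₀ hq
  set p := q.toReal with hp_def
  set S : Rd d → ℝ≥0∞ := fun ξ => sliceSup Set.univ (wabs ω (stft φ f)) ξ ^ p with hS_def
  have hw := aemeasurable_wabs hω.1 (continuous_stft φ f)
  have hS : AEMeasurable S volume := (aemeasurable_sliceSup _ hw).pow_const p
  have hSfin : ∫⁻ ξ, S ξ ≠ ∞ := by
    rw [hS_def, ← modNorm_rpow hq₀ hq hω.1]
    exact ENNReal.rpow_ne_top_of_nonneg hp.le (LT.lt.ne hf.1)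
  have hε2 : 0 < ε ^ p / 2 := ENNReal.half_pos (ENNReal.rpow_pos_of_nonneg hε hp.le).ne'
  have htail := ENNReal.Tendsto.const_mul (tendsto_rpow_zero hp hf.2) (Or.inr hC)
  rw [mul_zero] at htail
  -- `T` is fixed from the tail of `f` alone; the truncation radius `n` is chosen afterwards,
  -- depending on `T`.
  obtain ⟨T, hT⟩ := (htail.eventually_lt_const hε2).exists
  have hJ := ENNReal.Tendsto.const_mul (tendsto_lintegral_mul_exp hS hSfin T) (Or.inr hC)
  rw [mul_zero] at hJ
  obtain ⟨n, hn⟩ := (hJ.eventually_lt_const hε2).exists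
  obtain ⟨g, hg⟩ := H f n
  refine ⟨g, ?_⟩
  rw [← ENNReal.rpow_lt_rpow_iff hp]
  have htm : AEMeasurable
      (fun ξ => sliceSup {x | T ≤ ‖x‖} (wabs ω (stft φ f)) ξ ^ p) volume :=
    (aemeasurable_sliceSup _ hw).pow_const p
  calc _ ≤ C * ∫⁻ ξ, (sliceSup {x | T ≤ ‖x‖} (wabs ω (stft φ f)) ξ ^ p +
        S ξ * ENNReal.ofReal (Real.exp (-max ((n : ℝ) - T - ‖ξ‖) 0))) :=
        hg.trans (mul_le_mul' le_rfl (lintegral_mono fun ξ => sliceSup_mul_cutoff_le hp _ _ _ ξ))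
    _ = C * mixedNormOn {x | T ≤ ‖x‖} ∞ q ω (stft φ f) ^ p +
        C * ∫⁻ ξ, S ξ * ENNReal.ofReal (Real.exp (-max ((n : ℝ) - T - ‖ξ‖) 0)) := by
        rw [lintegral_add_left' htm, mul_add, hp_def, mixedNormOn_top_rpow hq₀ hq hω.1.pos]
    _ < ε ^ p / 2 + ε ^ p / 2 := ENNReal.add_lt_add hT hn
    _ = ε ^ p := ENNReal.add_halves _

end Density

end ModSharp

theorem mainTheorem2 (d : ℕ) (q : ℝ≥0∞) (hq₀ : 0 < q) (hq : q < ∞)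
    (ω : ModSharp.Rd d × ModSharp.Rd d → ℝ) (hω : ModSharp.IsModerateWeight ω)
    (φ : ModSharp.SigmaOne d) (hφ : φ ≠ 0) :
    ModSharp.IsQuasiNormCompletion (min 1 q).toReal (ModSharp.modNorm φ ω ∞ q)
      (ModSharp.toDual d) (ModSharp.modSharp φ ω q) := by
  exact {
    isSubspace := ⟨ModSharp.modSharpSubmodule φ hq₀.ne' hq.ne hω.1, rfl⟩
    finite := fun _ hu => hu.1
    definite := fun u _ => by
      refine ⟨ModSharp.eq_zero_of_modNorm_eq_zero hφ hω hq₀.ne' hq.ne, ?_⟩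
      rintro rfl
      have h := ModSharp.modNorm_smul (φ := φ) hq₀.ne' hq.ne hω.1 0 0
      have e : (0 : ℂ) • (0 : ModSharp.SigmaOneDual d) = 0 := by
        ext x
        simp
      rwa [e, enorm_zero, zero_mul] at h
    homogeneous := fun c u _ => ModSharp.modNorm_smul hq₀.ne' hq.ne hω.1 c u
    subadditive := fun u _ v _ => ModSharp.modNorm_add_rpow_le hq₀.ne' hq.ne hω.1 u v
    injective := ModSharp.toDual_injective
    map_mem := ModSharp.toDual_mem_modSharp φ hω hq₀.ne' hq.ne
    dense := fun _ hu _ hε => ModSharp.exists_modNorm_sub_toDual_lt hφ hω hq₀.ne' hq.ne hu hε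
    complete := fun _ hmem hs => ModSharp.modSharp_complete hφ hω hq₀.ne' hq.ne hmem hs }
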